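/- Let $M$ be a complete connected smooth Riemannian manifold of dimension $n$ with distance $d$. For a compact $k$-dimensional $C^1$ submanifold $K\subset M$ (embedded, without boundary, not necessarily connected), with normal bundle $NK\subset TM$ and normal exponential map $\exp^N:NK\to M$, define in $[0,\infty]$: - the thickness (normal injectivity radius) $i(K,M)=\sup\big(\{0\}\cup\{r>0:\exp^N \text{ is one-to-one on } \{v\in NK:\|v\|<r\}\}\big)$; - the ball radius $R_O(K,M)=\inf\{r>0: O(r;K)\cap K\neq\emptyset\}$ (with $\inf\emptyset=\infty$), where $O(r;K)=\bigcup_{p\in K}\ \bigcup_{w\in NK_p,\ \|w\|=1}B(\exp_p(rw),r)$ and $B(q,r)$ is the open metric ball. Fix a distance $d_G$ inducing the topology of the Grassmann bundle $G_{n,k}(TM)$ of $k$-planes tangent to $M$ (for instance the distance of a Riemannian metric on it), and for compact $k$-dimensional $C^1$ submanifolds $K,L$ put $$d_{C^1}(K,L)=\inf_{\psi}\ \sup_{x\in K}\big(d(x,\psi(x))+d_G(T_xK,T_{\psi(x)}L)\big),$$ the infimum being over all $C^1$ diffeomorphisms $\psi:K\to L$ (and $\infty$ if there are none). Let $K$ and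 $K_j$ $(j\in\mathbb N)$ be compact $k$-dimensional $C^1$ submanifolds of $M$ such that $K_j\to K$ in the $C^1$ sense, i.e. $d_{C^1}(K,K_j)\to 0$. Then $$\limsup_{j\to\infty}R_O(K_j,M)\le R_O(K,M)\qquad\text{and}\qquad \limsup_{j\to\infty}i(K_j,M)\le i(K,M).$$ -/

import Mathlib

open Set Filter Topology Manifold Bundle
open scoped ENNReal ContDiff

namespace RiemThick

noncomputable section

/-! ### Geodesics and the exponential map -/

section Geodesics

variable {n : ℕ} {M : Type*} [TopologicalSpace M] [ChartedSpace (EuclideanSpace ℝ (Fin n)) M]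

/-- The velocity vector `γ'(t)` of a curve, as a point of the tangent bundle. -/
def velocity (n : ℕ) {M : Type*} [TopologicalSpace M]
    [ChartedSpace (EuclideanSpace ℝ (Fin n)) M] (γ : ℝ → M) (t : ℝ) : TangentBundle (𝓡 n) M :=
  ⟨γ t, mfderiv 𝓘(ℝ, ℝ) (𝓡 n) γ t (1 : ℝ)⟩

/-- The coordinate vector field `∂ᵢ` of the preferred chart at `c`, at the point with
coordinates `y`. -/
def coordField (c : M) (i : Fin n) (y : EuclideanSpace ℝ (Fin n)) :
    TangentSpace (𝓡 n) ((extChartAt (𝓡 n) c).symm y) :=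
  mfderiv (𝓡 n) (𝓡 n) (extChartAt (𝓡 n) c).symm y (EuclideanSpace.single i (1 : ℝ))

variable [RiemannianBundle (fun x : M => TangentSpace (𝓡 n) x)]

/-- The matrix `gᵢⱼ = ⟨∂ᵢ, ∂ⱼ⟩` of the Riemannian metric in the preferred chart at `c`. -/
def gram (c : M) (y : EuclideanSpace ℝ (Fin n)) : Matrix (Fin n) (Fin n) ℝ :=
  Matrix.of fun i j => inner ℝ (coordField c i y) (coordField c j y)

/-- The partial derivative `∂ₗ gᵢⱼ`. -/
def dGram (c : M) (y : EuclideanSpace ℝ (Fin n)) (l i j : Fin n) : ℝ :=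
  fderiv ℝ (fun z => gram c z i j) y (EuclideanSpace.single l (1 : ℝ))

/-- The Christoffel symbol
`Γᵐᵢⱼ = ½ ∑ₗ gᵐˡ (∂ᵢ gⱼₗ + ∂ⱼ gᵢₗ - ∂ₗ gᵢⱼ)` of the Levi-Civita connection. -/
def christoffel (c : M) (y : EuclideanSpace ℝ (Fin n)) (m i j : Fin n) : ℝ :=
  (1 / 2) * ∑ l, (gram c y)⁻¹ m l * (dGram c y i j l + dGram c y j i l - dGram c y l i j)

/-- `γ : ℝ → M` is a geodesic: it is `C²` and in the charts of `M` it satisfies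
`xₘ'' + ∑ᵢⱼ Γᵐᵢⱼ xᵢ' xⱼ' = 0`. -/
def IsGeodesic (n : ℕ) {M : Type*} [TopologicalSpace M]
    [ChartedSpace (EuclideanSpace ℝ (Fin n)) M]
    [RiemannianBundle (fun x : M => TangentSpace (𝓡 n) x)] (γ : ℝ → M) : Prop :=
  ContMDiff 𝓘(ℝ, ℝ) (𝓡 n) 2 γ ∧
    ∀ (c : M) (t : ℝ), γ t ∈ (chartAt (EuclideanSpace ℝ (Fin n)) c).source → ∀ m : Fin n,
      deriv (deriv fun s => extChartAt (𝓡 n) c (γ s)) t m +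
        ∑ i, ∑ j, christoffel c (extChartAt (𝓡 n) c (γ t)) m i j *
          deriv (fun s => extChartAt (𝓡 n) c (γ s)) t i *
          deriv (fun s => extChartAt (𝓡 n) c (γ s)) t j = 0

open Classical in
/-- The exponential map: `exp v = γ(1)` for the geodesic `γ` with `γ'(0) = v`. (On a complete
manifold this geodesic exists and is unique; if there is none, the value is the foot of `v`.) -/
def expMap (v : TangentBundle (𝓡 n) M) : M :=
  if h : ∃ γ : ℝ → M, IsGeodesic n γ ∧ velocity n γ 0 = v then h.choose 1 else v.proj

end Geodesics

/-! ### Submanifolds -/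

section Submanifolds

/-- A `k`-dimensional (embedded) `C¹` submanifold without boundary of the `n`-manifold `M`: near
each of its points there is a `C¹` chart of `M` in which it is the coordinate plane
`ℝᵏ × {0}`. -/
structure C1Submanifold (n k : ℕ) (M : Type*) [TopologicalSpace M]
    [ChartedSpace (EuclideanSpace ℝ (Fin n)) M] where
  carrier : Set M
  dim_le : k ≤ n
  exists_slice : ∀ p ∈ carrier, ∃ Φ ∈ IsManifold.maximalAtlas (𝓡 n) 1 M, p ∈ Φ.source ∧
    ∀ x ∈ Φ.source, x ∈ carrier ↔ ∀ i : Fin n, k ≤ (i : ℕ) → Φ x i = 0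

variable {n k : ℕ} {M : Type*} [TopologicalSpace M] [ChartedSpace (EuclideanSpace ℝ (Fin n)) M]

/-- The tangent space `T_p K`: the velocities at `p` of the `C¹` curves in `K` through `p`.
(At the points of a `C¹` submanifold these velocities already form a linear subspace.) -/
def C1Submanifold.tangent (K : C1Submanifold n k M) (p : M) :
    Submodule ℝ (TangentSpace (𝓡 n) p) :=
  Submodule.span ℝ {v | ∃ γ : ℝ → M, ContMDiffAt 𝓘(ℝ, ℝ) (𝓡 n) 1 γ 0 ∧
    (∀ᶠ t in 𝓝 (0 : ℝ), γ t ∈ K.carrier) ∧ velocity n γ 0 = ⟨p, v⟩}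

/-- The tangent space in a slice chart: the vectors whose image under the differential of the
chart lies in `ℝᵏ × {0}`. -/
theorem C1Submanifold.mem_tangent_iff [IsManifold (𝓡 n) ∞ M] (K : C1Submanifold n k M) {p : M}
    (hp : p ∈ K.carrier) {Φ : OpenPartialHomeomorph M (EuclideanSpace ℝ (Fin n))}
    (hΦ : Φ ∈ IsManifold.maximalAtlas (𝓡 n) 1 M) (hpΦ : p ∈ Φ.source)
    (hK : ∀ x ∈ Φ.source, x ∈ K.carrier ↔ ∀ i : Fin n, k ≤ (i : ℕ) → Φ x i = 0)
    (v : TangentSpace (𝓡 n) p) :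
    v ∈ K.tangent p ↔ ∀ i : Fin n, k ≤ (i : ℕ) →
      WithLp.ofLp (p := 2) (V := Fin n → ℝ) (mfderiv (𝓡 n) (𝓡 n) Φ p v) i = 0 := by
  have hΦd : Φ.MDifferentiable (𝓡 n) (𝓡 n) :=
    ⟨(contMDiffOn_of_mem_maximalAtlas hΦ).mdifferentiableOn one_ne_zero,
      (contMDiffOn_symm_of_mem_maximalAtlas hΦ).mdifferentiableOn one_ne_zero⟩
  constructor
  · intro hv
    induction hv using Submodule.span_induction with
    | zero =>
      intro i _
      rw [map_zero]
      rfl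
    | add x y _ _ hx hy =>
      intro i hi
      rw [map_add]
      have h1 := hx i hi
      have h2 := hy i hi
      exact (congrArg₂ (· + ·) h1 h2).trans (add_zero 0)
    | smul a x _ hx =>
      intro i hi
      rw [map_smul]
      have h1 := hx i hi
      exact (congrArg (a * ·) h1).trans (mul_zero a)
    | mem v hv =>
      obtain ⟨γ, hγ, hγK, hvel⟩ := hv
      intro i hi
      obtain rfl : γ 0 = p := congrArg TotalSpace.proj hvel
      obtain rfl : mfderiv 𝓘(ℝ, ℝ) (𝓡 n) γ 0 (1 : ℝ) = v :=
        TotalSpace.mk_inj.1 hvel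
      have h1 : HasMFDerivAt 𝓘(ℝ, ℝ) (𝓡 n) γ 0 (mfderiv 𝓘(ℝ, ℝ) (𝓡 n) γ 0) :=
        (hγ.mdifferentiableAt one_ne_zero).hasMFDerivAt
      have h2 : HasMFDerivAt (𝓡 n) (𝓡 n) Φ (γ 0) (mfderiv (𝓡 n) (𝓡 n) Φ (γ 0)) :=
        (hΦd.mdifferentiableAt hpΦ).hasMFDerivAt
      have h3 := (HasMFDerivAt.comp (0 : ℝ) h2 h1).hasFDerivAt
      have h4 := (EuclideanSpace.proj i : EuclideanSpace ℝ (Fin n) →L[ℝ] ℝ).hasFDerivAt.comp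
        (0 : ℝ) h3
      have h5 : (fun t => Φ (γ t) i) =ᶠ[𝓝 (0 : ℝ)] fun _ => (0 : ℝ) := by
        filter_upwards [hγK, hγ.continuousAt.preimage_mem_nhds (Φ.open_source.mem_nhds hpΦ)]
          with t ht hts
        exact (hK _ hts).1 ht i hi
      have h6 := h4.unique ((hasFDerivAt_const (0 : ℝ) (0 : ℝ)).congr_of_eventuallyEq h5)
      exact congrArg (fun L : ℝ →L[ℝ] ℝ => L 1) h6
  · intro hv
    apply Submodule.subset_span
    set w : EuclideanSpace ℝ (Fin n) := mfderiv (𝓡 n) (𝓡 n) Φ p v with hw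
    have haff : ContDiff ℝ 1 (fun t : ℝ => Φ p + t • w) := by fun_prop
    have hΦp : Φ p ∈ Φ.target := Φ.map_source hpΦ
    have h0 : Φ p + (0 : ℝ) • w = Φ p := by simp
    have hsymm : ContMDiffAt (𝓡 n) (𝓡 n) 1 Φ.symm (Φ p + (0 : ℝ) • w) := by
      rw [h0]
      exact contMDiffAt_symm_of_mem_maximalAtlas hΦ hΦp
    refine ⟨fun t => Φ.symm (Φ p + t • w), ?_, ?_, ?_⟩
    · exact ContMDiffAt.comp (0 : ℝ) hsymm haff.contMDiff.contMDiffAt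
    · have : ∀ᶠ t in 𝓝 (0 : ℝ), Φ p + t • w ∈ Φ.target := by
        apply haff.continuous.continuousAt.preimage_mem_nhds
        rw [h0]
        exact Φ.open_target.mem_nhds hΦp
      filter_upwards [this] with t ht
      rw [hK _ (Φ.map_target ht)]
      intro i hi
      rw [Φ.right_inv ht]
      have h1 := (hK p hpΦ).1 hp i hi
      have h2 : w i = 0 := hv i hi
      simp [h1, h2]
    · have hL : HasMFDerivAt 𝓘(ℝ, ℝ) (𝓡 n) (fun t : ℝ => Φ p + t • w) 0
          (ContinuousLinearMap.toSpanSingleton ℝ w) := by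
        apply HasFDerivAt.hasMFDerivAt
        have := (((hasDerivAt_id (0 : ℝ)).smul_const w).const_add (Φ p)).hasFDerivAt
        rw [one_smul] at this
        exact this
      have hS : HasMFDerivAt (𝓡 n) (𝓡 n) Φ.symm (Φ p + (0 : ℝ) • w)
          (mfderiv (𝓡 n) (𝓡 n) Φ.symm (Φ p + (0 : ℝ) • w)) :=
        (hsymm.mdifferentiableAt one_ne_zero).hasMFDerivAt
      have hc := (HasMFDerivAt.comp (0 : ℝ) hS hL).mfderiv
      have hkey : (mfderiv (𝓡 n) (𝓡 n) Φ.symm (Φ p) w : EuclideanSpace ℝ (Fin n)) = v := by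
        have := hΦd.symm_comp_deriv hpΦ
        exact congrArg (fun L : EuclideanSpace ℝ (Fin n) →L[ℝ] EuclideanSpace ℝ (Fin n) => L v)
          this
      have e1 : (mfderiv 𝓘(ℝ, ℝ) (𝓡 n) (fun t : ℝ => Φ.symm (Φ p + t • w)) 0 (1 : ℝ) :
          EuclideanSpace ℝ (Fin n)) = v := by
        refine (congrArg (fun L : ℝ →L[ℝ] EuclideanSpace ℝ (Fin n) => L 1) hc).trans ?_
        rw [← hkey]
        change (mfderiv (𝓡 n) (𝓡 n) Φ.symm (Φ p + (0 : ℝ) • w) ((1 : ℝ) • w) :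
          EuclideanSpace ℝ (Fin n)) = _
        rw [one_smul, h0]
      have e0 : Φ.symm (Φ p + (0 : ℝ) • w) = p := by rw [h0, Φ.left_inv hpΦ]
      exact TotalSpace.ext e0 (heq_of_eq e1)

/-- The coordinate plane `ℝᵏ × {0}` in `ℝⁿ`. -/
def coordPlane (n k : ℕ) : Submodule ℝ (EuclideanSpace ℝ (Fin n)) where
  carrier := {v | ∀ i : Fin n, k ≤ (i : ℕ) → v i = 0}
  add_mem' := fun ha hb i hi => by simp [ha i hi, hb i hi]
  zero_mem' := fun i _ => rfl
  smul_mem' := fun c v hv i hi => by simp [hv i hi]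

theorem finrank_coordPlane {n k : ℕ} (h : k ≤ n) : Module.finrank ℝ (coordPlane n k) = k := by
  let e : coordPlane n k ≃ₗ[ℝ] (Fin k → ℝ) :=
    { toFun := fun v j => (v : EuclideanSpace ℝ (Fin n)) (Fin.castLE h j)
      map_add' := fun _ _ => rfl
      map_smul' := fun _ _ => rfl
      invFun := fun f => ⟨WithLp.toLp 2 fun i => if hi : (i : ℕ) < k then f ⟨i, hi⟩ else 0,
        fun i hi => by simp [not_lt.2 hi]⟩
      left_inv := fun v => by
        ext i
        by_cases hi : (i : ℕ) < k
        · simp [hi]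
        · simpa [hi] using (v.2 i (not_lt.1 hi)).symm
      right_inv := fun f => by
        ext j
        simp }
  rw [e.finrank_eq, Module.finrank_fin_fun]

theorem C1Submanifold.finrank_tangent [IsManifold (𝓡 n) ∞ M] (K : C1Submanifold n k M) {p : M}
    (hp : p ∈ K.carrier) : Module.finrank ℝ (K.tangent p) = k := by
  obtain ⟨Φ, hΦ, hpΦ, hK⟩ := K.exists_slice p hp
  have hΦd : Φ.MDifferentiable (𝓡 n) (𝓡 n) :=
    ⟨(contMDiffOn_of_mem_maximalAtlas hΦ).mdifferentiableOn one_ne_zero,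
      (contMDiffOn_symm_of_mem_maximalAtlas hΦ).mdifferentiableOn one_ne_zero⟩
  let e : TangentSpace (𝓡 n) p ≃ₗ[ℝ] EuclideanSpace ℝ (Fin n) := (hΦd.mfderiv hpΦ).toLinearEquiv
  have he : K.tangent p = (coordPlane n k).comap e.toLinearMap := by
    ext v
    exact K.mem_tangent_iff hp hΦ hpΦ hK v
  rw [he]
  refine ((e.submoduleMap _).finrank_eq.trans ?_).trans (finrank_coordPlane K.dim_le)
  rw [Submodule.map_comap_eq_of_surjective e.surjective]

end Submanifolds

/-! ### The Grassmann bundle -/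

section Grassmann

/-- The Grassmann bundle `G_{n,k}(TM)` of `k`-dimensional subspaces of the tangent spaces. -/
structure GrassmannBundle (n k : ℕ) (M : Type*) [TopologicalSpace M]
    [ChartedSpace (EuclideanSpace ℝ (Fin n)) M] where
  base : M
  plane : Submodule ℝ (TangentSpace (𝓡 n) base)
  finrank_plane : Module.finrank ℝ plane = k

variable {n k : ℕ} {M : Type*} [TopologicalSpace M] [ChartedSpace (EuclideanSpace ℝ (Fin n)) M]
  [IsManifold (𝓡 n) ∞ M]
  [RiemannianBundle (fun x : M => TangentSpace (𝓡 n) x)]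

instance finiteDimensional_tangentSpace (p : M) : FiniteDimensional ℝ (TangentSpace (𝓡 n) p) :=
  inferInstanceAs (FiniteDimensional ℝ (EuclideanSpace ℝ (Fin n)))

/-- A plane `V ⊆ T_p M`, seen as the orthogonal projection `T_p M → V ⊆ T_p M`, a point of the
total space of the bundle `End(TM)`. -/
def GrassmannBundle.toEnd (V : GrassmannBundle n k M) :
    TotalSpace (EuclideanSpace ℝ (Fin n) →L[ℝ] EuclideanSpace ℝ (Fin n))
      (fun p : M => TangentSpace (𝓡 n) p →L[ℝ] TangentSpace (𝓡 n) p) :=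
  ⟨V.base, V.plane.starProjection⟩

/-- The topology of the Grassmann bundle, as a subspace of `End(TM)`. -/
@[reducible] def GrassmannBundle.topology (n k : ℕ) (M : Type*) [TopologicalSpace M]
    [ChartedSpace (EuclideanSpace ℝ (Fin n)) M] [IsManifold (𝓡 n) ∞ M]
    [RiemannianBundle (fun x : M => TangentSpace (𝓡 n) x)] :
    TopologicalSpace (GrassmannBundle n k M) :=
  TopologicalSpace.induced GrassmannBundle.toEnd inferInstance

end Grassmann

/-! ### The `C¹` distance of submanifolds -/

section C1Distance

/-- `ψ` restricts to a `C¹` diffeomorphism from the submanifold `K` onto the submanifold `L`. (For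
a map on a `C¹` submanifold, `ContMDiffOn` of order `1` says that the map is `C¹` in the
submanifold's own charts.) -/
def IsC1Diffeo {n k : ℕ} {M : Type*} [TopologicalSpace M]
    [ChartedSpace (EuclideanSpace ℝ (Fin n)) M] (K L : C1Submanifold n k M) (ψ : M → M) : Prop :=
  MapsTo ψ K.carrier L.carrier ∧ ContMDiffOn (𝓡 n) (𝓡 n) 1 ψ K.carrier ∧
    ∃ φ : M → M, MapsTo φ L.carrier K.carrier ∧ ContMDiffOn (𝓡 n) (𝓡 n) 1 φ L.carrier ∧
      InvOn φ ψ K.carrier L.carrier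

variable {n k : ℕ} {M : Type*} [MetricSpace M] [ChartedSpace (EuclideanSpace ℝ (Fin n)) M]
  [IsManifold (𝓡 n) ∞ M]

/-- The tangent space `T_x K` as a point of the Grassmann bundle. -/
def C1Submanifold.gauss (K : C1Submanifold n k M) (x : K.carrier) : GrassmannBundle n k M :=
  ⟨x, K.tangent x, K.finrank_tangent x.2⟩

/-- The `C¹` distance
`inf_ψ sup_{x ∈ K} (d(x, ψ x) + d_G(T_x K, T_{ψ x} L))` over the `C¹` diffeomorphisms
`ψ : K → L`, with respect to a distance `d_G` on the Grassmann bundle; it is `∞` if there are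
none. -/
def c1Dist (dG : MetricSpace (GrassmannBundle n k M)) (K L : C1Submanifold n k M) : ℝ≥0∞ :=
  ⨅ (ψ : M → M) (h : IsC1Diffeo K L ψ), ⨆ x : K.carrier,
    ENNReal.ofReal
      (dist (x : M) (ψ x) + dG.dist (K.gauss x) (L.gauss ⟨ψ x, h.1 x.2⟩))

end C1Distance

/-! ### Thickness and ball radius -/

section Thickness

variable {n k : ℕ} {M : Type*} [MetricSpace M] [ChartedSpace (EuclideanSpace ℝ (Fin n)) M]
  [RiemannianBundle (fun x : M => TangentSpace (𝓡 n) x)]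

/-- The normal bundle `NK`, as a subset of `TM`. -/
def C1Submanifold.normalBundle (K : C1Submanifold n k M) : Set (TangentBundle (𝓡 n) M) :=
  {v | v.proj ∈ K.carrier ∧ v.2 ∈ (K.tangent v.proj)ᗮ}

/-- The thickness (normal injectivity radius) `i(K, M)`: the supremum of the `r > 0` for which
`exp` is one-to-one on `{v ∈ NK : ‖v‖ < r}` (and `0` if there are none). -/
def C1Submanifold.thickness (K : C1Submanifold n k M) : ℝ≥0∞ :=
  ⨆ (r : ℝ) (_ : 0 < r) (_ : InjOn expMap {v | v ∈ K.normalBundle ∧ ‖v.2‖ < r}), ENNReal.ofReal r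

/-- The set `O(r; K)`: the union of the open balls `B(exp_p (r w), r)` over the points `p ∈ K` and
the unit normal vectors `w` of `K` at `p`. -/
def C1Submanifold.ballUnion (K : C1Submanifold n k M) (r : ℝ) : Set M :=
  {x | ∃ p ∈ K.carrier, ∃ w ∈ (K.tangent p)ᗮ, ‖w‖ = 1 ∧
    x ∈ Metric.ball (expMap (⟨p, r • w⟩ : TangentBundle (𝓡 n) M)) r}

/-- The ball radius `R_O(K, M) = inf {r > 0 : O(r; K) ∩ K ≠ ∅}` (`∞` if there is no such `r`). -/
def C1Submanifold.ballRadius (K : C1Submanifold n k M) : ℝ≥0∞ :=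
  ⨅ (r : ℝ) (_ : 0 < r) (_ : (K.ballUnion r ∩ K.carrier).Nonempty), ENNReal.ofReal r

end Thickness

end

end RiemThick

/-! For a compact submanifold the thickness and the ball radius coincide, and the ball radius is
defined by an open condition. If a point `x` of `K` lies in the open ball of radius `r` about `exp_p
(r w)`, and `L` is `C¹`-close to `K` through `ψ`, then some unit normal `w'` of `L` at `ψ p` is
close to `w`, and continuity of the exponential map puts `ψ x` in the ball of radius `r` about `exp
(r w')`. So each radius that meets the condition for `K` eventually meets it for `K_j`
(`eventually_ballRadius_le`), which is the first inequality. The second is the chain `limsup i(K_j)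
≤ limsup R_O(K_j) ≤ R_O(K) ≤ i(K)`.

For `i ≤ R_O` (`thickness_le_ballRadius`): if `q = exp (r' w)` is closer than `r'` to `K`, a nearest
point of `K` is the foot of a normal vector shorter than `r'` with the same image `q`
(`exists_normal_foot`), so injectivity fails on every larger tube. For `R_O ≤ i`
(`ballRadius_le_thickness`): let two normal vectors have the same image. If their lengths differ,
the foot of the shorter lies in the ball given by the longer. If the lengths agree, the two
geodesics meet at an angle; prolonging one slightly past the meeting point and cutting the corner
(`exists_shortcut`) puts the foot of the other in the ball.

The Riemannian background is built from the geodesic equation in charts. That equation is the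
Euler–Lagrange equation of the energy, hence independent of the chart (`geodesicAt_iff`).
Completeness gives geodesics for all times (`exists_geodesic`), with a continuous flow
(`continuous_velocity_geod_left`). The second-order expansion of the energy around a geodesic
(`metric_expansion`) serves twice: bounded above it yields the first variation inequality
(`exists_first_variation`), and bounded below, with a Poincaré inequality, it yields local
minimality (`exists_minimizing_local`). From both come geodesics that run straight to a set
(`exists_geod_toward`) and their orthogonality at the nearest point. -/

namespace RiemThick

noncomputable section

set_option maxSynthPendingDepth 3
set_option linter.unusedSectionVars false

/-! ### Metric forms on a vector space and their Euler–Lagrange equation -/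

section MetricForms

variable {E : Type*} [NormedAddCommGroup E] [NormedSpace ℝ E]

/-- The Euler–Lagrange form of the energy `½ G_y(u, u)` at position `y`, velocity `u` and
acceleration `a`, evaluated at `w`. -/
def eulerLagrange (G : E → E →L[ℝ] E →L[ℝ] ℝ) (y u a w : E) : ℝ :=
  G y a w + fderiv ℝ G y u u w - (1 / 2) * fderiv ℝ G y w u u

theorem hasDerivAt_metric {G : E → E →L[ℝ] E →L[ℝ] ℝ} {x u h : ℝ → E} {x' u' h' : E} {t : ℝ}
    (hG : DifferentiableAt ℝ G (x t)) (hx : HasDerivAt x x' t) (hu : HasDerivAt u u' t)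
    (hh : HasDerivAt h h' t) :
    HasDerivAt (fun s => G (x s) (u s) (h s))
      (fderiv ℝ G (x t) x' (u t) (h t) + G (x t) u' (h t) + G (x t) (u t) h') t := by
  have h1 := (hG.hasFDerivAt.comp_hasDerivAt t hx).clm_apply hu
  have h2 := h1.clm_apply hh
  simpa using h2

/-- The pullback identity is differentiated along the line `y + t v`; the second derivative of `φ`
enters once for each argument. -/
theorem fderiv_pullback {G G' : E → E →L[ℝ] E →L[ℝ] ℝ} {φ : E → E} {y : E}
    (hφ : ContDiffAt ℝ 2 φ y) (hG : DifferentiableAt ℝ G y) (hG' : DifferentiableAt ℝ G' (φ y))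
    (h : ∀ᶠ z in 𝓝 y, ∀ u w, G z u w = G' (φ z) (fderiv ℝ φ z u) (fderiv ℝ φ z w)) (v u w : E) :
    fderiv ℝ G y v u w = fderiv ℝ G' (φ y) (fderiv ℝ φ y v) (fderiv ℝ φ y u) (fderiv ℝ φ y w) +
      G' (φ y) (fderiv ℝ (fderiv ℝ φ) y v u) (fderiv ℝ φ y w) +
      G' (φ y) (fderiv ℝ φ y u) (fderiv ℝ (fderiv ℝ φ) y v w) := by
  have hφ1 : DifferentiableAt ℝ φ y := hφ.differentiableAt two_ne_zero
  have hφ2 : DifferentiableAt ℝ (fderiv ℝ φ) y :=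
    (hφ.fderiv_right (m := 1) (by norm_num)).differentiableAt one_ne_zero
  have h0 : HasDerivAt (fun t : ℝ => y + t • v) v 0 := by
    simpa using ((hasDerivAt_id (0 : ℝ)).smul_const v).const_add y
  have e0 : y + (0 : ℝ) • v = y := by simp
  have hc : ∀ u : E, HasDerivAt (fun t : ℝ => fderiv ℝ φ (y + t • v) u)
      (fderiv ℝ (fderiv ℝ φ) y v u) 0 := by
    intro u
    have hf : HasFDerivAt (fderiv ℝ φ) (fderiv ℝ (fderiv ℝ φ) y) (y + (0 : ℝ) • v) := by
      rw [e0]; exact hφ2.hasFDerivAt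
    have h1 : HasDerivAt (fun t : ℝ => fderiv ℝ φ (y + t • v)) (fderiv ℝ (fderiv ℝ φ) y v) 0 :=
      HasFDerivAt.comp_hasDerivAt (f := fun t : ℝ => y + t • v) (0 : ℝ) hf h0
    have h2 := h1.clm_apply (hasDerivAt_const (0 : ℝ) u)
    rwa [map_zero, add_zero] at h2
  have hp : HasDerivAt (fun t : ℝ => φ (y + t • v)) (fderiv ℝ φ y v) 0 := by
    have hf : HasFDerivAt φ (fderiv ℝ φ y) (y + (0 : ℝ) • v) := by
      rw [e0]; exact hφ1.hasFDerivAt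
    exact HasFDerivAt.comp_hasDerivAt (f := fun t : ℝ => y + t • v) (0 : ℝ) hf h0
  have hr := hasDerivAt_metric (G := G') (x := fun t : ℝ => φ (y + t • v))
    (by simpa using hG') hp (hc u) (hc w)
  have hl := hasDerivAt_metric (G := G) (x := fun t : ℝ => y + t • v) (by simpa using hG) h0
    (hasDerivAt_const (0 : ℝ) u) (hasDerivAt_const (0 : ℝ) w)
  have hev : (fun s : ℝ => G (y + s • v) u w) =ᶠ[𝓝 0] fun s : ℝ =>
      G' (φ (y + s • v)) (fderiv ℝ φ (y + s • v) u) (fderiv ℝ φ (y + s • v) w) := by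
    have : Tendsto (fun s : ℝ => y + s • v) (𝓝 0) (𝓝 y) := by
      simpa using h0.continuousAt.tendsto
    filter_upwards [this.eventually h] with s hs using hs u w
  have := (hl.congr_of_eventuallyEq hev.symm).unique hr
  simpa using this

/-- The acceleration of `φ ∘ x` has the extra term `D²φ(u, u)`, and this is the term that `DG(u)(u,
w)` produces. The terms with `D²φ(u, w)` coming from the two derivatives of `G` cancel by the
symmetry of second derivatives. This is the chart independence of the geodesic equation. -/
theorem eulerLagrange_pullback {G G' : E → E →L[ℝ] E →L[ℝ] ℝ} {φ : E → E} {y : E}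
    (hφ : ContDiffAt ℝ 2 φ y) (hG : DifferentiableAt ℝ G y) (hG' : DifferentiableAt ℝ G' (φ y))
    (hsymm : ∀ u w, G' (φ y) u w = G' (φ y) w u)
    (h : ∀ᶠ z in 𝓝 y, ∀ u w, G z u w = G' (φ z) (fderiv ℝ φ z u) (fderiv ℝ φ z w)) (u a w : E) :
    eulerLagrange G y u a w = eulerLagrange G' (φ y) (fderiv ℝ φ y u)
      (fderiv ℝ (fderiv ℝ φ) y u u + fderiv ℝ φ y a) (fderiv ℝ φ y w) := by
  have hs : fderiv ℝ (fderiv ℝ φ) y u w = fderiv ℝ (fderiv ℝ φ) y w u :=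
    hφ.isSymmSndFDerivAt (by simp) u w
  simp only [eulerLagrange]
  rw [h.self_of_nhds, fderiv_pullback hφ hG hG' h, fderiv_pullback hφ hG hG' h, hs,
    hsymm (fderiv ℝ (fderiv ℝ φ) y w u)]
  simp only [map_add, add_apply]
  ring

/-- Conservation of energy: the derivative of `G(u, u)` is twice the Euler–Lagrange form tested on
`w = u`. -/
theorem hasDerivAt_speed_sq {G : E → E →L[ℝ] E →L[ℝ] ℝ} {x u : ℝ → E} {a : E} {t : ℝ}
    (hG : DifferentiableAt ℝ G (x t)) (hsymm : ∀ u w, G (x t) u w = G (x t) w u)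
    (hx : HasDerivAt x (u t) t) (hu : HasDerivAt u a t)
    (hEL : ∀ w, eulerLagrange G (x t) (u t) a w = 0) :
    HasDerivAt (fun s => G (x s) (u s) (u s)) 0 t := by
  have h := hasDerivAt_metric hG hx hu hu
  convert! h using 1
  have := hEL (u t)
  simp only [eulerLagrange] at this
  rw [hsymm (u t) a]
  linarith

/-- Bounds for a metric form on a ball. -/
structure MetricBounds (G : E → E →L[ℝ] E →L[ℝ] ℝ) (y₀ : E) (R lam C : ℝ) : Prop where
  R_pos : 0 < R
  lam_pos : 0 < lam
  C_nonneg : 0 ≤ C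
  contDiffOn : ContDiffOn ℝ 2 G (Metric.ball y₀ R)
  symm : ∀ y ∈ Metric.ball y₀ R, ∀ u w, G y u w = G y w u
  lower : ∀ y ∈ Metric.ball y₀ R, ∀ u, lam * ‖u‖ ^ 2 ≤ G y u u
  upper : ∀ y ∈ Metric.ball y₀ R, ∀ u w, |G y u w| ≤ C * ‖u‖ * ‖w‖
  lip : ∀ y ∈ Metric.ball y₀ R, ∀ z ∈ Metric.ball y₀ R, ‖G z - G y‖ ≤ C * ‖z - y‖
  taylor : ∀ y ∈ Metric.ball y₀ R, ∀ z ∈ Metric.ball y₀ R,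
    ‖G z - G y - fderiv ℝ G y (z - y)‖ ≤ C * ‖z - y‖ ^ 2

/-- Compactness of the unit sphere makes positivity at the centre uniform, and half of the bound
survives nearby by continuity. The map `fderiv ℝ G` is `C¹`, hence Lipschitz near `y₀`, which gives
the Taylor estimate. -/
theorem exists_metricBounds [FiniteDimensional ℝ E] {G : E → E →L[ℝ] E →L[ℝ] ℝ} {U : Set E}
    (hU : IsOpen U) {y₀ : E} (hy₀ : y₀ ∈ U) (hG : ContDiffOn ℝ 2 G U)
    (hsymm : ∀ y ∈ U, ∀ u w, G y u w = G y w u) (hpos : ∀ u, u ≠ 0 → 0 < G y₀ u u) :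
    ∃ R lam C, MetricBounds G y₀ R lam C ∧ Metric.ball y₀ R ⊆ U := by
  have hGat : ContDiffAt ℝ 2 G y₀ := hG.contDiffAt (hU.mem_nhds hy₀)
  -- lower bound at the centre
  obtain ⟨l, hl, hlow⟩ : ∃ l > 0, ∀ u, l * ‖u‖ ^ 2 ≤ G y₀ u u := by
    rcases subsingleton_or_nontrivial E with hE | hE
    · exact ⟨1, one_pos, fun u => by simp [Subsingleton.elim u 0]⟩
    · have hc : IsCompact (Metric.sphere (0 : E) 1) := isCompact_sphere 0 1
      have hne : (Metric.sphere (0 : E) 1).Nonempty := NormedSpace.sphere_nonempty.2 zero_le_one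
      have hcont : ContinuousOn (fun u => G y₀ u u) (Metric.sphere (0 : E) 1) :=
        ((G y₀).continuous.clm_apply continuous_id).continuousOn
      obtain ⟨u₀, hu₀, hmin⟩ := hc.exists_isMinOn hne hcont
      refine ⟨G y₀ u₀ u₀, hpos _ (by rintro rfl; simp at hu₀), fun u => ?_⟩
      by_cases hu : u = 0
      · simp [hu]
      have hun : ‖u‖ ≠ 0 := norm_ne_zero_iff.2 hu
      have : ‖u‖⁻¹ • u ∈ Metric.sphere (0 : E) 1 := by
        simp [norm_smul, hun]
      have h1 : G y₀ u₀ u₀ ≤ G y₀ (‖u‖⁻¹ • u) (‖u‖⁻¹ • u) := hmin this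
      simp only [map_smul, smul_apply, smul_eq_mul] at h1
      calc G y₀ u₀ u₀ * ‖u‖ ^ 2 ≤ (‖u‖⁻¹ * (‖u‖⁻¹ * G y₀ u u)) * ‖u‖ ^ 2 := by gcongr
        _ = G y₀ u u := by field_simp
  have hdG : ContDiffAt ℝ 1 (fderiv ℝ G) y₀ := hGat.fderiv_right (by norm_num)
  obtain ⟨K, s, hs, hK⟩ := hdG.exists_lipschitzOnWith
  have hcG : ContinuousAt G y₀ := hGat.continuousAt
  have hcd : ContinuousAt (fderiv ℝ G) y₀ := hdG.continuousAt
  have e1 : ∀ᶠ y in 𝓝 y₀, ‖G y - G y₀‖ < l / 2 := by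
    have := Metric.continuousAt_iff'.1 hcG (l / 2) (by positivity)
    simpa [dist_eq_norm] using this
  have e2 : ∀ᶠ y in 𝓝 y₀, ‖fderiv ℝ G y‖ < ‖fderiv ℝ G y₀‖ + 1 :=
    hcd.norm.eventually_lt continuousAt_const (by linarith)
  have e3 : ∀ᶠ y in 𝓝 y₀, ‖G y‖ < ‖G y₀‖ + 1 :=
    hcG.norm.eventually_lt continuousAt_const (by linarith)
  obtain ⟨R, hR, hball⟩ := Metric.eventually_nhds_iff_ball.1
    ((e1.and (e2.and e3)).and ((eventually_mem_nhds_iff.2 hs |>.self_of_nhds |> fun h =>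
      (eventually_of_mem h fun _ h => h)).and (hU.mem_nhds hy₀)))
  have hBU : Metric.ball y₀ R ⊆ U := fun y hy => (hball y hy).2.2
  set C : ℝ := (‖fderiv ℝ G y₀‖ + 1) + (‖G y₀‖ + 1) + K with hC
  have hK0 : (0 : ℝ) ≤ K := K.2
  have hd : ∀ y ∈ Metric.ball y₀ R, HasFDerivAt G (fderiv ℝ G y) y := fun y hy =>
    ((hG.contDiffAt (hU.mem_nhds (hBU hy))).differentiableAt two_ne_zero).hasFDerivAt
  refine ⟨R, l / 2, C, ⟨hR, by positivity, by positivity, hG.mono hBU,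
    fun y hy => hsymm y (hBU hy), ?_, ?_, ?_, ?_⟩, hBU⟩
  · intro y hy u
    have h1 := (hball y hy).1.1
    have h2 : |(G y - G y₀) u u| ≤ ‖G y - G y₀‖ * ‖u‖ * ‖u‖ := by
      simpa using (G y - G y₀).le_opNorm₂ u u
    have h3 : ‖G y - G y₀‖ * ‖u‖ * ‖u‖ ≤ l / 2 * ‖u‖ * ‖u‖ := by gcongr
    have h4 := abs_le.1 (h2.trans h3)
    have h5 := hlow u
    simp only [sub_apply] at h4
    nlinarith [h4.1]
  · intro y hy u w
    have h1 := (hball y hy).1.2.2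
    calc |G y u w| ≤ ‖G y‖ * ‖u‖ * ‖w‖ := by simpa using (G y).le_opNorm₂ u w
      _ ≤ C * ‖u‖ * ‖w‖ := by
        gcongr
        have := norm_nonneg (fderiv ℝ G y₀)
        linarith
  · intro y hy z hz
    have := (convex_ball y₀ R).norm_image_sub_le_of_norm_hasFDerivWithin_le
      (fun y hy => (hd y hy).hasFDerivWithinAt) (C := ‖fderiv ℝ G y₀‖ + 1)
      (fun y hy => (hball y hy).1.2.1.le) hy hz
    refine this.trans ?_
    gcongr
    have := norm_nonneg (G y₀)
    linarith
  · intro y hy z hz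
    -- Restricting to the points within `‖z - y‖` of `y` keeps the derivative within `K ‖z - y‖` of
    -- its value at `y`, so the mean value inequality gives a quadratic bound.
    set B := Metric.ball y₀ R ∩ Metric.closedBall y ‖z - y‖
    have hBc : Convex ℝ B := (convex_ball _ _).inter (convex_closedBall _ _)
    have := hBc.norm_image_sub_le_of_norm_hasFDerivWithin_le'
      (fun p hp => (hd p hp.1).hasFDerivWithinAt) (φ := fderiv ℝ G y) (C := K * ‖z - y‖)
      (fun p hp => ?_) (x := y) (y := z) ⟨hy, by simp⟩ ⟨hz, by simp [dist_eq_norm]⟩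
    · refine this.trans ?_
      rw [mul_assoc, ← sq]
      gcongr
      have h1 := norm_nonneg (G y₀)
      have h2 := norm_nonneg (fderiv ℝ G y₀)
      linarith
    · have h1 := hK.dist_le_mul p (hball p hp.1).2.1 y (hball y hy).2.1
      rw [dist_eq_norm] at h1
      refine h1.trans ?_
      gcongr
      exact hp.2

end MetricForms

/-! ### Energy of a geodesic compared with its variations -/

section EnergyComparison

variable {E : Type*} [NormedAddCommGroup E] [NormedSpace ℝ E]
  {G : E → E →L[ℝ] E →L[ℝ] ℝ} {y₀ : E} {R lam C : ℝ}

/-- An exact identity, sorted into order zero, the part linear in `(h, η)`, and a remainder of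
second order. Along a geodesic the linear part integrates to boundary terms, so only the remainder
has to be estimated. -/
theorem metric_expansion (G : E → E →L[ℝ] E →L[ℝ] ℝ) (y h u η : E)
    (hz : ∀ u w, G (y + h) u w = G (y + h) w u) :
    1 / 2 * G (y + h) (u + η) (u + η) = 1 / 2 * G y u u +
      (1 / 2 * fderiv ℝ G y h u u + G y u η) + (1 / 2 * G (y + h) η η + (G (y + h) - G y) u η +
        1 / 2 * (G (y + h) - G y - fderiv ℝ G y h) u u) := by
  simp only [map_add, add_apply, sub_apply]
  rw [hz η u]
  ring

theorem MetricBounds.abs_lip (hB : MetricBounds G y₀ R lam C) {y h : E}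
    (hy : y ∈ Metric.ball y₀ R) (hz : y + h ∈ Metric.ball y₀ R) (u η : E) :
    |(G (y + h) - G y) u η| ≤ C * ‖h‖ * ‖u‖ * ‖η‖ := by
  have h1 := (G (y + h) - G y).le_opNorm₂ u η
  have h2 := hB.lip y hy _ hz
  rw [add_sub_cancel_left] at h2
  rw [Real.norm_eq_abs] at h1
  exact h1.trans (by gcongr)

theorem MetricBounds.abs_taylor (hB : MetricBounds G y₀ R lam C) {y h : E}
    (hy : y ∈ Metric.ball y₀ R) (hz : y + h ∈ Metric.ball y₀ R) (u : E) :
    |(G (y + h) - G y - fderiv ℝ G y h) u u| ≤ C * ‖h‖ ^ 2 * ‖u‖ * ‖u‖ := by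
  have h1 := (G (y + h) - G y - fderiv ℝ G y h).le_opNorm₂ u u
  have h2 := hB.taylor y hy _ hz
  rw [add_sub_cancel_left] at h2
  rw [Real.norm_eq_abs] at h1
  exact h1.trans (by gcongr)

theorem MetricBounds.expansion_ge (hB : MetricBounds G y₀ R lam C) {y h : E}
    (hy : y ∈ Metric.ball y₀ R) (hz : y + h ∈ Metric.ball y₀ R) (u η : E) :
    1 / 2 * G y u u + (1 / 2 * fderiv ℝ G y h u u + G y u η) +
      (lam / 2 * ‖η‖ ^ 2 - C * ‖h‖ * ‖u‖ * ‖η‖ - C / 2 * ‖h‖ ^ 2 * ‖u‖ ^ 2) ≤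
      1 / 2 * G (y + h) (u + η) (u + η) := by
  rw [metric_expansion G y h u η (hB.symm _ hz)]
  have h1 := abs_le.1 (hB.abs_lip hy hz u η)
  have h2 := abs_le.1 (hB.abs_taylor hy hz u)
  have h3 := hB.lower _ hz η
  linarith [h1.1, h2.1]

theorem MetricBounds.expansion_le (hB : MetricBounds G y₀ R lam C) {y h : E}
    (hy : y ∈ Metric.ball y₀ R) (hz : y + h ∈ Metric.ball y₀ R) (u η : E) :
    1 / 2 * G (y + h) (u + η) (u + η) ≤
      1 / 2 * G y u u + (1 / 2 * fderiv ℝ G y h u u + G y u η) +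
      (C / 2 * ‖η‖ ^ 2 + C * ‖h‖ * ‖u‖ * ‖η‖ + C / 2 * ‖h‖ ^ 2 * ‖u‖ ^ 2) := by
  rw [metric_expansion G y h u η (hB.symm _ hz)]
  have h1 := abs_le.1 (hB.abs_lip hy hz u η)
  have h2 := abs_le.1 (hB.abs_taylor hy hz u)
  have h3 := abs_le.1 (hB.upper _ hz η η)
  linarith [h1.2, h2.2, h3.2]

theorem MetricBounds.continuousOn_metric (hB : MetricBounds G y₀ R lam C) {s : Set ℝ}
    {X U V : ℝ → E} (hX : ContinuousOn X s) (hXB : MapsTo X s (Metric.ball y₀ R))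
    (hU : ContinuousOn U s) (hV : ContinuousOn V s) :
    ContinuousOn (fun t => G (X t) (U t) (V t)) s :=
  ((hB.contDiffOn.continuousOn.comp hX hXB).clm_apply hU).clm_apply hV

theorem MetricBounds.continuousOn_fderiv (hB : MetricBounds G y₀ R lam C) {s : Set ℝ}
    {X H U V : ℝ → E} (hX : ContinuousOn X s) (hXB : MapsTo X s (Metric.ball y₀ R))
    (hH : ContinuousOn H s) (hU : ContinuousOn U s) (hV : ContinuousOn V s) :
    ContinuousOn (fun t => fderiv ℝ G (X t) (H t) (U t) (V t)) s :=
  ((((hB.contDiffOn.continuousOn_fderiv_of_isOpen Metric.isOpen_ball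
    (by norm_num)).comp hX hXB).clm_apply hH).clm_apply hU).clm_apply hV

/-- A curve `X` that is a geodesic for the metric form `G` up to a change of time with speed `m`,
along with a variation field `h` of velocity `m η`. -/
structure GeodesicVariation (G : E → E →L[ℝ] E →L[ℝ] ℝ) (y₀ : E) (R a b : ℝ) (m : ℝ → ℝ)
    (X U h η : ℝ → E) : Prop where
  le : a ≤ b
  cont_m : ContinuousOn m (Icc a b)
  cont_X : ContinuousOn X (Icc a b)
  cont_U : ContinuousOn U (Icc a b)
  cont_h : ContinuousOn h (Icc a b)
  cont_η : ContinuousOn η (Icc a b)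
  nonneg_m : ∀ t ∈ Icc a b, 0 ≤ m t
  mapsTo_X : MapsTo X (Icc a b) (Metric.ball y₀ R)
  mapsTo_add : MapsTo (fun t => X t + h t) (Icc a b) (Metric.ball y₀ R)
  deriv_X : ∀ t ∈ Ioo a b, HasDerivAt X (m t • U t) t
  deriv_h : ∀ t ∈ Ioo a b, HasDerivAt h (m t • η t) t
  deriv_U : ∀ t ∈ Ioo a b, ∃ A, HasDerivAt U (m t • A) t ∧
    ∀ w, eulerLagrange G (X t) (U t) A w = 0

variable {a b : ℝ} {m : ℝ → ℝ} {X U h η : ℝ → E}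

theorem GeodesicVariation.intervalIntegrable_energy (hV : GeodesicVariation G y₀ R a b m X U h η)
    (hB : MetricBounds G y₀ R lam C) :
    IntervalIntegrable (fun t => m t * (1 / 2 * G (X t) (U t) (U t))) MeasureTheory.volume a b :=
  ContinuousOn.intervalIntegrable_of_Icc hV.le (hV.cont_m.mul
    ((hB.continuousOn_metric hV.cont_X hV.mapsTo_X hV.cont_U hV.cont_U).const_mul (1 / 2)))

theorem GeodesicVariation.intervalIntegrable_linear (hV : GeodesicVariation G y₀ R a b m X U h η)
    (hB : MetricBounds G y₀ R lam C) :
    IntervalIntegrable (fun t => m t * (1 / 2 * fderiv ℝ G (X t) (h t) (U t) (U t) +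
      G (X t) (U t) (η t))) MeasureTheory.volume a b :=
  ContinuousOn.intervalIntegrable_of_Icc hV.le (hV.cont_m.mul
    (((hB.continuousOn_fderiv hV.cont_X hV.mapsTo_X hV.cont_h hV.cont_U
      hV.cont_U).const_mul (1 / 2)).add
      (hB.continuousOn_metric hV.cont_X hV.mapsTo_X hV.cont_U hV.cont_η)))

theorem GeodesicVariation.intervalIntegrable_energy_add
    (hV : GeodesicVariation G y₀ R a b m X U h η) (hB : MetricBounds G y₀ R lam C) :
    IntervalIntegrable (fun t => m t * (1 / 2 * G (X t + h t) (U t + η t) (U t + η t)))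
      MeasureTheory.volume a b :=
  ContinuousOn.intervalIntegrable_of_Icc hV.le (hV.cont_m.mul
    ((hB.continuousOn_metric (hV.cont_X.add hV.cont_h) hV.mapsTo_add (hV.cont_U.add hV.cont_η)
      (hV.cont_U.add hV.cont_η)).const_mul (1 / 2)))

/-- By the Euler–Lagrange equation the linear part of the expansion is the derivative of `G(U, h)`;
this is the first variation formula, with the weight `m` absorbing the change of time. -/
theorem GeodesicVariation.integral_linear (hV : GeodesicVariation G y₀ R a b m X U h η)
    (hB : MetricBounds G y₀ R lam C) :
    ∫ t in a..b, m t * (1 / 2 * fderiv ℝ G (X t) (h t) (U t) (U t) + G (X t) (U t) (η t)) =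
      G (X b) (U b) (h b) - G (X a) (U a) (h a) := by
  apply intervalIntegral.integral_eq_sub_of_hasDerivAt_of_le hV.le
    (f := fun t => G (X t) (U t) (h t))
  · exact hB.continuousOn_metric hV.cont_X hV.mapsTo_X hV.cont_U hV.cont_h
  · intro t ht
    have ht' := Ioo_subset_Icc_self ht
    obtain ⟨A, hA, hEL⟩ := hV.deriv_U t ht
    have hd : DifferentiableAt ℝ G (X t) :=
      (hB.contDiffOn.contDiffAt (Metric.isOpen_ball.mem_nhds (hV.mapsTo_X ht'))).differentiableAt
        two_ne_zero
    convert! hasDerivAt_metric hd (hV.deriv_X t ht) hA (hV.deriv_h t ht) using 1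
    have := hEL (h t)
    simp only [eulerLagrange] at this
    simp only [map_smul, smul_apply, smul_eq_mul]
    linear_combination (-m t) * this
  · exact hV.intervalIntegrable_linear hB

theorem GeodesicVariation.energy_ge (hV : GeodesicVariation G y₀ R a b m X U h η)
    (hB : MetricBounds G y₀ R lam C) {ρ : ℝ → ℝ} (hρ : ContinuousOn ρ (Icc a b))
    (hle : ∀ t ∈ Icc a b, ρ t ≤ lam / 2 * ‖η t‖ ^ 2 - C * ‖h t‖ * ‖U t‖ * ‖η t‖ -
      C / 2 * ‖h t‖ ^ 2 * ‖U t‖ ^ 2) :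
    (∫ t in a..b, m t * (1 / 2 * G (X t) (U t) (U t))) +
      (G (X b) (U b) (h b) - G (X a) (U a) (h a)) + ∫ t in a..b, m t * ρ t ≤
    ∫ t in a..b, m t * (1 / 2 * G (X t + h t) (U t + η t) (U t + η t)) := by
  have c1 := hV.intervalIntegrable_energy hB
  have c2 := hV.intervalIntegrable_linear hB
  have c3 : IntervalIntegrable (fun t => m t * ρ t) MeasureTheory.volume a b :=
    ContinuousOn.intervalIntegrable_of_Icc hV.le (hV.cont_m.mul hρ)
  have c4 := hV.intervalIntegrable_energy_add hB
  rw [← hV.integral_linear hB, ← intervalIntegral.integral_add c1 c2, ← intervalIntegral.integral_add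
    (c1.add c2) c3]
  apply intervalIntegral.integral_mono_on hV.le
    ((c1.add c2).add c3)
    c4
  intro t ht
  have h1 := hB.expansion_ge (hV.mapsTo_X ht) (hV.mapsTo_add ht) (U t) (η t)
  have h2 := hle t ht
  rw [← mul_add, ← mul_add]
  exact mul_le_mul_of_nonneg_left (by linarith) (hV.nonneg_m t ht)

theorem GeodesicVariation.energy_le (hV : GeodesicVariation G y₀ R a b m X U h η)
    (hB : MetricBounds G y₀ R lam C) {ρ : ℝ → ℝ} (hρ : ContinuousOn ρ (Icc a b))
    (hle : ∀ t ∈ Icc a b, C / 2 * ‖η t‖ ^ 2 + C * ‖h t‖ * ‖U t‖ * ‖η t‖ +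
      C / 2 * ‖h t‖ ^ 2 * ‖U t‖ ^ 2 ≤ ρ t) :
    ∫ t in a..b, m t * (1 / 2 * G (X t + h t) (U t + η t) (U t + η t)) ≤
    (∫ t in a..b, m t * (1 / 2 * G (X t) (U t) (U t))) +
      (G (X b) (U b) (h b) - G (X a) (U a) (h a)) + ∫ t in a..b, m t * ρ t := by
  have c1 := hV.intervalIntegrable_energy hB
  have c2 := hV.intervalIntegrable_linear hB
  have c3 : IntervalIntegrable (fun t => m t * ρ t) MeasureTheory.volume a b :=
    ContinuousOn.intervalIntegrable_of_Icc hV.le (hV.cont_m.mul hρ)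
  have c4 := hV.intervalIntegrable_energy_add hB
  rw [← hV.integral_linear hB, ← intervalIntegral.integral_add c1 c2, ← intervalIntegral.integral_add
    (c1.add c2) c3]
  apply intervalIntegral.integral_mono_on hV.le c4
    ((c1.add c2).add c3)
  intro t ht
  have h1 := hB.expansion_le (hV.mapsTo_X ht) (hV.mapsTo_add ht) (U t) (η t)
  have h2 := hle t ht
  rw [← mul_add, ← mul_add]
  exact mul_le_mul_of_nonneg_left (by linarith) (hV.nonneg_m t ht)

/-- A Poincaré inequality for the variation field. -/
theorem GeodesicVariation.poincare [CompleteSpace E]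
    (hV : GeodesicVariation G y₀ R a b m X U h η) (ha : h a = 0) (hm : ∫ t in a..b, m t ≤ 1) :
    ∫ t in a..b, m t * ‖h t‖ ^ 2 ≤ ∫ t in a..b, m t * ‖η t‖ ^ 2 := by
  -- Since `h` vanishes at `a`, the fundamental theorem of calculus gives `‖h‖ ≤ I` everywhere.
  set I := ∫ t in a..b, m t * ‖η t‖ with hI
  have cη := hV.cont_m.mul hV.cont_η.norm
  have cη2 := hV.cont_m.mul (hV.cont_η.norm.pow 2)
  have ch2 := hV.cont_m.mul (hV.cont_h.norm.pow 2)
  have cm := hV.cont_m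
  have hu := uIcc_of_le hV.le
  have hI0 : 0 ≤ I := intervalIntegral.integral_nonneg hV.le fun t ht =>
    mul_nonneg (hV.nonneg_m t ht) (norm_nonneg _)
  have hbound : ∀ t ∈ Icc a b, ‖h t‖ ≤ I := by
    intro t ht
    have hsub : Icc a t ⊆ Icc a b := Icc_subset_Icc_right ht.2
    have h1 : ∫ s in a..t, m s • η s = h t - h a := by
      apply intervalIntegral.integral_eq_sub_of_hasDerivAt_of_le ht.1 (hV.cont_h.mono hsub)
        (fun s hs => hV.deriv_h s ⟨hs.1, hs.2.trans_le ht.2⟩)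
      apply ContinuousOn.intervalIntegrable
      rw [uIcc_of_le ht.1]
      exact (hV.cont_m.smul hV.cont_η).mono hsub
    rw [ha, sub_zero] at h1
    rw [← h1]
    calc ‖∫ s in a..t, m s • η s‖ ≤ ∫ s in a..t, ‖m s • η s‖ :=
          intervalIntegral.norm_integral_le_integral_norm ht.1
      _ = ∫ s in a..t, m s * ‖η s‖ := by
          apply intervalIntegral.integral_congr
          intro s hs
          rw [uIcc_of_le ht.1] at hs
          simp [norm_smul, abs_of_nonneg (hV.nonneg_m s (hsub hs))]
      _ ≤ I := by
          apply intervalIntegral.integral_mono_interval le_rfl ht.1 ht.2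
          · filter_upwards [MeasureTheory.ae_restrict_mem measurableSet_Ioc] with s hs
            exact mul_nonneg (hV.nonneg_m s (Ioc_subset_Icc_self hs)) (norm_nonneg _)
          · exact (hu ▸ cη).intervalIntegrable
  have hm0 : 0 ≤ ∫ t in a..b, m t :=
    intervalIntegral.integral_nonneg hV.le hV.nonneg_m
  have h1 : ∫ t in a..b, m t * ‖h t‖ ^ 2 ≤ I ^ 2 := by
    calc ∫ t in a..b, m t * ‖h t‖ ^ 2 ≤ ∫ t in a..b, m t * I ^ 2 := by
          apply intervalIntegral.integral_mono_on hV.le (hu ▸ ch2).intervalIntegrable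
            (hu ▸ (cm.mul continuousOn_const)).intervalIntegrable
          intro t ht
          have := hbound t ht
          have := hV.nonneg_m t ht
          gcongr
      _ = (∫ t in a..b, m t) * I ^ 2 := by rw [intervalIntegral.integral_mul_const]
      _ ≤ 1 * I ^ 2 := by gcongr
      _ = I ^ 2 := one_mul _
  -- Cauchy–Schwarz by hand: expanding this square and using `∫ m ≤ 1` gives `I² ≤ ∫ m ‖η‖²`.
  have h2 : 0 ≤ ∫ t in a..b, m t * (‖η t‖ - I) ^ 2 :=
    intervalIntegral.integral_nonneg hV.le fun t ht =>
      mul_nonneg (hV.nonneg_m t ht) (sq_nonneg _)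
  have h3 : ∫ t in a..b, m t * (‖η t‖ - I) ^ 2 = (∫ t in a..b, m t * ‖η t‖ ^ 2) -
      2 * I * I + I ^ 2 * ∫ t in a..b, m t := by
    have e : ∀ t, m t * (‖η t‖ - I) ^ 2 = m t * ‖η t‖ ^ 2 - 2 * I * (m t * ‖η t‖) + I ^ 2 * m t :=
      fun t => by ring
    simp only [e]
    rw [intervalIntegral.integral_add, intervalIntegral.integral_sub,
      intervalIntegral.integral_const_mul, intervalIntegral.integral_const_mul, ← hI]
    · exact (hu ▸ cη2).intervalIntegrable
    · exact ((hu ▸ cη).intervalIntegrable).const_mul _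
    · exact ((hu ▸ cη2).intervalIntegrable).sub (((hu ▸ cη).intervalIntegrable).const_mul _)
    · exact ((hu ▸ cm).intervalIntegrable).const_mul _
  nlinarith [sq_nonneg I]

/-- Short geodesics minimize the energy among the curves in the ball with the same endpoints. -/
theorem GeodesicVariation.energy_min [CompleteSpace E]
    (hV : GeodesicVariation G y₀ R a b m X U h η) (hB : MetricBounds G y₀ R lam C)
    (ha : h a = 0) (hb : h b = 0) (hm : ∫ t in a..b, m t ≤ 1) {ν : ℝ}
    (hU : ∀ t ∈ Icc a b, ‖U t‖ ≤ ν) (hν : C * ν + C / 2 * ν ^ 2 ≤ lam / 2) :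
    ∫ t in a..b, m t * (1 / 2 * G (X t) (U t) (U t)) ≤
      ∫ t in a..b, m t * (1 / 2 * G (X t + h t) (U t + η t) (U t + η t)) := by
  have hu := uIcc_of_le hV.le
  have cη2 := hV.cont_m.mul (hV.cont_η.norm.pow 2)
  have ch2 := hV.cont_m.mul (hV.cont_h.norm.pow 2)
  have hν0 : 0 ≤ ν := (norm_nonneg _).trans (hU a ⟨le_rfl, hV.le⟩)
  have hC := hB.C_nonneg
  -- The cross term is split by `2 ‖h‖ ‖η‖ ≤ ‖h‖² + ‖η‖²`. The Poincaré inequality then trades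
  -- `‖h‖²` for `‖η‖²`, leaving the coefficient `lam / 2 - C ν - C ν² / 2`, nonnegative by `hν`.
  have key := hV.energy_ge hB
    (ρ := fun t => (lam / 2 - C * ν / 2) * ‖η t‖ ^ 2 - (C * ν / 2 + C / 2 * ν ^ 2) * ‖h t‖ ^ 2)
    (((hV.cont_η.norm.pow 2).const_mul _).sub ((hV.cont_h.norm.pow 2).const_mul _)) (by
      intro t ht
      have h1 := hU t ht
      have h2 : C * ‖h t‖ * ‖U t‖ * ‖η t‖ ≤ C * ‖h t‖ * ν * ‖η t‖ := by gcongr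
      have h3 : C / 2 * ‖h t‖ ^ 2 * ‖U t‖ ^ 2 ≤ C / 2 * ‖h t‖ ^ 2 * ν ^ 2 := by gcongr
      have h4 : 0 ≤ C * ν * (‖h t‖ - ‖η t‖) ^ 2 := by positivity
      nlinarith)
  have e : ∫ t in a..b, m t * ((lam / 2 - C * ν / 2) * ‖η t‖ ^ 2 -
      (C * ν / 2 + C / 2 * ν ^ 2) * ‖h t‖ ^ 2) = (lam / 2 - C * ν / 2) *
      (∫ t in a..b, m t * ‖η t‖ ^ 2) - (C * ν / 2 + C / 2 * ν ^ 2) *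
      ∫ t in a..b, m t * ‖h t‖ ^ 2 := by
    rw [← intervalIntegral.integral_const_mul, ← intervalIntegral.integral_const_mul,
      ← intervalIntegral.integral_sub ((hu ▸ cη2).intervalIntegrable.const_mul _)
        ((hu ▸ ch2).intervalIntegrable.const_mul _)]
    congr 1
    ext t
    ring
  rw [e, ha, hb] at key
  have hp := hV.poincare ha hm
  have h0 : 0 ≤ ∫ t in a..b, m t * ‖η t‖ ^ 2 :=
    intervalIntegral.integral_nonneg hV.le fun t ht =>
      mul_nonneg (hV.nonneg_m t ht) (sq_nonneg _)
  have h1 : (C * ν / 2 + C / 2 * ν ^ 2) * ∫ t in a..b, m t * ‖h t‖ ^ 2 ≤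
      (C * ν / 2 + C / 2 * ν ^ 2) * ∫ t in a..b, m t * ‖η t‖ ^ 2 := by
    gcongr
  have h2 : 0 ≤ (lam / 2 - C * ν - C / 2 * ν ^ 2) * ∫ t in a..b, m t * ‖η t‖ ^ 2 :=
    mul_nonneg (by linarith) h0
  simp only [map_zero, sub_zero, add_zero] at key
  linarith

end EnergyComparison

/-! ### The geodesic equation solved for the acceleration -/

section GeodesicAcc

variable {E : Type*} [NormedAddCommGroup E] [NormedSpace ℝ E]

/-- The acceleration of the geodesics of a metric form `G` as a function of position and
velocity. -/
def geodesicAcc (G : E → E →L[ℝ] E →L[ℝ] ℝ) (y u : E) : E :=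
  (G y).inverse ((1 / 2 : ℝ) • ((fderiv ℝ G y).flip u).flip u - fderiv ℝ G y u u)

theorem isInvertible_of_pos [FiniteDimensional ℝ E] {B : E →L[ℝ] E →L[ℝ] ℝ}
    (hpos : ∀ u, u ≠ 0 → 0 < B u u) : B.IsInvertible := by
  have hinj : Function.Injective (B : E →ₗ[ℝ] E →L[ℝ] ℝ) := by
    rw [injective_iff_map_eq_zero]
    intro u hu
    by_contra h
    have := hpos u h
    have h2 : B u = 0 := hu
    rw [h2] at this
    exact lt_irrefl _ this
  have hdim : Module.finrank ℝ E = Module.finrank ℝ (E →L[ℝ] ℝ) := by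
    rw [← (LinearMap.toContinuousLinearMap (𝕜 := ℝ) (E := E) (F' := ℝ)).finrank_eq]
    exact (Subspace.dual_finrank_eq (K := ℝ) (V := E)).symm
  let e := LinearEquiv.ofInjectiveOfFinrankEq (B : E →ₗ[ℝ] E →L[ℝ] ℝ) hinj hdim
  exact ⟨e.toContinuousLinearEquiv, by ext; rfl⟩

/-- As a map to the dual space `G y` is invertible, so the weak equation determines `a`. Geodesics
thereby become solutions of an explicit second-order equation. -/
theorem eulerLagrange_eq_zero_iff {G : E → E →L[ℝ] E →L[ℝ] ℝ} {y : E}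
    (hG : (G y).IsInvertible) (u a : E) :
    (∀ w, eulerLagrange G y u a w = 0) ↔ a = geodesicAcc G y u := by
  obtain ⟨e, he⟩ := hG
  have h1 : (∀ w, eulerLagrange G y u a w = 0) ↔
      G y a = (1 / 2 : ℝ) • ((fderiv ℝ G y).flip u).flip u - fderiv ℝ G y u u := by
    rw [ContinuousLinearMap.ext_iff]
    refine forall_congr' fun w => ?_
    simp only [eulerLagrange, sub_apply, smul_apply, ContinuousLinearMap.flip_apply, smul_eq_mul]
    constructor <;> intro h <;> linarith
  rw [h1, geodesicAcc, ← he, ContinuousLinearMap.inverse_equiv]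
  exact (ContinuousLinearEquiv.eq_symm_apply e).symm

theorem contDiffOn_geodesicAcc [CompleteSpace E] {G : E → E →L[ℝ] E →L[ℝ] ℝ} {U : Set E}
    (hU : IsOpen U) (hG : ContDiffOn ℝ 2 G U) (hinv : ∀ y ∈ U, (G y).IsInvertible) :
    ContDiffOn ℝ 1 (fun z : E × E => geodesicAcc G z.1 z.2) (U ×ˢ univ) := by
  have hfst : MapsTo (Prod.fst : E × E → E) (U ×ˢ univ) U := fun z hz => hz.1
  have h1 : ContDiffOn ℝ 1 (fun z : E × E => G z.1) (U ×ˢ univ) :=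
    (hG.of_le (by norm_num)).comp contDiff_fst.contDiffOn hfst
  have h2 : ContDiffOn ℝ 1 (fun z : E × E => fderiv ℝ G z.1) (U ×ˢ univ) :=
    (hG.fderiv_of_isOpen hU (by norm_num)).comp contDiff_fst.contDiffOn hfst
  have h3 : ContDiffOn ℝ 1 (fun z : E × E => (G z.1).inverse) (U ×ˢ univ) := by
    intro z hz
    obtain ⟨e, he⟩ := hinv z.1 hz.1
    have h4 : ContDiffAt ℝ 1 ContinuousLinearMap.inverse (G z.1) := by
      rw [← he]; exact contDiffAt_map_inverse e
    exact h4.comp_contDiffWithinAt z (h1 z hz)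
  have hsnd : ContDiffOn ℝ 1 (fun z : E × E => z.2) (U ×ˢ univ) := contDiff_snd.contDiffOn
  have h5 : ContDiffOn ℝ 1 (fun z : E × E => (fderiv ℝ G z.1).flip) (U ×ˢ univ) :=
    (ContinuousLinearMap.flipₗᵢ ℝ E E (E →L[ℝ] ℝ)).contDiff.comp_contDiffOn h2
  have h6 : ContDiffOn ℝ 1 (fun z : E × E => ((fderiv ℝ G z.1).flip z.2).flip) (U ×ˢ univ) :=
    (ContinuousLinearMap.flipₗᵢ ℝ E E ℝ).contDiff.comp_contDiffOn (h5.clm_apply hsnd)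
  exact h3.clm_apply ((contDiffOn_const (c := (1 / 2 : ℝ)) |>.smul (h6.clm_apply hsnd)).sub
    ((h2.clm_apply hsnd).clm_apply hsnd))

/-- The homogeneity behind affine changes of time, and behind the vanishing of the acceleration to
second order at zero velocity. -/
theorem geodesicAcc_smul (G : E → E →L[ℝ] E →L[ℝ] ℝ) (y u : E) (c : ℝ) :
    geodesicAcc G y (c • u) = c ^ 2 • geodesicAcc G y u := by
  have h : (1 / 2 : ℝ) • ((fderiv ℝ G y).flip (c • u)).flip (c • u) -
      fderiv ℝ G y (c • u) (c • u) = c ^ 2 • ((1 / 2 : ℝ) • ((fderiv ℝ G y).flip u).flip u -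
      fderiv ℝ G y u u) := by
    ext w
    simp
    ring
  rw [geodesicAcc, h, map_smul, geodesicAcc]

end GeodesicAcc

/-! ### The Riemannian metric in coordinates -/

section MetricForm

variable {n : ℕ} {M : Type*} [TopologicalSpace M] [ChartedSpace (EuclideanSpace ℝ (Fin n)) M]

/-- The model space of an `n`-manifold. -/
abbrev Euc (n : ℕ) := EuclideanSpace ℝ (Fin n)

/-- The differential of the inverse of the preferred chart at `c`. -/
def chartFrame (c : M) (y : Euc n) : Euc n →L[ℝ] TangentSpace (𝓡 n) ((extChartAt (𝓡 n) c).symm y) :=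
  mfderiv (𝓡 n) (𝓡 n) (extChartAt (𝓡 n) c).symm y

theorem sum_single (u : Euc n) : ∑ i, u i • EuclideanSpace.single i (1 : ℝ) = u := by
  ext j
  simp [Finset.sum_apply, Pi.single_apply]

theorem chart_symm_mem {c : M} {y : Euc n} (hy : y ∈ (extChartAt (𝓡 n) c).target) :
    (extChartAt (𝓡 n) c).symm y ∈ (chartAt (Euc n) c).source := by
  simpa using (extChartAt (𝓡 n) c).map_target hy

section Riem

variable [RiemannianBundle (fun x : M => TangentSpace (𝓡 n) x)]

/-- The Riemannian metric in the preferred chart at `c`, as a bilinear form. -/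
def metricForm (c : M) (y : Euc n) : Euc n →L[ℝ] Euc n →L[ℝ] ℝ :=
  ∑ i, ∑ j, gram c y i j •
    (EuclideanSpace.proj i : Euc n →L[ℝ] ℝ).smulRight (EuclideanSpace.proj j : Euc n →L[ℝ] ℝ)

theorem metricForm_apply' (c : M) (y u w : Euc n) :
    metricForm c y u w = ∑ i, ∑ j, gram c y i j * (u i * w j) := by
  simp [metricForm, sum_apply]

theorem metricForm_apply (c : M) (y u w : Euc n) :
    metricForm c y u w = inner ℝ (chartFrame c y u) (chartFrame c y w) := by
  rw [metricForm_apply']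
  conv_rhs => rw [← sum_single u, ← sum_single w]
  rw [map_sum, map_sum, sum_inner]
  refine Finset.sum_congr rfl fun i _ => ?_
  rw [inner_sum]
  refine Finset.sum_congr rfl fun j _ => ?_
  rw [map_smul, map_smul, real_inner_smul_left, real_inner_smul_right]
  simp only [gram, Matrix.of_apply, coordField, chartFrame]
  rw [mul_comm, mul_assoc]
  rfl

theorem metricForm_symm (c : M) (y u w : Euc n) : metricForm c y u w = metricForm c y w u := by
  rw [metricForm_apply, metricForm_apply, real_inner_comm]

end Riem

variable [IsManifold (𝓡 n) ∞ M]

theorem contMDiffAt_chart {c p : M} (hp : p ∈ (chartAt (Euc n) c).source) :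
    ContMDiffAt (𝓡 n) 𝓘(ℝ, Euc n) ∞ (extChartAt (𝓡 n) c) p :=
  contMDiffAt_extChartAt' hp

theorem contMDiffAt_chart_symm {c : M} {y : Euc n} (hy : y ∈ (extChartAt (𝓡 n) c).target) :
    ContMDiffAt 𝓘(ℝ, Euc n) (𝓡 n) ∞ (extChartAt (𝓡 n) c).symm y :=
  (contMDiffOn_extChartAt_symm c).contMDiffAt ((isOpen_extChartAt_target c).mem_nhds hy)

/-- The transition map between two charts. -/
def transition (c c' : M) : Euc n → Euc n :=
  fun y => extChartAt (𝓡 n) c' ((extChartAt (𝓡 n) c).symm y)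

theorem contDiffAt_transition {c c' : M} {y : Euc n} (hy : y ∈ (extChartAt (𝓡 n) c).target)
    (hy' : (extChartAt (𝓡 n) c).symm y ∈ (chartAt (Euc n) c').source) :
    ContDiffAt ℝ ∞ (transition c c') y :=
  ((contMDiffAt_chart hy').comp y (contMDiffAt_chart_symm hy)).contDiffAt

theorem eventually_transition {c c' : M} {y : Euc n} (hy : y ∈ (extChartAt (𝓡 n) c).target)
    (hy' : (extChartAt (𝓡 n) c).symm y ∈ (chartAt (Euc n) c').source) :
    ∀ᶠ z in 𝓝 y, z ∈ (extChartAt (𝓡 n) c).target ∧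
      (extChartAt (𝓡 n) c).symm z ∈ (chartAt (Euc n) c').source := by
  filter_upwards [(isOpen_extChartAt_target c).mem_nhds hy,
    (contMDiffAt_chart_symm hy).continuousAt.preimage_mem_nhds
      ((chartAt (Euc n) c').open_source.mem_nhds hy')] with z h1 h2 using ⟨h1, h2⟩

theorem chartFrame_transition {c c' : M} {y : Euc n} (hy : y ∈ (extChartAt (𝓡 n) c).target)
    (hy' : (extChartAt (𝓡 n) c).symm y ∈ (chartAt (Euc n) c').source) (u : Euc n) :
    (chartFrame c y u : Euc n) = chartFrame c' (transition c c' y) (fderiv ℝ (transition c c') y u) := by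
  have h1 : (extChartAt (𝓡 n) c).symm =ᶠ[𝓝 y] (extChartAt (𝓡 n) c').symm ∘ transition c c' := by
    filter_upwards [eventually_transition hy hy'] with z hz
    exact ((extChartAt (𝓡 n) c').left_inv (by simpa using hz.2)).symm
  have ht : transition c c' y ∈ (extChartAt (𝓡 n) c').target :=
    (extChartAt (𝓡 n) c').map_source (by simpa using hy')
  have h2 : HasMFDerivAt 𝓘(ℝ, Euc n) (𝓡 n) (extChartAt (𝓡 n) c').symm (transition c c' y)
      (mfderiv 𝓘(ℝ, Euc n) (𝓡 n) (extChartAt (𝓡 n) c').symm (transition c c' y)) :=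
    ((contMDiffAt_chart_symm ht).mdifferentiableAt (by simp)).hasMFDerivAt
  have h3 : HasMFDerivAt 𝓘(ℝ, Euc n) 𝓘(ℝ, Euc n) (transition c c') y
      (fderiv ℝ (transition c c') y) :=
    ((contDiffAt_transition hy hy').differentiableAt (by simp)).hasFDerivAt.hasMFDerivAt
  have h4 := (h2.comp y h3).congr_of_eventuallyEq h1
  have h5 := h4.mfderiv
  exact congrArg (fun L : Euc n →L[ℝ] Euc n => L u) h5

theorem chart_mfderiv_chartFrame {c : M} {y : Euc n} (hy : y ∈ (extChartAt (𝓡 n) c).target)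
    (u : Euc n) : (mfderiv (𝓡 n) 𝓘(ℝ, Euc n) (extChartAt (𝓡 n) c) ((extChartAt (𝓡 n) c).symm y)
      (chartFrame c y u) : Euc n) = u := by
  have h1 : (fun z => extChartAt (𝓡 n) c ((extChartAt (𝓡 n) c).symm z)) =ᶠ[𝓝 y] id := by
    filter_upwards [(isOpen_extChartAt_target c).mem_nhds hy] with z hz
    exact (extChartAt (𝓡 n) c).right_inv hz
  have h2 := ((contMDiffAt_chart (chart_symm_mem hy)).mdifferentiableAt (by simp)).hasMFDerivAt
  have h3 := ((contMDiffAt_chart_symm hy).mdifferentiableAt (by simp)).hasMFDerivAt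
  have h4 := ((h2.comp y h3).congr_of_eventuallyEq h1.symm).mfderiv
  have h5 : mfderiv 𝓘(ℝ, Euc n) 𝓘(ℝ, Euc n) (id : Euc n → Euc n) y = ContinuousLinearMap.id ℝ _ :=
    mfderiv_id
  exact (congrArg (fun L : Euc n →L[ℝ] Euc n => L u) (h4.symm.trans h5))

theorem chartFrame_mfderiv_chart {c p : M} (hp : p ∈ (chartAt (Euc n) c).source)
    (v : TangentSpace (𝓡 n) p) : (chartFrame c (extChartAt (𝓡 n) c p)
      (mfderiv (𝓡 n) 𝓘(ℝ, Euc n) (extChartAt (𝓡 n) c) p v) : Euc n) = v := by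
  have hp' : p ∈ (extChartAt (𝓡 n) c).source := by simpa using hp
  have h1 : (fun z => (extChartAt (𝓡 n) c).symm (extChartAt (𝓡 n) c z)) =ᶠ[𝓝 p] id := by
    filter_upwards [(chartAt (Euc n) c).open_source.mem_nhds hp] with z hz
    exact (extChartAt (𝓡 n) c).left_inv (by simpa using hz)
  have h2 := ((contMDiffAt_chart hp).mdifferentiableAt (by simp)).hasMFDerivAt
  have h3 := ((contMDiffAt_chart_symm ((extChartAt (𝓡 n) c).map_source hp')).mdifferentiableAt
    (by simp)).hasMFDerivAt
  have h4 := ((h3.comp p h2).congr_of_eventuallyEq h1.symm).mfderiv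
  have h5 : mfderiv (𝓡 n) (𝓡 n) (id : M → M) p = ContinuousLinearMap.id ℝ _ := mfderiv_id
  exact (congrArg (fun L : Euc n →L[ℝ] Euc n => L v) (h4.symm.trans h5))

/-- The coordinate fields are smooth sections of the tangent bundle, being images of constant fields
under the tangent map of the inverse chart; the smoothness of the metric coefficients rests on this.
-/
theorem contMDiffOn_chartFrame (c : M) (u : Euc n) :
    ContMDiffOn 𝓘(ℝ, Euc n) (𝓡 n).tangent ∞
      (fun y => (⟨(extChartAt (𝓡 n) c).symm y, chartFrame c y u⟩ : TangentBundle (𝓡 n) M))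
      (extChartAt (𝓡 n) c).target := by
  have h1 := (contMDiffOn_extChartAt_symm (I := 𝓡 n) (n := ∞) c).contMDiffOn_tangentMapWithin
    (m := ∞) (by simp) (isOpen_extChartAt_target c).uniqueMDiffOn
  have h2 : ContMDiff 𝓘(ℝ, Euc n) 𝓘(ℝ, Euc n).tangent ∞
      (fun y : Euc n => (⟨y, u⟩ : TangentBundle 𝓘(ℝ, Euc n) (Euc n))) :=
    (contMDiff_vectorSpace_iff_contDiff (V := fun _ : Euc n => u)).2 contDiff_const
  refine (h1.comp h2.contMDiffOn (s := (extChartAt (𝓡 n) c).target) (fun y hy => hy)).congr ?_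
  intro y hy
  simp only [tangentMapWithin, Function.comp_apply]
  rw [mfderivWithin_of_isOpen (isOpen_extChartAt_target c) hy]
  rfl

variable [RiemannianBundle (fun x : M => TangentSpace (𝓡 n) x)]

theorem metricForm_transition {c c' : M} {y : Euc n} (hy : y ∈ (extChartAt (𝓡 n) c).target)
    (hy' : (extChartAt (𝓡 n) c).symm y ∈ (chartAt (Euc n) c').source) (u w : Euc n) :
    metricForm c y u w = metricForm c' (transition c c' y) (fderiv ℝ (transition c c') y u)
      (fderiv ℝ (transition c c') y w) := by
  rw [metricForm_apply, metricForm_apply]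
  have e : (extChartAt (𝓡 n) c').symm (transition c c' y) = (extChartAt (𝓡 n) c).symm y :=
    (extChartAt (𝓡 n) c').left_inv (by simpa using hy')
  have h1 := chartFrame_transition hy hy' u
  have h2 := chartFrame_transition hy hy' w
  -- The two frames sit over base points that are only propositionally equal; `key` transports the
  -- inner product between the fibres.
  have key : ∀ (p q : M) (_ : p = q) (a b a' b' : Euc n), a = a' → b = b' →
      inner ℝ (show TangentSpace (𝓡 n) p from a) (show TangentSpace (𝓡 n) p from b) =
      inner ℝ (show TangentSpace (𝓡 n) q from a') (show TangentSpace (𝓡 n) q from b') := by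
    rintro p _ rfl a b _ _ rfl rfl
    rfl
  exact key _ _ e.symm _ _ _ _ h1 h2

theorem metricForm_pos {c : M} {y : Euc n} (hy : y ∈ (extChartAt (𝓡 n) c).target) {u : Euc n}
    (hu : u ≠ 0) : 0 < metricForm c y u u := by
  rw [metricForm_apply]
  apply real_inner_self_pos.2
  intro h
  apply hu
  have := chart_mfderiv_chartFrame hy u
  rw [h, map_zero] at this
  exact this.symm

theorem contDiffOn_metricForm [IsContMDiffRiemannianBundle (𝓡 n) ∞ (Euc n)
      (fun x : M => TangentSpace (𝓡 n) x)] (c : M) :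
    ContDiffOn ℝ ∞ (metricForm (n := n) c) (extChartAt (𝓡 n) c).target := by
  unfold metricForm
  refine ContDiffOn.sum fun i _ => ContDiffOn.sum fun j _ => ?_
  suffices h : ContDiffOn ℝ ∞ (fun y => gram (n := n) c y i j) (extChartAt (𝓡 n) c).target from
    h.smul contDiffOn_const
  rw [← contMDiffOn_iff_contDiffOn]
  exact (contMDiffOn_chartFrame c (EuclideanSpace.single i 1)).inner_bundle
    (contMDiffOn_chartFrame c (EuclideanSpace.single j 1))

end MetricForm

/-! ### Christoffel symbols and the Euler–Lagrange equation -/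

section Christoffel

variable {n : ℕ} {M : Type*} [TopologicalSpace M] [ChartedSpace (EuclideanSpace ℝ (Fin n)) M]
  [IsManifold (𝓡 n) ∞ M]
  [RiemannianBundle (fun x : M => TangentSpace (𝓡 n) x)]

theorem metricForm_isInvertible {c : M} {y : Euc n} (hy : y ∈ (extChartAt (𝓡 n) c).target) :
    (metricForm c y).IsInvertible :=
  isInvertible_of_pos fun _ hu => metricForm_pos hy hu

variable [IsContMDiffRiemannianBundle (𝓡 n) ∞ (EuclideanSpace ℝ (Fin n))
    (fun x : M => TangentSpace (𝓡 n) x)]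

theorem contDiffAt_metricForm {c : M} {y : Euc n} (hy : y ∈ (extChartAt (𝓡 n) c).target) :
    ContDiffAt ℝ ∞ (metricForm (n := n) c) y :=
  (contDiffOn_metricForm c).contDiffAt ((isOpen_extChartAt_target c).mem_nhds hy)

theorem differentiableAt_metricForm {c : M} {y : Euc n}
    (hy : y ∈ (extChartAt (𝓡 n) c).target) : DifferentiableAt ℝ (metricForm (n := n) c) y :=
  (contDiffAt_metricForm hy).differentiableAt (by simp)

theorem gram_eq_metricForm (c : M) (y : Euc n) (i j : Fin n) :
    gram c y i j = metricForm c y (EuclideanSpace.single i 1) (EuclideanSpace.single j 1) := by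
  rw [metricForm_apply]
  rfl

theorem dGram_eq {c : M} {y : Euc n} (hy : y ∈ (extChartAt (𝓡 n) c).target) (l i j : Fin n) :
    dGram c y l i j = fderiv ℝ (metricForm c) y (EuclideanSpace.single l 1)
      (EuclideanSpace.single i 1) (EuclideanSpace.single j 1) := by
  unfold dGram
  simp only [gram_eq_metricForm]
  have h := ((differentiableAt_metricForm hy).hasFDerivAt.clm_apply
    (hasFDerivAt_const (EuclideanSpace.single i (1 : ℝ)) y)).clm_apply
    (hasFDerivAt_const (EuclideanSpace.single j (1 : ℝ)) y)
  rw [h.fderiv]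
  simp

theorem fderiv_metricForm_apply {c : M} {y : Euc n} (hy : y ∈ (extChartAt (𝓡 n) c).target)
    (v u w : Euc n) : fderiv ℝ (metricForm c) y v u w =
      ∑ l, ∑ i, ∑ j, dGram c y l i j * (v l * u i * w j) := by
  conv_lhs => rw [← sum_single v, ← sum_single u, ← sum_single w]
  simp only [map_sum, map_smul, sum_apply, smul_apply, smul_eq_mul, dGram_eq hy, Finset.mul_sum]
  rw [Finset.sum_comm_cycle, Finset.sum_congr rfl fun i _ => Finset.sum_comm]
  exact Finset.sum_congr rfl fun l _ => Finset.sum_congr rfl fun i _ =>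
    Finset.sum_congr rfl fun j _ => by ring

/-- The Euler–Lagrange form at `w` is the pairing of `w` with `g a + b`, while the Christoffel
equation reads `a + g⁻¹ b = 0`. Positive definiteness makes the Gram matrix `g` invertible, so the
two conditions agree. -/
theorem eulerLagrange_iff_christoffel {c : M} {y : Euc n}
    (hy : y ∈ (extChartAt (𝓡 n) c).target) (u a : Euc n) :
    (∀ w, eulerLagrange (metricForm c) y u a w = 0) ↔
      ∀ m, a m + ∑ i, ∑ j, christoffel c y m i j * u i * u j = 0 := by
  -- The Christoffel symbols of the first kind, contracted twice with `u`.
  set b : Fin n → ℝ := fun l => (1 / 2) * ∑ i, ∑ j,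
    (dGram c y i j l + dGram c y j i l - dGram c y l i j) * u i * u j with hb
  have hdet : IsUnit (gram c y).det := by
    rw [isUnit_iff_ne_zero]
    intro h
    obtain ⟨v, hv, hv0⟩ := Matrix.exists_mulVec_eq_zero_iff.2 h
    have h1 := metricForm_pos (n := n) hy (u := WithLp.toLp 2 v) (by simpa using hv)
    rw [metricForm_apply'] at h1
    have h2 : ∀ i, ∑ j, gram c y i j * v j = 0 := fun i => congrFun hv0 i
    have h3 : ∑ i, ∑ j, gram c y i j * (v i * v j) = ∑ i, v i * ∑ j, gram c y i j * v j := by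
      refine Finset.sum_congr rfl fun i _ => ?_
      rw [Finset.mul_sum]
      exact Finset.sum_congr rfl fun j _ => by ring
    simp only [h3, h2, mul_zero, Finset.sum_const_zero, lt_irrefl] at h1
  have h1 : (∀ w, eulerLagrange (metricForm c) y u a w = 0) ↔
      (gram c y).mulVec (fun m => a m) + b = 0 := by
    have key : ∀ w, eulerLagrange (metricForm c) y u a w =
        ∑ l, w l * ((gram c y).mulVec (fun m => a m) + b) l := by
      intro w
      simp only [eulerLagrange]
      rw [fderiv_metricForm_apply hy, fderiv_metricForm_apply hy, metricForm_symm,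
        metricForm_apply']
      -- Against the symmetric weight `u i * u j` the first two derivative terms of the Christoffel
      -- symbol give the same sum.
      have e1 : ∑ l, ∑ i, ∑ j, w l * (dGram c y j i l * u i * u j) =
          ∑ l, ∑ i, ∑ j, w l * (dGram c y i j l * u i * u j) := by
        refine Finset.sum_congr rfl fun l _ => ?_
        rw [Finset.sum_comm]
        exact Finset.sum_congr rfl fun i _ => Finset.sum_congr rfl fun j _ => by ring
      have e2 : ∑ i, ∑ j, ∑ l, dGram c y i j l * (u i * u j * w l) =
          ∑ l, ∑ i, ∑ j, w l * (dGram c y i j l * u i * u j) := by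
        rw [Finset.sum_comm_cycle]
        exact Finset.sum_congr rfl fun l _ => Finset.sum_congr rfl fun i _ =>
          Finset.sum_congr rfl fun j _ => by ring
      have e3 : ∑ l, w l * b l = (1 / 2) * ((∑ l, ∑ i, ∑ j, w l * (dGram c y i j l * u i * u j)) +
          (∑ l, ∑ i, ∑ j, w l * (dGram c y j i l * u i * u j)) -
          ∑ l, ∑ i, ∑ j, dGram c y l i j * (w l * u i * u j)) := by
        simp only [hb, ← Finset.sum_add_distrib, ← Finset.sum_sub_distrib, Finset.mul_sum]
        exact Finset.sum_congr rfl fun l _ => Finset.sum_congr rfl fun i _ =>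
          Finset.sum_congr rfl fun j _ => by ring
      have e4 : ∑ l, w l * ((gram c y).mulVec (fun m => a m) + b) l =
          (∑ l, ∑ m, gram c y l m * (w l * a m)) + ∑ l, w l * b l := by
        rw [← Finset.sum_add_distrib]
        refine Finset.sum_congr rfl fun l _ => ?_
        rw [Pi.add_apply, mul_add, Matrix.mulVec, dotProduct, Finset.mul_sum]
        congr 1
        exact Finset.sum_congr rfl fun m _ => by ring
      rw [e4, e3, e2, e1]
      ring
    constructor
    · intro h
      ext l
      have := h (EuclideanSpace.single l 1)
      rw [key] at this
      simpa [Pi.single_apply] using this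
    · intro h w
      rw [key, h]
      simp
  have h2 : (∀ m, a m + ∑ i, ∑ j, christoffel c y m i j * u i * u j = 0) ↔
      (fun m => a m) + (gram c y)⁻¹.mulVec b = 0 := by
    rw [funext_iff]
    refine forall_congr' fun m => ?_
    have : ∑ i, ∑ j, christoffel c y m i j * u i * u j = (gram c y)⁻¹.mulVec b m := by
      simp only [christoffel, Matrix.mulVec, dotProduct, hb, Finset.mul_sum, Finset.sum_mul]
      rw [Finset.sum_congr rfl fun i _ => Finset.sum_comm]
      rw [Finset.sum_comm]
      refine Finset.sum_congr rfl fun l _ => Finset.sum_congr rfl fun i _ =>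
        Finset.sum_congr rfl fun j _ => by ring
    rw [this]
    rfl
  rw [h1, h2]
  constructor
  · intro h
    have := congrArg (gram c y)⁻¹.mulVec h
    rwa [Matrix.mulVec_add, Matrix.mulVec_mulVec, Matrix.nonsing_inv_mul _ hdet, Matrix.one_mulVec,
      Matrix.mulVec_zero] at this
  · intro h
    have := congrArg (gram c y).mulVec h
    rwa [Matrix.mulVec_add, Matrix.mulVec_mulVec, Matrix.mul_nonsing_inv _ hdet, Matrix.one_mulVec,
      Matrix.mulVec_zero] at this

end Christoffel

/-! ### The geodesic equation at a time, in any chart -/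

section LocalGeodesics

variable {n : ℕ} {M : Type*} [TopologicalSpace M] [ChartedSpace (EuclideanSpace ℝ (Fin n)) M]

/-- The curve `γ` read in the preferred chart at `c`. -/
def inChart (n : ℕ) {M : Type*} [TopologicalSpace M]
    [ChartedSpace (EuclideanSpace ℝ (Fin n)) M] (c : M) (γ : ℝ → M) : ℝ → Euc n := fun s => extChartAt (𝓡 n) c (γ s)

/-- `γ` satisfies the geodesic equation at time `t`, in all charts. -/
def GeodesicAt (n : ℕ) {M : Type*} [TopologicalSpace M]
    [ChartedSpace (EuclideanSpace ℝ (Fin n)) M]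
    [RiemannianBundle (fun x : M => TangentSpace (𝓡 n) x)] (γ : ℝ → M) (t : ℝ) : Prop :=
  ContMDiffAt 𝓘(ℝ, ℝ) (𝓡 n) 2 γ t ∧
    ∀ c : M, γ t ∈ (chartAt (EuclideanSpace ℝ (Fin n)) c).source → ∀ m : Fin n,
      deriv (deriv (inChart n c γ)) t m +
        ∑ i, ∑ j, christoffel c (inChart n c γ t) m i j * deriv (inChart n c γ) t i *
          deriv (inChart n c γ) t j = 0

theorem isGeodesic_iff [RiemannianBundle (fun x : M => TangentSpace (𝓡 n) x)] {γ : ℝ → M} :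
    IsGeodesic n γ ↔ ∀ t, GeodesicAt n γ t :=
  ⟨fun h t => ⟨h.1 t, fun c hc m => h.2 c t hc m⟩,
    fun h => ⟨fun t => (h t).1, fun c t hc m => (h t).2 c hc m⟩⟩

theorem inChart_mem_target {c : M} {γ : ℝ → M} {t : ℝ} (hc : γ t ∈ (chartAt (Euc n) c).source) :
    inChart n c γ t ∈ (extChartAt (𝓡 n) c).target :=
  (extChartAt (𝓡 n) c).map_source (by simpa using hc)

theorem symm_inChart {c : M} {γ : ℝ → M} {t : ℝ} (hc : γ t ∈ (chartAt (Euc n) c).source) :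
    (extChartAt (𝓡 n) c).symm (inChart n c γ t) = γ t :=
  (extChartAt (𝓡 n) c).left_inv (by simpa using hc)

theorem eventually_mem_source {c : M} {γ : ℝ → M} {t : ℝ} (hγ : ContinuousAt γ t)
    (hc : γ t ∈ (chartAt (Euc n) c).source) :
    ∀ᶠ s in 𝓝 t, γ s ∈ (chartAt (Euc n) c).source :=
  hγ.preimage_mem_nhds ((chartAt (Euc n) c).open_source.mem_nhds hc)

theorem hasDerivAt_deriv_of_contDiffAt {E : Type*} [NormedAddCommGroup E] [NormedSpace ℝ E]
    {x : ℝ → E} {t : ℝ} (hx : ContDiffAt ℝ 2 x t) : HasDerivAt (deriv x) (deriv (deriv x) t) t := by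
  have h1 : ContDiffAt ℝ 1 (fderiv ℝ x) t := hx.fderiv_right (by norm_num)
  have h2 : DifferentiableAt ℝ (deriv x) t := by
    have := (h1.differentiableAt one_ne_zero).clm_apply (differentiableAt_const (1 : ℝ))
    exact this
  exact h2.hasDerivAt

variable [IsManifold (𝓡 n) ∞ M]

theorem two_le_infty : (2 : WithTop ℕ∞) ≤ (∞ : WithTop ℕ∞) := ENat.LEInfty.out

theorem contDiffAt_inChart {c : M} {γ : ℝ → M} {t : ℝ} {k : ℕ∞}
    (hγ : ContMDiffAt 𝓘(ℝ, ℝ) (𝓡 n) k γ t) (hc : γ t ∈ (chartAt (Euc n) c).source) :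
    ContDiffAt ℝ k (inChart n c γ) t :=
  (((contMDiffAt_chart hc).of_le (by exact_mod_cast le_top)).comp t hγ).contDiffAt

theorem contMDiffAt_of_inChart {c : M} {γ : ℝ → M} {t : ℝ} {k : ℕ∞} (hγ : ContinuousAt γ t)
    (hc : γ t ∈ (chartAt (Euc n) c).source) (hx : ContDiffAt ℝ k (inChart n c γ) t) :
    ContMDiffAt 𝓘(ℝ, ℝ) (𝓡 n) k γ t := by
  have h1 : ContMDiffAt 𝓘(ℝ, ℝ) (𝓡 n) k ((extChartAt (𝓡 n) c).symm ∘ inChart n c γ) t :=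
    ((contMDiffAt_chart_symm (inChart_mem_target hc)).of_le (by exact_mod_cast le_top)).comp t
      hx.contMDiffAt
  refine h1.congr_of_eventuallyEq ?_
  filter_upwards [eventually_mem_source hγ hc] with s hs using (symm_inChart hs).symm

theorem inChart_eventuallyEq_transition {c c' : M} {γ : ℝ → M} {t : ℝ} (hγ : ContinuousAt γ t)
    (hc : γ t ∈ (chartAt (Euc n) c).source) :
    inChart n c' γ =ᶠ[𝓝 t] fun s => transition c c' (inChart n c γ s) := by
  filter_upwards [eventually_mem_source hγ hc] with s hs
  simp only [transition]
  rw [symm_inChart hs]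
  rfl

/-- First and second derivatives of a curve after a change of variables. -/
theorem deriv_deriv_comp {E : Type*} [NormedAddCommGroup E] [NormedSpace ℝ E] {φ : E → E}
    {x : ℝ → E} {t : ℝ} (hx : ContDiffAt ℝ 2 x t) (hφ : ContDiffAt ℝ 2 φ (x t)) :
    deriv (fun s => φ (x s)) t = fderiv ℝ φ (x t) (deriv x t) ∧
    deriv (deriv fun s => φ (x s)) t = fderiv ℝ (fderiv ℝ φ) (x t) (deriv x t) (deriv x t) +
      fderiv ℝ φ (x t) (deriv (deriv x) t) := by
  have hev : ∀ᶠ s in 𝓝 t, HasDerivAt (fun s => φ (x s)) (fderiv ℝ φ (x s) (deriv x s)) s := by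
    have h1 : ∀ᶠ s in 𝓝 t, ContDiffAt ℝ 2 x s := hx.eventually (by simp)
    have h2 : ∀ᶠ s in 𝓝 t, ContDiffAt ℝ 2 φ (x s) :=
      hx.continuousAt.eventually (hφ.eventually (by simp))
    filter_upwards [h1, h2] with s hs1 hs2
    exact (hs2.differentiableAt two_ne_zero).hasFDerivAt.comp_hasDerivAt s
      (hs1.differentiableAt two_ne_zero).hasDerivAt
  refine ⟨hev.self_of_nhds.deriv, ?_⟩
  have e : deriv (fun s => φ (x s)) =ᶠ[𝓝 t] fun s => fderiv ℝ φ (x s) (deriv x s) :=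
    hev.mono fun s hs => hs.deriv
  rw [e.deriv_eq]
  have h1 : ContDiffAt ℝ 1 (fderiv ℝ φ) (x t) := hφ.fderiv_right (by norm_num)
  have h2 := (h1.differentiableAt one_ne_zero).hasFDerivAt.comp_hasDerivAt t
      (hx.differentiableAt two_ne_zero).hasDerivAt
  exact (h2.clm_apply (hasDerivAt_deriv_of_contDiffAt hx)).deriv

variable [RiemannianBundle (fun x : M => TangentSpace (𝓡 n) x)]
  [IsContMDiffRiemannianBundle (𝓡 n) ∞ (EuclideanSpace ℝ (Fin n))
    (fun x : M => TangentSpace (𝓡 n) x)]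

/-- The transition map is an isometry of the two coordinate metrics, and the second derivative of
the curve transforms into exactly the acceleration of the pullback formula. -/
theorem eulerLagrange_transition {c c' : M} {γ : ℝ → M} {t : ℝ}
    (hγ : ContMDiffAt 𝓘(ℝ, ℝ) (𝓡 n) 2 γ t) (hc : γ t ∈ (chartAt (Euc n) c).source)
    (hc' : γ t ∈ (chartAt (Euc n) c').source) (w : Euc n) :
    eulerLagrange (metricForm c) (inChart n c γ t) (deriv (inChart n c γ) t)
      (deriv (deriv (inChart n c γ)) t) w =
    eulerLagrange (metricForm c') (inChart n c' γ t) (deriv (inChart n c' γ) t)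
      (deriv (deriv (inChart n c' γ)) t) (fderiv ℝ (transition c c') (inChart n c γ t) w) := by
  have hy := inChart_mem_target hc
  have hy' : (extChartAt (𝓡 n) c).symm (inChart n c γ t) ∈ (chartAt (Euc n) c').source := by
    rw [symm_inChart hc]; exact hc'
  have hφ : ContDiffAt ℝ 2 (transition (n := n) c c') (inChart n c γ t) :=
    (contDiffAt_transition hy hy').of_le two_le_infty
  have ev := inChart_eventuallyEq_transition (c' := c') hγ.continuousAt hc
  have e0 : inChart n c' γ t = transition c c' (inChart n c γ t) := ev.self_of_nhds
  have hd := deriv_deriv_comp (contDiffAt_inChart (k := 2) hγ hc) hφ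
  rw [ev.deriv.deriv_eq, ev.deriv_eq, e0, hd.1, hd.2]
  refine eulerLagrange_pullback hφ (differentiableAt_metricForm hy) ?_
    (fun u w => metricForm_symm _ _ _ _) ?_ _ _ w
  · rw [← e0]
    exact differentiableAt_metricForm (inChart_mem_target hc')
  · filter_upwards [eventually_transition hy hy'] with z hz u w
      using metricForm_transition hz.1 hz.2 u w

/-- The geodesic equation can be checked in one chart. -/
theorem geodesicAt_iff {c : M} {γ : ℝ → M} {t : ℝ} (hc : γ t ∈ (chartAt (Euc n) c).source) :
    GeodesicAt n γ t ↔ ContMDiffAt 𝓘(ℝ, ℝ) (𝓡 n) 2 γ t ∧ deriv (deriv (inChart n c γ)) t =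
      geodesicAcc (metricForm c) (inChart n c γ t) (deriv (inChart n c γ) t) := by
  refine and_congr_right fun hγ => ?_
  rw [← eulerLagrange_eq_zero_iff (metricForm_isInvertible (inChart_mem_target hc))]
  constructor
  · intro h
    rw [eulerLagrange_iff_christoffel (inChart_mem_target hc)]
    exact h c hc
  · intro h c' hc'
    rw [← eulerLagrange_iff_christoffel (inChart_mem_target hc')]
    intro w
    rw [eulerLagrange_transition hγ hc' hc]
    exact h _

/-- A geodesic in a chart, as a solution of an ordinary differential equation. -/
theorem GeodesicAt.hasDerivAt {c : M} {γ : ℝ → M} {t : ℝ} (hγ : GeodesicAt n γ t)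
    (hc : γ t ∈ (chartAt (Euc n) c).source) :
    HasDerivAt (inChart n c γ) (deriv (inChart n c γ) t) t ∧
    HasDerivAt (deriv (inChart n c γ))
      (geodesicAcc (metricForm c) (inChart n c γ t) (deriv (inChart n c γ) t)) t := by
  have h1 := contDiffAt_inChart (k := 2) hγ.1 hc
  refine ⟨(h1.differentiableAt two_ne_zero).hasDerivAt, ?_⟩
  rw [← ((geodesicAt_iff hc).1 hγ).2]
  exact hasDerivAt_deriv_of_contDiffAt h1

theorem contDiffAt_geodesicAcc {c : M} {y : Euc n} (hy : y ∈ (extChartAt (𝓡 n) c).target)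
    (u : Euc n) :
    ContDiffAt ℝ 1 (fun z : Euc n × Euc n => geodesicAcc (metricForm c) z.1 z.2) (y, u) :=
  (contDiffOn_geodesicAcc (isOpen_extChartAt_target c)
    ((contDiffOn_metricForm c).of_le two_le_infty)
    fun _ hy => metricForm_isInvertible hy).contDiffAt
    (((isOpen_extChartAt_target c).prod isOpen_univ).mem_nhds ⟨hy, mem_univ _⟩)

/-- Regularity comes by bootstrapping: the acceleration is a continuous function of position and
velocity, so `u` is `C¹` and hence `x` is `C²`. -/
theorem geodesicAt_of_hasDerivAt {c : M} {x u : ℝ → Euc n} {t : ℝ}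
    (hx : x t ∈ (extChartAt (𝓡 n) c).target)
    (h : ∀ᶠ s in 𝓝 t, HasDerivAt x (u s) s ∧
      HasDerivAt u (geodesicAcc (metricForm c) (x s) (u s)) s) :
    GeodesicAt n (fun s => (extChartAt (𝓡 n) c).symm (x s)) t := by
  set γ : ℝ → M := fun s => (extChartAt (𝓡 n) c).symm (x s) with hγ
  have hxc : ContinuousAt x t := h.self_of_nhds.1.continuousAt
  have ht : ∀ᶠ s in 𝓝 t, x s ∈ (extChartAt (𝓡 n) c).target :=
    hxc.preimage_mem_nhds ((isOpen_extChartAt_target c).mem_nhds hx)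
  have hc : γ t ∈ (chartAt (Euc n) c).source := chart_symm_mem hx
  have hγc : ContinuousAt γ t :=
    (contMDiffAt_chart_symm hx).continuousAt.comp_of_eq hxc rfl
  have e : inChart n c γ =ᶠ[𝓝 t] x := by
    filter_upwards [ht] with s hs using (extChartAt (𝓡 n) c).right_inv hs
  have e1 : deriv x =ᶠ[𝓝 t] u := h.mono fun s hs => hs.1.deriv
  obtain ⟨V, hVsub, hVo, hVt⟩ := eventually_nhds_iff.1 (h.and ht)
  have hu : ContDiffOn ℝ 1 u V := by
    rw [show (1 : WithTop ℕ∞) = 0 + 1 from rfl, contDiffOn_succ_iff_deriv_of_isOpen hVo]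
    refine ⟨fun s hs => (hVsub s hs).1.2.differentiableAt.differentiableWithinAt, by simp, ?_⟩
    rw [contDiffOn_zero]
    have hcont : ContinuousOn (fun s => geodesicAcc (metricForm c) (x s) (u s)) V := by
      intro s hs
      have h1 := (contDiffAt_geodesicAcc (hVsub s hs).2 (u s)).continuousAt
      have h2 : ContinuousAt (fun s => (x s, u s)) s :=
        (hVsub s hs).1.1.continuousAt.prodMk (hVsub s hs).1.2.continuousAt
      exact (ContinuousAt.comp_of_eq h1 h2 rfl).continuousWithinAt
    exact hcont.congr fun s hs => (hVsub s hs).1.2.deriv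
  have hx2 : ContDiffOn ℝ 2 x V := by
    rw [show (2 : WithTop ℕ∞) = 1 + 1 from by norm_num, contDiffOn_succ_iff_deriv_of_isOpen hVo]
    exact ⟨fun s hs => (hVsub s hs).1.1.differentiableAt.differentiableWithinAt, by simp,
      hu.congr fun s hs => (hVsub s hs).1.1.deriv⟩
  have hx2' : ContDiffAt ℝ (2 : ℕ∞) x t := hx2.contDiffAt (hVo.mem_nhds hVt)
  rw [geodesicAt_iff hc]
  refine ⟨contMDiffAt_of_inChart (k := 2) hγc hc (hx2'.congr_of_eventuallyEq e), ?_⟩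
  rw [e.deriv.deriv_eq, e.deriv_eq, e.self_of_nhds, e1.deriv_eq, e1.self_of_nhds]
  exact h.self_of_nhds.2.deriv

theorem GeodesicAt.congr {γ γ' : ℝ → M} {t : ℝ} (hγ : GeodesicAt n γ t) (h : γ' =ᶠ[𝓝 t] γ) :
    GeodesicAt n γ' t := by
  refine ⟨hγ.1.congr_of_eventuallyEq h, fun c hc m => ?_⟩
  have e : inChart n c γ' =ᶠ[𝓝 t] inChart n c γ := by
    filter_upwards [h] with s hs
    simp only [inChart, hs]
  rw [e.deriv.deriv_eq, e.deriv_eq, e.self_of_nhds]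
  rw [h.self_of_nhds] at hc
  exact hγ.2 c hc m

/-- Affine changes of time preserve the geodesic equation. -/
theorem GeodesicAt.comp_affine {γ : ℝ → M} {a b t : ℝ} (hγ : GeodesicAt n γ (a * t + b)) :
    GeodesicAt n (fun s => γ (a * s + b)) t := by
  set c := γ (a * t + b)
  have hc : γ (a * t + b) ∈ (chartAt (Euc n) c).source := mem_chart_source _ _
  have hf : ContMDiffAt 𝓘(ℝ, ℝ) 𝓘(ℝ, ℝ) 2 (fun s : ℝ => a * s + b) t := by
    apply ContDiffAt.contMDiffAt
    fun_prop
  refine (geodesicAt_iff (γ := fun s => γ (a * s + b)) hc).2 ⟨ContMDiffAt.comp t hγ.1 hf, ?_⟩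
  have hd : ∀ s, deriv (fun s : ℝ => a * s + b) s = a := fun s => by simp
  have hx := contDiffAt_inChart (k := 2) hγ.1 hc
  have hcont : ContinuousAt (fun s : ℝ => a * s + b) t := by fun_prop
  have e1 : deriv (inChart n c fun s => γ (a * s + b)) =ᶠ[𝓝 t]
      fun s => a • deriv (inChart n c γ) (a * s + b) := by
    have h1 : ∀ᶠ s in 𝓝 t, ContDiffAt ℝ 2 (inChart n c γ) (a * s + b) :=
      hcont.eventually (hx.eventually (by simp))
    filter_upwards [h1] with s hs
    have := HasDerivAt.scomp (𝕜 := ℝ) s (hs.differentiableAt two_ne_zero).hasDerivAt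
      (((hasDerivAt_id s).const_mul a).add_const b)
    rw [mul_one] at this
    exact this.deriv
  have e2 : HasDerivAt (fun s => a • deriv (inChart n c γ) (a * s + b))
      (a • a • deriv (deriv (inChart n c γ)) (a * t + b)) t := by
    have := HasDerivAt.scomp (𝕜 := ℝ) t (hasDerivAt_deriv_of_contDiffAt hx)
      (((hasDerivAt_id t).const_mul a).add_const b)
    rw [mul_one] at this
    exact this.const_smul a
  rw [e1.deriv_eq, e2.deriv, e1.self_of_nhds, geodesicAcc_smul,
    ((geodesicAt_iff hc).1 hγ).2, smul_smul, ← sq]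
  rfl

end LocalGeodesics

/-! ### Charts of the tangent bundle -/

section TangentCharts

variable {n : ℕ} {M : Type*} [TopologicalSpace M] [ChartedSpace (EuclideanSpace ℝ (Fin n)) M]
  [IsManifold (𝓡 n) ∞ M]

/-- The chart of the tangent bundle given by the preferred chart at `c`. -/
def tangentChart (c : M) (v : TangentBundle (𝓡 n) M) : Euc n × Euc n :=
  (extChartAt (𝓡 n) c v.proj, mfderiv (𝓡 n) 𝓘(ℝ, Euc n) (extChartAt (𝓡 n) c) v.proj v.2)

/-- The inverse of `tangentChart`. -/
def tangentChartSymm (c : M) (z : Euc n × Euc n) : TangentBundle (𝓡 n) M :=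
  ⟨(extChartAt (𝓡 n) c).symm z.1, chartFrame c z.1 z.2⟩

theorem tangentChartSymm_tangentChart {c : M} {v : TangentBundle (𝓡 n) M}
    (hv : v.proj ∈ (chartAt (Euc n) c).source) : tangentChartSymm c (tangentChart c v) = v := by
  have h1 : (extChartAt (𝓡 n) c).symm (extChartAt (𝓡 n) c v.proj) = v.proj :=
    (extChartAt (𝓡 n) c).left_inv (by simpa using hv)
  exact TotalSpace.ext h1 (heq_of_eq (chartFrame_mfderiv_chart hv v.2))

theorem continuousOn_tangentChart (c : M) :
    ContinuousOn (tangentChart (n := n) c) (TotalSpace.proj ⁻¹' (chartAt (Euc n) c).source) := by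
  have h1 := ((contMDiffOn_extChartAt (I := 𝓡 n) (n := ∞) (x := c)).contMDiffOn_tangentMapWithin
    (m := 0) (by simp) (chartAt (Euc n) c).open_source.uniqueMDiffOn).continuousOn
  have h2 := (tangentBundleModelSpaceHomeomorph 𝓘(ℝ, Euc n)).continuous.comp_continuousOn h1
  refine h2.congr ?_
  intro v hv
  have e := mfderivWithin_of_isOpen (I := 𝓡 n) (I' := 𝓘(ℝ, Euc n)) (f := extChartAt (𝓡 n) c)
    (chartAt (Euc n) c).open_source hv
  exact Prod.ext rfl (congrArg (fun L : Euc n →L[ℝ] Euc n => L v.2) e.symm)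

theorem continuousOn_tangentChartSymm (c : M) :
    ContinuousOn (tangentChartSymm (n := n) c) ((extChartAt (𝓡 n) c).target ×ˢ univ) := by
  have h1 := ((contMDiffOn_extChartAt_symm (I := 𝓡 n) (n := ∞) c).contMDiffOn_tangentMapWithin
    (m := 0) (by simp) (isOpen_extChartAt_target c).uniqueMDiffOn).continuousOn
  have h2 := h1.comp (tangentBundleModelSpaceHomeomorph 𝓘(ℝ, Euc n)).symm.continuous.continuousOn
    (s := (extChartAt (𝓡 n) c).target ×ˢ univ) (fun z hz => hz.1)
  refine h2.congr ?_
  intro z hz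
  have e := mfderivWithin_of_isOpen (I := 𝓘(ℝ, Euc n)) (I' := 𝓡 n)
    (f := (extChartAt (𝓡 n) c).symm) (isOpen_extChartAt_target c) hz.1
  exact TotalSpace.ext rfl (heq_of_eq (congrArg (fun L : Euc n →L[ℝ] Euc n => L z.2) e.symm))

theorem tangentChart_velocity {c : M} {γ : ℝ → M} {t : ℝ}
    (hγ : MDifferentiableAt 𝓘(ℝ, ℝ) (𝓡 n) γ t) (hc : γ t ∈ (chartAt (Euc n) c).source) :
    tangentChart c (velocity n γ t) = (inChart n c γ t, deriv (inChart n c γ) t) := by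
  refine Prod.ext rfl ?_
  have h1 := ((contMDiffAt_chart hc).mdifferentiableAt (by simp)).hasMFDerivAt
  have h2 : HasFDerivAt (inChart n c γ)
      ((mfderiv (𝓡 n) 𝓘(ℝ, Euc n) (extChartAt (𝓡 n) c) (γ t) : Euc n →L[ℝ] Euc n) ∘L
        (mfderiv 𝓘(ℝ, ℝ) (𝓡 n) γ t : ℝ →L[ℝ] Euc n)) t :=
    (h1.comp t hγ.hasMFDerivAt).hasFDerivAt
  have h3 : HasDerivAt (inChart n c γ) _ t := HasFDerivAt.hasDerivAt h2
  exact (HasDerivAt.deriv h3).symm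

theorem velocity_eq_tangentChartSymm {c : M} {γ : ℝ → M} {t : ℝ}
    (hγ : MDifferentiableAt 𝓘(ℝ, ℝ) (𝓡 n) γ t) (hc : γ t ∈ (chartAt (Euc n) c).source) :
    velocity n γ t = tangentChartSymm c (inChart n c γ t, deriv (inChart n c γ) t) := by
  rw [← tangentChart_velocity hγ hc, tangentChartSymm_tangentChart hc]

theorem velocity_congr {γ γ' : ℝ → M} {t : ℝ} (h : γ =ᶠ[𝓝 t] γ') :
    velocity n γ t = velocity n γ' t := by
  have h0 := h.self_of_nhds
  refine TotalSpace.ext h0 (heq_of_eq ?_)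
  exact congrArg (fun L : ℝ →L[ℝ] Euc n => L 1) (h.mfderiv_eq (I := 𝓘(ℝ, ℝ)) (I' := 𝓡 n))

theorem velocity_comp_affine {γ : ℝ → M} {a b t : ℝ}
    (hγ : MDifferentiableAt 𝓘(ℝ, ℝ) (𝓡 n) γ (a * t + b)) :
    velocity n (fun s => γ (a * s + b)) t =
      ⟨γ (a * t + b), a • (velocity n γ (a * t + b)).2⟩ := by
  have h1 : HasMFDerivAt 𝓘(ℝ, ℝ) 𝓘(ℝ, ℝ) (fun s : ℝ => a * s + b) t
      (ContinuousLinearMap.toSpanSingleton ℝ a) := by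
    have : HasDerivAt (fun s : ℝ => a * s + b) a t := by
      simpa using ((hasDerivAt_id t).const_mul a).add_const b
    exact this.hasFDerivAt.hasMFDerivAt
  have h2 := (HasMFDerivAt.comp t (f := fun s : ℝ => a * s + b) hγ.hasMFDerivAt h1).mfderiv
  refine TotalSpace.ext rfl (heq_of_eq ?_)
  refine (congrArg (fun L : ℝ →L[ℝ] Euc n => L 1) h2).trans ?_
  have key : ∀ L : ℝ →L[ℝ] Euc n, L ((1 : ℝ) • a) = a • L 1 := fun L => by
    rw [← map_smul]
    simp
  exact key _

/-! ### Constant speed and uniqueness of geodesics -/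

section Unique

variable [RiemannianBundle (fun x : M => TangentSpace (𝓡 n) x)]
  [IsContMDiffRiemannianBundle (𝓡 n) ∞ (EuclideanSpace ℝ (Fin n))
    (fun x : M => TangentSpace (𝓡 n) x)]

theorem norm_tangentChartSymm_sq (c : M) (z : Euc n × Euc n) :
    ‖(tangentChartSymm c z : TangentBundle (𝓡 n) M).2‖ ^ 2 = metricForm c z.1 z.2 z.2 := by
  rw [metricForm_apply, real_inner_self_eq_norm_sq]
  rfl

theorem norm_velocity_sq {c : M} {γ : ℝ → M} {t : ℝ}
    (hγ : MDifferentiableAt 𝓘(ℝ, ℝ) (𝓡 n) γ t) (hc : γ t ∈ (chartAt (Euc n) c).source) :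
    ‖(velocity n γ t).2‖ ^ 2 =
      metricForm c (inChart n c γ t) (deriv (inChart n c γ) t) (deriv (inChart n c γ) t) := by
  rw [velocity_eq_tangentChartSymm hγ hc, norm_tangentChartSymm_sq]

theorem hasDerivAt_norm_velocity_sq {γ : ℝ → M} {t : ℝ} (hγ : ∀ᶠ s in 𝓝 t, GeodesicAt n γ s) :
    HasDerivAt (fun s => ‖(velocity n γ s).2‖ ^ 2) 0 t := by
  have hc : γ t ∈ (chartAt (Euc n) (γ t)).source := mem_chart_source _ _
  have h := hγ.self_of_nhds
  have ev := eventually_mem_source h.1.continuousAt hc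
  have e : (fun s => ‖(velocity n γ s).2‖ ^ 2) =ᶠ[𝓝 t] fun s => metricForm (γ t)
      (inChart n (γ t) γ s) (deriv (inChart n (γ t) γ) s) (deriv (inChart n (γ t) γ) s) := by
    filter_upwards [hγ, ev] with s h1 h2
    exact norm_velocity_sq (h1.1.mdifferentiableAt two_ne_zero) h2
  refine HasDerivAt.congr_of_eventuallyEq ?_ e
  have hd := h.hasDerivAt hc
  refine hasDerivAt_speed_sq (differentiableAt_metricForm (inChart_mem_target hc))
    (metricForm_symm _ _) hd.1 hd.2 ?_
  rw [eulerLagrange_eq_zero_iff (metricForm_isInvertible (inChart_mem_target hc))]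

/-- Geodesics have constant speed. -/
theorem norm_velocity_eq {γ : ℝ → M} {s : Set ℝ} (hs : IsOpen s) (hsc : IsPreconnected s)
    (hγ : ∀ t ∈ s, GeodesicAt n γ t) {t t' : ℝ} (ht : t ∈ s) (ht' : t' ∈ s) :
    ‖(velocity n γ t).2‖ = ‖(velocity n γ t').2‖ := by
  have h : ∀ r ∈ s, HasDerivAt (fun s => ‖(velocity n γ s).2‖ ^ 2) 0 r := fun r hr =>
    hasDerivAt_norm_velocity_sq (eventually_of_mem (hs.mem_nhds hr) hγ)
  have h1 := hs.is_const_of_deriv_eq_zero hsc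
    (fun r hr => (h r hr).differentiableAt.differentiableWithinAt) (fun r hr => (h r hr).deriv)
    ht ht'
  exact (sq_eq_sq₀ (norm_nonneg _) (norm_nonneg _)).1 h1

/-- In a chart, position and velocity solve an autonomous first-order system whose right-hand side
is `C¹`, hence locally Lipschitz, so solutions with the same initial value agree locally. -/
theorem geodesic_eventuallyEq {γ₁ γ₂ : ℝ → M} {t : ℝ} (h₁ : ∀ᶠ s in 𝓝 t, GeodesicAt n γ₁ s)
    (h₂ : ∀ᶠ s in 𝓝 t, GeodesicAt n γ₂ s) (h : velocity n γ₁ t = velocity n γ₂ t) :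
    γ₁ =ᶠ[𝓝 t] γ₂ := by
  set c := γ₁ t with hcdef
  have h0 : γ₁ t = γ₂ t := congrArg TotalSpace.proj h
  have hc₁ : γ₁ t ∈ (chartAt (Euc n) c).source := mem_chart_source _ _
  have hc₂ : γ₂ t ∈ (chartAt (Euc n) c).source := h0 ▸ hc₁
  have g₁ := h₁.self_of_nhds
  have g₂ := h₂.self_of_nhds
  set z₁ : ℝ → Euc n × Euc n := fun s => (inChart n c γ₁ s, deriv (inChart n c γ₁) s)
  set z₂ : ℝ → Euc n × Euc n := fun s => (inChart n c γ₂ s, deriv (inChart n c γ₂) s)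
  have hz : z₁ t = z₂ t := by
    simp only [z₁, z₂]
    rw [← tangentChart_velocity (g₁.1.mdifferentiableAt two_ne_zero) hc₁,
      ← tangentChart_velocity (g₂.1.mdifferentiableAt two_ne_zero) hc₂, h]
  have hF : ContDiffAt ℝ 1 (fun z : Euc n × Euc n => (z.2, geodesicAcc (metricForm c) z.1 z.2))
      (z₁ t) := contDiffAt_snd.prodMk (contDiffAt_geodesicAcc (inChart_mem_target hc₁) _)
  obtain ⟨L, S, hS, hL⟩ := hF.exists_lipschitzOnWith
  have ev₁ := eventually_mem_source g₁.1.continuousAt hc₁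
  have ev₂ := eventually_mem_source g₂.1.continuousAt hc₂
  have d₁ : ∀ᶠ s in 𝓝 t, HasDerivAt z₁ ((z₁ s).2, geodesicAcc (metricForm c) (z₁ s).1 (z₁ s).2)
      s := by
    filter_upwards [h₁, ev₁] with s hs1 hs2
    exact (hs1.hasDerivAt hs2).1.prodMk (hs1.hasDerivAt hs2).2
  have d₂ : ∀ᶠ s in 𝓝 t, HasDerivAt z₂ ((z₂ s).2, geodesicAcc (metricForm c) (z₂ s).1 (z₂ s).2)
      s := by
    filter_upwards [h₂, ev₂] with s hs1 hs2
    exact (hs1.hasDerivAt hs2).1.prodMk (hs1.hasDerivAt hs2).2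
  have s₁ : ∀ᶠ s in 𝓝 t, z₁ s ∈ S := d₁.self_of_nhds.continuousAt.preimage_mem_nhds hS
  have s₂ : ∀ᶠ s in 𝓝 t, z₂ s ∈ S := d₂.self_of_nhds.continuousAt.preimage_mem_nhds (hz ▸ hS)
  have key := ODE_solution_unique_of_eventually
    (v := fun _ z => (z.2, geodesicAcc (metricForm c) z.1 z.2)) (s := fun _ => S)
    (Eventually.of_forall fun _ => hL) (d₁.and s₁) (d₂.and s₂) hz
  filter_upwards [key, ev₁, ev₂] with s hs hs1 hs2
  rw [← symm_inChart hs1, ← symm_inChart hs2]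
  exact congrArg _ (congrArg Prod.fst hs)

/-- Two geodesics with the same velocity at some time coincide. -/
theorem geodesic_eqOn [T2Space M] {γ₁ γ₂ : ℝ → M} {s : Set ℝ} (hs : IsOpen s)
    (hsc : IsPreconnected s) (h₁ : ∀ t ∈ s, GeodesicAt n γ₁ t) (h₂ : ∀ t ∈ s, GeodesicAt n γ₂ t)
    {t₀ : ℝ} (ht₀ : t₀ ∈ s) (h : velocity n γ₁ t₀ = velocity n γ₂ t₀) : EqOn γ₁ γ₂ s := by
  have e₁ : ∀ t ∈ s, ∀ᶠ r in 𝓝 t, GeodesicAt n γ₁ r := fun t ht =>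
    eventually_of_mem (hs.mem_nhds ht) h₁
  have e₂ : ∀ t ∈ s, ∀ᶠ r in 𝓝 t, GeodesicAt n γ₂ r := fun t ht =>
    eventually_of_mem (hs.mem_nhds ht) h₂
  -- The times at which the germs agree form an open set. It is relatively closed in `s`: positions
  -- and chart velocities are continuous, so their agreement passes to the limit, where local
  -- uniqueness applies again.
  have key : s ⊆ {t | γ₁ =ᶠ[𝓝 t] γ₂} := by
    refine hsc.subset_of_closure_inter_subset ?_ ⟨t₀, ht₀,
      geodesic_eventuallyEq (e₁ _ ht₀) (e₂ _ ht₀) h⟩ ?_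
    · exact isOpen_setOfPred_eventually_nhds
    · rintro t ⟨htc, hts⟩
      have hfr : ∃ᶠ r in 𝓝 t, γ₁ =ᶠ[𝓝 r] γ₂ := mem_closure_iff_frequently.1 htc
      have g₁ := h₁ t hts
      have g₂ := h₂ t hts
      have h0 : γ₁ t = γ₂ t := tendsto_nhds_unique_of_frequently_eq g₁.1.continuousAt
        g₂.1.continuousAt (hfr.mono fun r hr => hr.self_of_nhds)
      set c := γ₁ t with hcdef
      have hc₁ : γ₁ t ∈ (chartAt (Euc n) c).source := mem_chart_source _ _
      have hc₂ : γ₂ t ∈ (chartAt (Euc n) c).source := h0 ▸ hc₁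
      have hd : deriv (inChart n c γ₁) t = deriv (inChart n c γ₂) t := by
        refine tendsto_nhds_unique_of_frequently_eq (g₁.hasDerivAt hc₁).2.continuousAt
          (g₂.hasDerivAt hc₂).2.continuousAt (hfr.mono fun r hr => ?_)
        apply EventuallyEq.deriv_eq
        filter_upwards [hr] with q hq
        simp only [inChart, hq]
      refine geodesic_eventuallyEq (e₁ _ hts) (e₂ _ hts) ?_
      rw [velocity_eq_tangentChartSymm (g₁.1.mdifferentiableAt two_ne_zero) hc₁,
        velocity_eq_tangentChartSymm (g₂.1.mdifferentiableAt two_ne_zero) hc₂, hd]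
      simp only [inChart, ← h0]
      rfl
  exact fun t ht => (key ht).self_of_nhds

end Unique

end TangentCharts

/-! ### The local geodesic flow -/

section LocalFlow

/-- A local flow of a `C¹` vector field, staying in a given neighbourhood. -/
theorem exists_local_flow {E : Type*} [NormedAddCommGroup E] [NormedSpace ℝ E] [CompleteSpace E]
    {F : E → E} {z₀ : E} (hF : ContDiffAt ℝ 1 F z₀) {V : Set E} (hV : V ∈ 𝓝 z₀) :
    ∃ r > 0, ∃ ε > 0, ∃ (L : NNReal) (α : E → ℝ → E),
      (∀ z ∈ Metric.ball z₀ r, α z 0 = z ∧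
        ∀ t ∈ Ioo (-ε) ε, HasDerivAt (α z) (F (α z t)) t ∧ α z t ∈ V) ∧
      ∀ t ∈ Ioo (-ε) ε, LipschitzOnWith L (fun z => α z t) (Metric.ball z₀ r) := by
  obtain ⟨ε, hε, a, r, L₀, K, hr, hpl⟩ := IsPicardLindelof.of_contDiffAt_one hF
  obtain ⟨α, hα, L, hL⟩ :=
    (hpl 0).exists_forall_mem_closedBall_eq_hasDerivWithinAt_lipschitzOnWith
  simp only [zero_sub, zero_add] at hα hL
  obtain ⟨ρ, hρ, hρV⟩ := Metric.mem_nhds_iff.1 hV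
  have hr' : (0 : ℝ) < r := hr
  have hz₀ : z₀ ∈ Metric.closedBall z₀ (r : ℝ) := Metric.mem_closedBall_self hr'.le
  have h0 := hα z₀ hz₀
  have hd : ∀ z ∈ Metric.closedBall z₀ (r : ℝ), ∀ t ∈ Ioo (-ε) ε,
      HasDerivAt (α z) (F (α z t)) t := fun z hz t ht =>
    ((hα z hz).2 t (Ioo_subset_Icc_self ht)).hasDerivAt (Icc_mem_nhds ht.1 ht.2)
  have hc : ContinuousAt (α z₀) 0 := (hd z₀ hz₀ 0 ⟨by linarith, hε⟩).continuousAt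
  obtain ⟨δ, hδ, hδ'⟩ := Metric.continuousAt_iff.1 hc (ρ / 2) (by positivity)
  -- One half of `ρ` is used for the drift of the central solution, the other for the Lipschitz
  -- dependence on the initial value.
  refine ⟨min r (ρ / 2 / (L + 1)), lt_min hr' (by positivity), min ε δ, lt_min hε hδ, L, α, ?_, ?_⟩
  · intro z hz
    have hzr : z ∈ Metric.closedBall z₀ (r : ℝ) :=
      Metric.ball_subset_closedBall (Metric.ball_subset_ball (min_le_left _ _) hz)
    refine ⟨(hα z hzr).1, fun t ht => ?_⟩
    have htε : t ∈ Ioo (-ε) ε :=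
      ⟨by linarith [ht.1, min_le_left ε δ], ht.2.trans_le (min_le_left _ _)⟩
    refine ⟨hd z hzr t htε, hρV ?_⟩
    have h1 : dist (α z₀ t) z₀ < ρ / 2 := by
      have := hδ' (x := t) (by
        rw [Real.dist_eq, sub_zero, abs_lt]
        exact ⟨by linarith [ht.1, min_le_right ε δ], ht.2.trans_le (min_le_right _ _)⟩)
      rwa [h0.1] at this
    have h2 : dist (α z t) (α z₀ t) ≤ L * dist z z₀ :=
      (hL t (Ioo_subset_Icc_self htε)).dist_le_mul z hzr z₀ hz₀
    have h3 : dist z z₀ < ρ / 2 / (L + 1) := hz.trans_le (min_le_right _ _)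
    have h4 : L * dist z z₀ ≤ ρ / 2 := by
      have h5 : (L + 1 : ℝ) * dist z z₀ ≤ ρ / 2 := by
        rw [lt_div_iff₀ (by positivity)] at h3
        linarith
      linarith [dist_nonneg (x := z) (y := z₀)]
    exact Metric.mem_ball.2 ((dist_triangle _ _ _).trans_lt (by linarith))
  · intro t ht
    have htε : t ∈ Ioo (-ε) ε :=
      ⟨by linarith [ht.1, min_le_left ε δ], ht.2.trans_le (min_le_left _ _)⟩
    exact (hL t (Ioo_subset_Icc_self htε)).mono
      ((Metric.ball_subset_ball (min_le_left _ _)).trans Metric.ball_subset_closedBall)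

variable {n : ℕ} {M : Type*} [TopologicalSpace M] [ChartedSpace (EuclideanSpace ℝ (Fin n)) M]
  [IsManifold (𝓡 n) ∞ M]
  [RiemannianBundle (fun x : M => TangentSpace (𝓡 n) x)]
  [IsContMDiffRiemannianBundle (𝓡 n) ∞ (EuclideanSpace ℝ (Fin n))
    (fun x : M => TangentSpace (𝓡 n) x)]

/-- The first order system of the geodesics in a chart. -/
def geodesicField (n : ℕ) {M : Type*} [TopologicalSpace M]
    [ChartedSpace (EuclideanSpace ℝ (Fin n)) M]
    [RiemannianBundle (fun x : M => TangentSpace (𝓡 n) x)] (c : M) (z : Euc n × Euc n) :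
    Euc n × Euc n :=
  (z.2, geodesicAcc (metricForm c) z.1 z.2)

theorem contDiffAt_geodesicField {c : M} {z : Euc n × Euc n}
    (hz : z.1 ∈ (extChartAt (𝓡 n) c).target) : ContDiffAt ℝ 1 (geodesicField n c) z :=
  contDiffAt_snd.prodMk (contDiffAt_geodesicAcc hz _)

/-- The geodesic flow in a chart. -/
theorem exists_geodesic_flow (c : M) {z₀ : Euc n × Euc n}
    (hz₀ : z₀.1 ∈ (extChartAt (𝓡 n) c).target) :
    ∃ r > 0, ∃ ε > 0, ∃ (L : NNReal) (α : Euc n × Euc n → ℝ → Euc n × Euc n),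
      (∀ z ∈ Metric.ball z₀ r, α z 0 = z ∧ ∀ t ∈ Ioo (-ε) ε,
        HasDerivAt (α z) (geodesicField n c (α z t)) t ∧
        (α z t).1 ∈ (extChartAt (𝓡 n) c).target) ∧
      ∀ t ∈ Ioo (-ε) ε, LipschitzOnWith L (fun z => α z t) (Metric.ball z₀ r) :=
  exists_local_flow (contDiffAt_geodesicField hz₀)
    (((isOpen_extChartAt_target c).preimage continuous_fst).mem_nhds hz₀)

theorem geodesicAt_of_flow {c : M} {a b : ℝ} {z : ℝ → Euc n × Euc n}
    (h : ∀ t ∈ Ioo a b, HasDerivAt z (geodesicField n c (z t)) t ∧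
      (z t).1 ∈ (extChartAt (𝓡 n) c).target) {t : ℝ} (ht : t ∈ Ioo a b) :
    GeodesicAt n (fun s => (extChartAt (𝓡 n) c).symm (z s).1) t ∧
      velocity n (fun s => (extChartAt (𝓡 n) c).symm (z s).1) t = tangentChartSymm c (z t) := by
  have hfst : ∀ s ∈ Ioo a b, HasDerivAt (fun r => (z r).1) (z s).2 s := fun s hs =>
    (ContinuousLinearMap.fst ℝ (Euc n) (Euc n)).hasFDerivAt.comp_hasDerivAt s (h s hs).1
  have hsnd : ∀ s ∈ Ioo a b, HasDerivAt (fun r => (z r).2)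
      (geodesicAcc (metricForm c) (z s).1 (z s).2) s := fun s hs =>
    (ContinuousLinearMap.snd ℝ (Euc n) (Euc n)).hasFDerivAt.comp_hasDerivAt s (h s hs).1
  have hg : GeodesicAt n (fun s => (extChartAt (𝓡 n) c).symm (z s).1) t :=
    geodesicAt_of_hasDerivAt (h t ht).2
      (eventually_of_mem (Ioo_mem_nhds ht.1 ht.2) fun s hs => ⟨hfst s hs, hsnd s hs⟩)
  refine ⟨hg, ?_⟩
  have e : inChart n c (fun s => (extChartAt (𝓡 n) c).symm (z s).1) =ᶠ[𝓝 t] fun s => (z s).1 := by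
    filter_upwards [Ioo_mem_nhds ht.1 ht.2] with s hs
    exact (extChartAt (𝓡 n) c).right_inv (h s hs).2
  rw [velocity_eq_tangentChartSymm (c := c) (hg.1.mdifferentiableAt two_ne_zero)
    (chart_symm_mem (h t ht).2), e.deriv_eq, e.self_of_nhds, (hfst t ht).deriv]

theorem exists_chart_metricBounds (c : M) {y : Euc n} (hy : y ∈ (extChartAt (𝓡 n) c).target) :
    ∃ R lam C, MetricBounds (metricForm (n := n) c) y R lam C ∧
      Metric.ball y R ⊆ (extChartAt (𝓡 n) c).target :=
  exists_metricBounds (isOpen_extChartAt_target c) hy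
    ((contDiffOn_metricForm c).of_le two_le_infty) (fun y _ => metricForm_symm c y)
    (fun _ hu => metricForm_pos hy hu)

/-- Geodesics starting near a point with speed at most `1` exist for a uniform time. -/
theorem exists_uniform_time (p : M) : ∃ U ∈ 𝓝 p, ∃ ε > 0, ∀ v : TangentBundle (𝓡 n) M,
    v.proj ∈ U → ‖v.2‖ ≤ 1 →
    ∃ γ : ℝ → M, (∀ t ∈ Ioo (-ε) ε, GeodesicAt n γ t) ∧ velocity n γ 0 = v := by
  have hp : p ∈ (chartAt (Euc n) p).source := mem_chart_source _ _
  set y₀ := extChartAt (𝓡 n) p p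
  have hy₀ : y₀ ∈ (extChartAt (𝓡 n) p).target := mem_extChartAt_target p
  obtain ⟨r, hr, ε, hε, L, α, hα, -⟩ := exists_geodesic_flow p (z₀ := (y₀, 0)) hy₀
  obtain ⟨R, lam, C, hB, hBt⟩ := exists_chart_metricBounds p hy₀
  have hcont : ContinuousAt (extChartAt (𝓡 n) p) p := continuousAt_extChartAt p
  have hU : {q | q ∈ (chartAt (Euc n) p).source ∧
      extChartAt (𝓡 n) p q ∈ Metric.ball y₀ (min R r)} ∈ 𝓝 p :=
    Filter.inter_mem ((chartAt (Euc n) p).open_source.mem_nhds hp)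
      (hcont.preimage_mem_nhds (Metric.ball_mem_nhds _ (lt_min hB.R_pos hr)))
  have hl : 0 < Real.sqrt lam := Real.sqrt_pos.2 hB.lam_pos
  -- Speed at most `1` bounds the coordinate velocity by `1 / √lam`, so scaling by `κ` brings it
  -- within `r / 2` of zero, inside the domain of the flow. Undoing the scaling turns the time `ε`
  -- into `ε κ`.
  set κ : ℝ := r * Real.sqrt lam / 2 with hκ
  have hκ0 : 0 < κ := by positivity
  refine ⟨_, hU, ε * κ, by positivity, fun v hv hv1 => ?_⟩
  set z := tangentChart p v with hz
  have hzR : z.1 ∈ Metric.ball y₀ R := Metric.ball_subset_ball (min_le_left _ _) hv.2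
  have hzr : z.1 ∈ Metric.ball y₀ r := Metric.ball_subset_ball (min_le_right _ _) hv.2
  have hvz : tangentChartSymm p z = v := tangentChartSymm_tangentChart hv.1
  have hn : lam * ‖z.2‖ ^ 2 ≤ 1 := by
    have h1 := hB.lower _ hzR z.2
    rw [← norm_tangentChartSymm_sq p z, hvz] at h1
    exact h1.trans (pow_le_one₀ (norm_nonneg _) hv1)
  have hn' : Real.sqrt lam * ‖z.2‖ ≤ 1 := by
    have h3 : (Real.sqrt lam * ‖z.2‖) ^ 2 ≤ 1 ^ 2 := by
      rw [mul_pow, Real.sq_sqrt hB.lam_pos.le, one_pow]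
      exact hn
    exact (pow_le_pow_iff_left₀ (by positivity) zero_le_one two_ne_zero).1 h3
  have hw : (z.1, κ • z.2) ∈ Metric.ball ((y₀, 0) : Euc n × Euc n) r := by
    rw [Metric.mem_ball, Prod.dist_eq]
    refine max_lt hzr ?_
    rw [dist_zero_right, norm_smul, Real.norm_eq_abs, abs_of_pos hκ0, hκ]
    have : r * Real.sqrt lam / 2 * ‖z.2‖ = r / 2 * (Real.sqrt lam * ‖z.2‖) := by ring
    rw [this]
    nlinarith
  obtain ⟨h0, hflow⟩ := hα _ hw
  set β : ℝ → M := fun s => (extChartAt (𝓡 n) p).symm (α (z.1, κ • z.2) s).1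
  have hβ : ∀ t ∈ Ioo (-ε) ε, GeodesicAt n β t := fun t ht => (geodesicAt_of_flow hflow ht).1
  have hβ0 := (geodesicAt_of_flow hflow (t := 0) ⟨by linarith, hε⟩).2
  have hβd : MDifferentiableAt 𝓘(ℝ, ℝ) (𝓡 n) β 0 :=
    (hβ 0 ⟨by linarith, hε⟩).1.mdifferentiableAt two_ne_zero
  have he : κ⁻¹ * 0 + 0 = (0 : ℝ) := by ring
  refine ⟨fun s => β (κ⁻¹ * s + 0), fun t ht => GeodesicAt.comp_affine (hβ _ ?_), ?_⟩
  · rw [add_zero, inv_mul_eq_div]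
    constructor
    · rw [lt_div_iff₀ hκ0]; linarith [ht.1]
    · rw [div_lt_iff₀ hκ0]; exact ht.2
  · rw [velocity_comp_affine (by rw [he]; exact hβd), he]
    rw [← hvz]
    have h1 : velocity n β 0 = tangentChartSymm p (z.1, κ • z.2) := by
      rw [← h0]; exact hβ0
    have h2 : (⟨β 0, (velocity n β 0).2⟩ : TangentBundle (𝓡 n) M) =
      tangentChartSymm p (z.1, κ • z.2) := h1
    have h3 : ∀ w : TangentBundle (𝓡 n) M, w = tangentChartSymm p (z.1, κ • z.2) →
        (⟨w.proj, κ⁻¹ • w.2⟩ : TangentBundle (𝓡 n) M) = tangentChartSymm p z := by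
      rintro _ rfl
      refine TotalSpace.ext rfl (heq_of_eq ?_)
      change κ⁻¹ • chartFrame p z.1 (κ • z.2) = chartFrame p z.1 z.2
      rw [map_smul, smul_smul, inv_mul_cancel₀ hκ0.ne', one_smul]
    exact h3 _ h2

end LocalFlow

/-! ### Distance bounded by length -/

section Distance

open MeasureTheory

variable {n : ℕ} {M : Type*} [MetricSpace M] [ChartedSpace (EuclideanSpace ℝ (Fin n)) M]
  [IsManifold (𝓡 n) ∞ M]
  [RiemannianBundle (fun x : M => TangentSpace (𝓡 n) x)]
  [IsContMDiffRiemannianBundle (𝓡 n) ∞ (EuclideanSpace ℝ (Fin n))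
    (fun x : M => TangentSpace (𝓡 n) x)]
  [IsRiemannianManifold (𝓡 n) M]

theorem dist_le_integral {γ : ℝ → M} {a b : ℝ} (hab : a ≤ b)
    (hγ : ContMDiffOn 𝓘(ℝ, ℝ) (𝓡 n) 1 γ (Icc a b)) {s : ℝ → ℝ} (hs : ContinuousOn s (Icc a b))
    (h : ∀ t ∈ Ioo a b, ‖(velocity n γ t).2‖ ≤ s t) : dist (γ a) (γ b) ≤ ∫ t in a..b, s t := by
  have hnn : ∀ t ∈ Ioo a b, 0 ≤ s t := fun t ht => (norm_nonneg _).trans (h t ht)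
  have hint : IntegrableOn s (Ioo a b) := (hs.integrableOn_Icc).mono_set Ioo_subset_Icc_self
  have h1 : edist (γ a) (γ b) ≤ ENNReal.ofReal (∫ t in Ioo a b, s t) := by
    rw [IsRiemannianManifold.out (I := 𝓡 n) (γ a) (γ b)]
    refine (riemannianEDist_le_pathELength hγ rfl rfl hab).trans ?_
    rw [pathELength_eq_lintegral_mfderiv_Ioo,
      ofReal_integral_eq_lintegral_ofReal hint
        ((ae_restrict_iff' measurableSet_Ioo).2 (Eventually.of_forall hnn))]
    refine setLIntegral_mono_ae' measurableSet_Ioo (Eventually.of_forall fun t ht => ?_)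
    rw [← ofReal_norm]
    exact ENNReal.ofReal_le_ofReal (h t ht)
  rw [intervalIntegral.integral_of_le hab, ← integral_Ioc_eq_integral_Ioo] at *
  rw [edist_dist] at h1
  refine (ENNReal.ofReal_le_ofReal_iff ?_).1 h1
  rw [integral_Ioc_eq_integral_Ioo]
  exact setIntegral_nonneg measurableSet_Ioo hnn

theorem dist_le_of_geodesicAt {γ : ℝ → M} {a b ν : ℝ} (hab : a ≤ b)
    (hγ : ∀ t ∈ Icc a b, GeodesicAt n γ t) (h : ∀ t ∈ Icc a b, ‖(velocity n γ t).2‖ ≤ ν) :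
    dist (γ a) (γ b) ≤ ν * (b - a) := by
  have := dist_le_integral (n := n) (γ := γ) hab
    (fun t ht => ((hγ t ht).1.of_le one_le_two).contMDiffWithinAt)
    (s := fun _ => ν) continuousOn_const fun t ht => h t (Ioo_subset_Icc_self ht)
  simpa [mul_comm] using this

end Distance

/-! ### Gluing geodesics -/

section Glue

variable {n : ℕ} {M : Type*} [TopologicalSpace M] [ChartedSpace (EuclideanSpace ℝ (Fin n)) M]
  [IsManifold (𝓡 n) ∞ M]
  [RiemannianBundle (fun x : M => TangentSpace (𝓡 n) x)]
  [IsContMDiffRiemannianBundle (𝓡 n) ∞ (EuclideanSpace ℝ (Fin n))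
    (fun x : M => TangentSpace (𝓡 n) x)]

theorem velocity_shift {γ : ℝ → M} {b t : ℝ} (hγ : GeodesicAt n γ (t + b)) :
    velocity n (fun s => γ (s + b)) t = velocity n γ (t + b) := by
  have h := velocity_comp_affine (n := n) (γ := γ) (a := 1) (b := b) (t := t)
    (by rw [one_mul]; exact hγ.1.mdifferentiableAt two_ne_zero)
  simp only [one_mul, one_smul] at h
  have key : ∀ x, x = t + b →
      (⟨γ x, (velocity n γ x).2⟩ : TangentBundle (𝓡 n) M) = velocity n γ (t + b) := by
    rintro _ rfl
    rfl
  exact h.trans (key _ (by rw [one_mul]))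

theorem GeodesicAt.shift {γ : ℝ → M} {b t : ℝ} (hγ : GeodesicAt n γ (t + b)) :
    GeodesicAt n (fun s => γ (s + b)) t := by
  have h := GeodesicAt.comp_affine (n := n) (γ := γ) (a := 1) (b := b) (t := t)
    (by rw [one_mul]; exact hγ)
  simp only [one_mul] at h
  exact h

/-- Two geodesics with the same velocity at a common time can be glued. -/
theorem exists_geodesic_glue [T2Space M] {γ β : ℝ → M} {a b c d t₁ : ℝ}
    (hγ : ∀ t ∈ Ioo a b, GeodesicAt n γ t) (hβ : ∀ t ∈ Ioo c d, GeodesicAt n β t)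
    (h₁ : t₁ ∈ Ioo a b) (h₂ : t₁ ∈ Ioo c d) (h : velocity n γ t₁ = velocity n β t₁) :
    ∃ γ' : ℝ → M, (∀ t ∈ Ioo a d, GeodesicAt n γ' t) ∧ ∀ t ≤ t₁, γ' =ᶠ[𝓝 t] γ ∨ t ≤ a := by
  have hmem : t₁ ∈ Ioo (max a c) (min b d) := ⟨max_lt h₁.1 h₂.1, lt_min h₁.2 h₂.2⟩
  have heq : EqOn γ β (Ioo (max a c) (min b d)) := geodesic_eqOn isOpen_Ioo isPreconnected_Ioo
    (fun t ht => hγ t ⟨(le_max_left _ _).trans_lt ht.1, ht.2.trans_le (min_le_left _ _)⟩)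
    (fun t ht => hβ t ⟨(le_max_right _ _).trans_lt ht.1, ht.2.trans_le (min_le_right _ _)⟩)
    hmem h
  set γ' : ℝ → M := fun t => if t ≤ t₁ then γ t else β t with hγ'
  have e₁ : ∀ t ≤ t₁, γ' =ᶠ[𝓝 t] γ := by
    intro t ht
    rcases ht.lt_or_eq with ht | rfl
    · filter_upwards [Iio_mem_nhds ht] with s hs
      simp [hγ', (mem_Iio.1 hs).le]
    · filter_upwards [isOpen_Ioo.mem_nhds hmem] with s hs
      by_cases h : s ≤ t
      · simp [hγ', h]
      · simp [hγ', h, heq hs]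
  refine ⟨γ', fun t ht => ?_, fun t ht => Or.inl (e₁ t ht)⟩
  rcases le_or_gt t t₁ with h | h
  · exact (hγ t ⟨ht.1, h.trans_lt h₁.2⟩).congr (e₁ t h)
  · refine (hβ t ⟨h₂.1.trans h, ht.2⟩).congr ?_
    filter_upwards [Ioi_mem_nhds h] with s hs
    simp [hγ', not_le.2 (mem_Ioi.1 hs)]

end Glue

/-! ### Geodesic completeness and continuity of the geodesic flow -/

section Complete

variable {n : ℕ} {M : Type*} [MetricSpace M] [ChartedSpace (EuclideanSpace ℝ (Fin n)) M]
  [IsManifold (𝓡 n) ∞ M]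
  [RiemannianBundle (fun x : M => TangentSpace (𝓡 n) x)]
  [IsContMDiffRiemannianBundle (𝓡 n) ∞ (EuclideanSpace ℝ (Fin n))
    (fun x : M => TangentSpace (𝓡 n) x)]
  [IsRiemannianManifold (𝓡 n) M] [CompleteSpace M]

/-- In a complete manifold a geodesic can be continued beyond the end of its interval. -/
theorem exists_geodesic_extend {γ : ℝ → M} {a b : ℝ} (ha : a < 0) (hb : 0 < b)
    (hγ : ∀ t ∈ Ioo a b, GeodesicAt n γ t) (h1 : ‖(velocity n γ 0).2‖ ≤ 1) :
    ∃ b' > b, ∃ γ' : ℝ → M, (∀ t ∈ Ioo a b', GeodesicAt n γ' t) ∧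
      velocity n γ' 0 = velocity n γ 0 := by
  have hs : ∀ t ∈ Ioo a b, ‖(velocity n γ t).2‖ ≤ 1 := fun t ht =>
    (norm_velocity_eq isOpen_Ioo isPreconnected_Ioo hγ ht ⟨ha, hb⟩).le.trans h1
  have hle : ∀ s ∈ Ioo a b, ∀ t ∈ Ioo a b, s ≤ t → dist (γ s) (γ t) ≤ dist s t := by
    intro s hs' t ht hst
    have hsub : Icc s t ⊆ Ioo a b := Icc_subset_Ioo hs'.1 ht.2
    have := dist_le_of_geodesicAt (n := n) hst (fun r hr => hγ r (hsub hr))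
      (fun r hr => hs r (hsub hr))
    rw [dist_comm s t, Real.dist_eq, abs_of_nonneg (by linarith)]
    linarith
  -- Bounded speed makes `γ` Lipschitz, so by completeness it has a limit at the end of its
  -- interval.
  have hlip : LipschitzOnWith 1 γ (Ioo a b) := by
    refine LipschitzOnWith.of_dist_le_mul fun s hs' t ht => ?_
    rw [NNReal.coe_one, one_mul]
    rcases le_total s t with h | h
    · exact hle s hs' t ht h
    · rw [dist_comm, dist_comm s t]
      exact hle t ht s hs' h
  have hab : a < b := ha.trans hb
  have hcl : b ∈ closure (Ioo a b) := by
    rw [closure_Ioo hab.ne]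
    exact right_mem_Icc.2 hab.le
  obtain ⟨p, hp⟩ : ∃ p, Tendsto γ (𝓝[Ioo a b] b) (𝓝 p) := by
    have : (𝓝[Ioo a b] b).NeBot := mem_closure_iff_nhdsWithin_neBot.1 hcl
    apply CompleteSpace.complete
    refine Cauchy.map_of_le ?_ hlip.uniformContinuousOn inf_le_right
    exact cauchy_nhds.mono inf_le_left
  obtain ⟨U, hU, ε, hε, hflow⟩ := exists_uniform_time (n := n) p
  have : (𝓝[Ioo a b] b).NeBot := mem_closure_iff_nhdsWithin_neBot.1 hcl
  -- The restart time lies within `ε / 2` of `b`, and geodesics from near `p` last for time `ε`, so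
  -- the new piece reaches beyond `b`.
  obtain ⟨t₁, hU₁, ht₁, hlo⟩ : ∃ t₁, γ t₁ ∈ U ∧ t₁ ∈ Ioo a b ∧ t₁ ∈ Ioi (max 0 (b - ε / 2)) :=
    ((hp.eventually_mem hU).and ((eventually_mem_nhdsWithin).and
      (mem_nhdsWithin_of_mem_nhds (Ioi_mem_nhds (max_lt hb (by linarith)))))).exists
  have hlo1 : 0 < t₁ := (le_max_left _ _).trans_lt hlo
  have hlo2 : b - ε / 2 < t₁ := (le_max_right _ _).trans_lt hlo
  obtain ⟨β, hβ, hβ0⟩ := hflow (velocity n γ t₁) hU₁ (hs _ ht₁)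
  have hβg : ∀ t ∈ Ioo (t₁ - ε) (t₁ + ε), GeodesicAt n (fun s => β (s + -t₁)) t := fun t ht =>
    GeodesicAt.shift (hβ _ ⟨by linarith [ht.1], by linarith [ht.2]⟩)
  obtain ⟨γ', hγ', heq⟩ := exists_geodesic_glue hγ hβg ht₁
    ⟨by linarith, by linarith⟩ (by
      rw [velocity_shift (hβ _ ⟨by linarith, by linarith⟩), add_neg_cancel, hβ0])
  refine ⟨t₁ + ε, by linarith, γ', hγ', ?_⟩
  rcases heq 0 hlo1.le with h | h
  · exact velocity_congr h
  · linarith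

/-- Geodesics of speed at most `1` exist for all times. -/
theorem exists_geodesic_of_norm_le_one (v : TangentBundle (𝓡 n) M) (hv : ‖v.2‖ ≤ 1) :
    ∃ γ : ℝ → M, IsGeodesic n γ ∧ velocity n γ 0 = v := by
  -- The half-lengths of symmetric intervals of existence. No element of `S` is the largest, while
  -- gluing would place a finite supremum in `S`; hence `S` is unbounded.
  set S : Set ℝ := {T | 0 < T ∧ ∃ γ : ℝ → M, (∀ t ∈ Ioo (-T) T, GeodesicAt n γ t) ∧
    velocity n γ 0 = v} with hS
  have hne : S.Nonempty := by
    obtain ⟨U, hU, ε, hε, h⟩ := exists_uniform_time (n := n) v.proj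
    exact ⟨ε, hε, h v (mem_of_mem_nhds hU) hv⟩
  have hext : ∀ T ∈ S, ∃ T' ∈ S, T < T' := by
    rintro T ⟨hT, γ, hγ, hγ0⟩
    obtain ⟨b, hb, γ₁, hγ₁, h₁⟩ := exists_geodesic_extend (by linarith) hT hγ (by rwa [hγ0])
    -- The left end is moved by reversing time, extending to the right, and reversing again.
    have hr : ∀ t ∈ Ioo (-b) T, GeodesicAt n (fun s => γ₁ (-1 * s + 0)) t := fun t ht =>
      GeodesicAt.comp_affine (hγ₁ _ ⟨by linarith [ht.2], by linarith [ht.1]⟩)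
    have hd : ∀ {γ : ℝ → M}, GeodesicAt n γ 0 →
        velocity n (fun s => γ (-1 * s + 0)) 0 = ⟨γ 0, (-1 : ℝ) • (velocity n γ 0).2⟩ := by
      intro γ h
      have h0 : (-1 : ℝ) * 0 + 0 = 0 := by norm_num
      rw [velocity_comp_affine (by rw [h0]; exact h.1.mdifferentiableAt two_ne_zero), h0]
    have hd₁ := hd (hγ₁ 0 ⟨by linarith, by linarith⟩)
    have hn : ‖(velocity n (fun s => γ₁ (-1 * s + 0)) 0).2‖ ≤ 1 := by
      have hn₁ : ‖(velocity n γ₁ 0).2‖ ≤ 1 := by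
        rw [h₁, hγ0]
        exact hv
      rw [hd₁]
      refine (norm_smul_le _ _).trans ?_
      rw [norm_neg, norm_one, one_mul]
      exact hn₁
    obtain ⟨b', hb', γ₂, hγ₂, h₂⟩ := exists_geodesic_extend (by linarith) hT hr hn
    refine ⟨min b b', ⟨lt_min (by linarith) (by linarith), fun s => γ₂ (-1 * s + 0),
      fun t ht => GeodesicAt.comp_affine (hγ₂ _ ?_), ?_⟩, lt_min hb hb'⟩
    · have := min_le_left b b'
      have := min_le_right b b'
      exact ⟨by linarith [ht.2], by linarith [ht.1]⟩
    · rw [hd (hγ₂ 0 ⟨by linarith, by linarith⟩)]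
      have h3 : ∀ w : TangentBundle (𝓡 n) M,
          w = ⟨γ₁ 0, (-1 : ℝ) • (velocity n γ₁ 0).2⟩ →
          (⟨w.proj, (-1 : ℝ) • w.2⟩ : TangentBundle (𝓡 n) M) = velocity n γ₁ 0 := by
        rintro _ rfl
        refine TotalSpace.ext rfl (heq_of_eq ?_)
        change (-1 : ℝ) • (-1 : ℝ) • (velocity n γ₁ 0).2 = (velocity n γ₁ 0).2
        rw [smul_smul]
        norm_num
      exact (h3 _ (h₂.trans hd₁)).trans (h₁.trans hγ0)
  have : Nonempty M := ⟨v.proj⟩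
  choose! Γ hΓ hΓ0 using fun T (hT : T ∈ S) => hT.2
  have hagree : ∀ T ∈ S, ∀ T' ∈ S, T ≤ T' → EqOn (Γ T) (Γ T') (Ioo (-T) T) :=
    fun T hT T' hT' hTT => geodesic_eqOn isOpen_Ioo isPreconnected_Ioo (hΓ T hT)
      (fun t ht => hΓ T' hT' t ⟨by linarith [ht.1], by linarith [ht.2]⟩)
      (t₀ := 0) ⟨by linarith [hT.1], hT.1⟩ ((hΓ0 T hT).trans (hΓ0 T' hT').symm)
  -- By uniqueness the geodesics `Γ T` agree on common intervals, so picking for each time any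
  -- admissible `T` defines a single geodesic.
  have hglue : ∀ I : Set ℝ, (∀ t ∈ I, ∃ T ∈ S, t ∈ Ioo (-T) T) → ∃ γ : ℝ → M,
      (∀ t ∈ I, GeodesicAt n γ t) ∧ velocity n γ 0 = v := by
    intro I hI
    classical
    obtain ⟨T₀, hT₀⟩ := hne
    set τ : ℝ → ℝ := fun t => if h : ∃ T ∈ S, t ∈ Ioo (-T) T then h.choose else T₀ with hτ
    have hτS : ∀ t, (∃ T ∈ S, t ∈ Ioo (-T) T) → τ t ∈ S ∧ t ∈ Ioo (-τ t) (τ t) := by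
      intro t h
      simp only [hτ, dif_pos h]
      exact h.choose_spec
    set γ : ℝ → M := fun t => Γ (τ t) t with hγ
    have heq : ∀ T ∈ S, EqOn γ (Γ T) (Ioo (-T) T) := by
      intro T hT t ht
      obtain ⟨h1, h2⟩ := hτS t ⟨T, hT, ht⟩
      rcases le_total T (τ t) with h | h
      · exact (hagree T hT _ h1 h ht).symm
      · exact hagree _ h1 T hT h h2
    refine ⟨γ, fun t ht => ?_, ?_⟩
    · obtain ⟨T, hT, htT⟩ := hI t ht
      exact (hΓ T hT t htT).congr (eventually_of_mem (isOpen_Ioo.mem_nhds htT) (heq T hT))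
    · rw [← hΓ0 T₀ hT₀]
      exact velocity_congr (eventually_of_mem (isOpen_Ioo.mem_nhds
        (⟨by linarith [hT₀.1], hT₀.1⟩ : (0 : ℝ) ∈ Ioo (-T₀) T₀)) (heq T₀ hT₀))
  by_cases hbdd : BddAbove S
  · exfalso
    obtain ⟨T₀, hT₀⟩ := hne
    have hmem : sSup S ∈ S := by
      refine ⟨hT₀.1.trans_le (le_csSup hbdd hT₀), hglue _ fun t ht => ?_⟩
      obtain ⟨T, hT, h⟩ := exists_lt_of_lt_csSup ⟨T₀, hT₀⟩ (abs_lt.2 ⟨by linarith [ht.1], ht.2⟩)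
      exact ⟨T, hT, abs_lt.1 h⟩
    obtain ⟨T', hT', h⟩ := hext _ hmem
    exact absurd (le_csSup hbdd hT') (not_le.2 h)
  · obtain ⟨γ, hγ, h0⟩ := hglue univ fun t _ => by
      obtain ⟨T, hT, h⟩ := not_bddAbove_iff.1 hbdd |t|
      exact ⟨T, hT, abs_lt.1 h⟩
    exact ⟨γ, isGeodesic_iff.2 fun t => hγ t (mem_univ t), h0⟩

theorem velocity_scale {γ : ℝ → M} {a t : ℝ} (hγ : GeodesicAt n γ (a * t)) :
    velocity n (fun s => γ (a * s)) t = ⟨γ (a * t), a • (velocity n γ (a * t)).2⟩ := by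
  have h := velocity_comp_affine (n := n) (γ := γ) (a := a) (b := 0) (t := t)
    (by rw [add_zero]; exact hγ.1.mdifferentiableAt two_ne_zero)
  simp only [add_zero] at h
  have key : ∀ x, x = a * t → (⟨γ x, a • (velocity n γ x).2⟩ : TangentBundle (𝓡 n) M) =
      ⟨γ (a * t), a • (velocity n γ (a * t)).2⟩ := by
    rintro _ rfl
    rfl
  exact h.trans (key _ (add_zero _))

theorem GeodesicAt.scale {γ : ℝ → M} {a t : ℝ} (hγ : GeodesicAt n γ (a * t)) :
    GeodesicAt n (fun s => γ (a * s)) t := by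
  have h := GeodesicAt.comp_affine (n := n) (γ := γ) (a := a) (b := 0) (t := t)
    (by rw [add_zero]; exact hγ)
  simp only [add_zero] at h
  exact h

/-- The theorem of Hopf and Rinow: in a complete manifold, geodesics exist for all times. -/
theorem exists_geodesic (v : TangentBundle (𝓡 n) M) :
    ∃ γ : ℝ → M, IsGeodesic n γ ∧ velocity n γ 0 = v := by
  set c : ℝ := ‖v.2‖ + 1
  have hc : 0 < c := by positivity
  obtain ⟨γ, hγ, h0⟩ := exists_geodesic_of_norm_le_one (⟨v.proj, c⁻¹ • v.2⟩ : TangentBundle (𝓡 n) M)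
    (by
      refine (norm_smul_le _ _).trans ?_
      rw [norm_inv, Real.norm_of_nonneg hc.le, inv_mul_le_iff₀ hc]
      simp [c])
  rw [isGeodesic_iff] at hγ
  refine ⟨fun s => γ (c * s), isGeodesic_iff.2 fun t => GeodesicAt.scale (hγ _), ?_⟩
  rw [velocity_scale (hγ _), mul_zero]
  have h3 : ∀ w : TangentBundle (𝓡 n) M, w = ⟨v.proj, c⁻¹ • v.2⟩ →
      (⟨w.proj, c • w.2⟩ : TangentBundle (𝓡 n) M) = v := by
    rintro _ rfl
    refine TotalSpace.ext rfl (heq_of_eq ?_)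
    change c • c⁻¹ • v.2 = v.2
    rw [smul_smul, mul_inv_cancel₀ hc.ne', one_smul]
  exact h3 _ h0

/-- The geodesic with initial velocity `v`. -/
def geod (v : TangentBundle (𝓡 n) M) : ℝ → M := (exists_geodesic v).choose

theorem geodesicAt_geod (v : TangentBundle (𝓡 n) M) (t : ℝ) : GeodesicAt n (geod v) t :=
  isGeodesic_iff.1 (exists_geodesic v).choose_spec.1 t

theorem velocity_geod_zero (v : TangentBundle (𝓡 n) M) : velocity n (geod v) 0 = v :=
  (exists_geodesic v).choose_spec.2

theorem geod_zero (v : TangentBundle (𝓡 n) M) : geod v 0 = v.proj :=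
  congrArg TotalSpace.proj (velocity_geod_zero v)

theorem eqOn_geod {γ : ℝ → M} {s : Set ℝ} (hs : IsOpen s) (hsc : IsPreconnected s)
    (hγ : ∀ t ∈ s, GeodesicAt n γ t) (h0 : (0 : ℝ) ∈ s) : EqOn γ (geod (velocity n γ 0)) s :=
  geodesic_eqOn hs hsc hγ (fun t _ => geodesicAt_geod _ t) h0 (velocity_geod_zero _).symm

theorem eq_geod {γ : ℝ → M} (hγ : ∀ t, GeodesicAt n γ t) {v : TangentBundle (𝓡 n) M}
    (h : velocity n γ 0 = v) : γ = geod v := by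
  subst h
  exact funext fun t => eqOn_geod isOpen_univ isPreconnected_univ (fun t _ => hγ t) (mem_univ _)
    (mem_univ t)

/-- Uniqueness makes the choices in `expMap` and in `geod` irrelevant. -/
theorem expMap_eq_geod (v : TangentBundle (𝓡 n) M) : expMap v = geod v 1 := by
  have h := exists_geodesic v
  rw [expMap, dif_pos h]
  exact congrFun (eq_geod (isGeodesic_iff.1 h.choose_spec.1) h.choose_spec.2) 1

theorem geod_smul (p : M) (v : TangentSpace (𝓡 n) p) (a t : ℝ) :
    geod (⟨p, a • v⟩ : TangentBundle (𝓡 n) M) t = geod (⟨p, v⟩ : TangentBundle (𝓡 n) M) (a * t) := by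
  refine (congrFun (eq_geod (γ := fun s => geod (⟨p, v⟩ : TangentBundle (𝓡 n) M) (a * s))
    (fun t => GeodesicAt.scale (geodesicAt_geod _ _)) ?_) t).symm
  rw [velocity_scale (geodesicAt_geod _ _), mul_zero]
  have h3 : ∀ w : TangentBundle (𝓡 n) M, w = ⟨p, v⟩ →
      (⟨w.proj, a • w.2⟩ : TangentBundle (𝓡 n) M) = ⟨p, a • v⟩ := by
    rintro _ rfl
    rfl
  exact h3 _ (velocity_geod_zero _)

theorem expMap_smul (p : M) (v : TangentSpace (𝓡 n) p) (t : ℝ) :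
    expMap (⟨p, t • v⟩ : TangentBundle (𝓡 n) M) = geod (⟨p, v⟩ : TangentBundle (𝓡 n) M) t := by
  rw [expMap_eq_geod, geod_smul, mul_one]

theorem geod_add (v : TangentBundle (𝓡 n) M) (s t : ℝ) :
    geod (velocity n (geod v) s) t = geod v (t + s) := by
  refine (congrFun (eq_geod (γ := fun t => geod v (t + s))
    (fun t => GeodesicAt.shift (geodesicAt_geod _ _)) ?_) t).symm
  rw [velocity_shift (geodesicAt_geod _ _), zero_add]

theorem norm_velocity_geod (v : TangentBundle (𝓡 n) M) (t : ℝ) :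
    ‖(velocity n (geod v) t).2‖ = ‖v.2‖ := by
  rw [norm_velocity_eq isOpen_univ isPreconnected_univ (fun t _ => geodesicAt_geod v t)
    (mem_univ t) (mem_univ 0), velocity_geod_zero]

theorem velocity_geod_add (v : TangentBundle (𝓡 n) M) (s t : ℝ) :
    velocity n (geod (velocity n (geod v) s)) t = velocity n (geod v) (t + s) := by
  rw [← velocity_shift (geodesicAt_geod _ _)]
  congr 1
  exact funext fun t => geod_add v s t

theorem continuous_velocity_geod (v : TangentBundle (𝓡 n) M) :
    Continuous fun t => velocity n (geod v) t := by
  rw [continuous_iff_continuousAt]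
  intro t
  set c := geod v t
  have hc : geod v t ∈ (chartAt (Euc n) c).source := mem_chart_source _ _
  have hd := (geodesicAt_geod v t).hasDerivAt hc
  have ev := eventually_mem_source (geodesicAt_geod v t).1.continuousAt hc
  have e : (fun t => velocity n (geod v) t) =ᶠ[𝓝 t] fun s => tangentChartSymm c
      (inChart n c (geod v) s, deriv (inChart n c (geod v)) s) := by
    filter_upwards [ev] with s hs
    exact velocity_eq_tangentChartSymm ((geodesicAt_geod v s).1.mdifferentiableAt two_ne_zero) hs
  refine ContinuousAt.congr ?_ e.symm
  have h1 : ContinuousAt (tangentChartSymm (n := n) c)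
      (inChart n c (geod v) t, deriv (inChart n c (geod v)) t) :=
    (continuousOn_tangentChartSymm c).continuousAt
      (((isOpen_extChartAt_target c).prod isOpen_univ).mem_nhds ⟨inChart_mem_target hc, mem_univ _⟩)
  exact ContinuousAt.comp (f := fun s => (inChart n c (geod v) s, deriv (inChart n c (geod v)) s))
    h1 (hd.1.continuousAt.prodMk hd.2.continuousAt)

/-- The geodesic flow is continuous for small times, locally uniformly. -/
theorem exists_continuousOn_velocity_geod (u : TangentBundle (𝓡 n) M) :
    ∃ N : Set (TangentBundle (𝓡 n) M), IsOpen N ∧ u ∈ N ∧ ∃ ε > 0, ∀ t ∈ Ioo (-ε) ε,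
      ContinuousOn (fun w => velocity n (geod w) t) N := by
  set c := u.proj with hcdef
  have hc : u.proj ∈ (chartAt (Euc n) c).source := mem_chart_source _ _
  have hz₀ : (tangentChart c u).1 ∈ (extChartAt (𝓡 n) c).target := mem_extChartAt_target c
  obtain ⟨r, hr, ε, hε, L, α, hα, hL⟩ := exists_geodesic_flow c hz₀
  have hcont := continuousOn_tangentChart (n := n) c
  refine ⟨TotalSpace.proj ⁻¹' (chartAt (Euc n) c).source ∩
    tangentChart c ⁻¹' Metric.ball (tangentChart c u) r, ?_, ⟨hc, Metric.mem_ball_self hr⟩, ε, hε,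
    fun t ht => ?_⟩
  · exact hcont.isOpen_inter_preimage ((chartAt (Euc n) c).open_source.preimage
      (FiberBundle.continuous_proj _ _)) Metric.isOpen_ball
  · have e : EqOn (fun w => velocity n (geod w) t)
        (fun w => tangentChartSymm c (α (tangentChart c w) t))
        (TotalSpace.proj ⁻¹' (chartAt (Euc n) c).source ∩
          tangentChart c ⁻¹' Metric.ball (tangentChart c u) r) := by
      rintro w ⟨hw, hwr⟩
      obtain ⟨h0, hflow⟩ := hα _ hwr
      have hg := fun s (hs : s ∈ Ioo (-ε) ε) => geodesicAt_of_flow hflow hs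
      have hv := (hg 0 ⟨by linarith, hε⟩).2
      rw [h0, tangentChartSymm_tangentChart hw] at hv
      have heq := eqOn_geod isOpen_Ioo isPreconnected_Ioo (fun s hs => (hg s hs).1)
        ⟨by linarith, hε⟩
      rw [hv] at heq
      simp only
      rw [← (hg t ht).2]
      exact velocity_congr (eventually_of_mem (isOpen_Ioo.mem_nhds ht) heq.symm)
    refine ContinuousOn.congr ?_ e
    refine (continuousOn_tangentChartSymm c).comp ((hL t ht).continuousOn.comp
      (hcont.mono inter_subset_left) fun w hw => hw.2) fun w hw => ⟨?_, mem_univ _⟩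
    exact ((hα _ hw.2).2 t ht).2

/-- The local statement has a time bound depending on the base vector. For a fixed `v`, the times at
which the flow is continuous at `v` form a nonempty clopen subset of `ℝ`. -/
theorem continuous_velocity_geod_left (t : ℝ) :
    Continuous fun w : TangentBundle (𝓡 n) M => velocity n (geod w) t := by
  rw [continuous_iff_continuousAt]
  intro v
  set A : Set ℝ := {t | ContinuousAt (fun w => velocity n (geod w) t) v} with hA
  -- By the flow law, time `t` is reached by first flowing to some `s ∈ A` close to `t₀` and then
  -- for the short time `t - s` near `velocity n (geod v) t₀`, where the local flow is continuous.
  have key : ∀ t₀ ∈ closure A, A ∈ 𝓝 t₀ := by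
    intro t₀ ht₀
    obtain ⟨N, hN, hu, ε, hε, hcont⟩ := exists_continuousOn_velocity_geod (velocity n (geod v) t₀)
    have ev : ∀ᶠ s in 𝓝 t₀, velocity n (geod v) s ∈ N :=
      (continuous_velocity_geod v).continuousAt.preimage_mem_nhds (hN.mem_nhds hu)
    obtain ⟨s, hsA, hsN, hsd⟩ := ((mem_closure_iff_frequently.1 ht₀).and_eventually
      (ev.and (Metric.ball_mem_nhds t₀ (half_pos hε)))).exists
    filter_upwards [Metric.ball_mem_nhds t₀ (half_pos hε)] with t ht
    have hts : t - s ∈ Ioo (-ε) ε := by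
      refine abs_lt.1 ?_
      rw [← Real.dist_eq]
      refine (dist_triangle t t₀ s).trans_lt ?_
      rw [dist_comm t₀ s]
      rw [Metric.mem_ball] at ht
      linarith
    have h1 : ContinuousAt (fun w => velocity n (geod w) (t - s)) (velocity n (geod v) s) :=
      (hcont _ hts).continuousAt (hN.mem_nhds hsN)
    have h2 : ContinuousAt (fun w => velocity n (geod (velocity n (geod w) s)) (t - s)) v :=
      ContinuousAt.comp (f := fun w => velocity n (geod w) s) h1 hsA
    simp only [velocity_geod_add, sub_add_cancel] at h2
    exact h2
  have hclopen : IsClopen A := by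
    refine ⟨?_, isOpen_iff_mem_nhds.2 fun t ht => key t (subset_closure ht)⟩
    exact isClosed_of_closure_subset fun t ht => mem_of_mem_nhds (key t ht)
  have h0 : (0 : ℝ) ∈ A := by
    have h : (fun w : TangentBundle (𝓡 n) M => velocity n (geod w) 0) = id :=
      funext velocity_geod_zero
    change ContinuousAt (fun w : TangentBundle (𝓡 n) M => velocity n (geod w) 0) v
    rw [h]
    exact continuousAt_id
  have ht : t ∈ A := hclopen.eq_univ ⟨0, h0⟩ ▸ mem_univ t
  exact ht

theorem dist_geod_le (v : TangentBundle (𝓡 n) M) {s t : ℝ} (h : s ≤ t) :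
    dist (geod v s) (geod v t) ≤ ‖v.2‖ * (t - s) :=
  dist_le_of_geodesicAt h (fun r _ => geodesicAt_geod v r) fun r _ => (norm_velocity_geod v r).le

end Complete

/-! ### The first variation inequality -/

section FirstVariation

variable {n : ℕ} {M : Type*} [MetricSpace M] [ChartedSpace (EuclideanSpace ℝ (Fin n)) M]
  [IsManifold (𝓡 n) ∞ M]
  [RiemannianBundle (fun x : M => TangentSpace (𝓡 n) x)]
  [IsContMDiffRiemannianBundle (𝓡 n) ∞ (EuclideanSpace ℝ (Fin n))
    (fun x : M => TangentSpace (𝓡 n) x)]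

theorem norm_velocity_chart_sq {c : M} {x : ℝ → Euc n} {x' : Euc n} {t : ℝ}
    (hx : HasDerivAt x x' t) (ht : x t ∈ (extChartAt (𝓡 n) c).target) :
    ‖(velocity n (fun s => (extChartAt (𝓡 n) c).symm (x s)) t).2‖ ^ 2 =
      metricForm c (x t) x' x' := by
  have hev : ∀ᶠ s in 𝓝 t, x s ∈ (extChartAt (𝓡 n) c).target :=
    hx.continuousAt.preimage_mem_nhds ((isOpen_extChartAt_target c).mem_nhds ht)
  have e : inChart n c (fun s => (extChartAt (𝓡 n) c).symm (x s)) =ᶠ[𝓝 t] x := by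
    filter_upwards [hev] with s hs using (extChartAt (𝓡 n) c).right_inv hs
  have hd : MDifferentiableAt 𝓘(ℝ, ℝ) (𝓡 n) (fun s => (extChartAt (𝓡 n) c).symm (x s)) t :=
    ((contMDiffAt_chart_symm ht).mdifferentiableAt (by simp)).comp t
      hx.differentiableAt.mdifferentiableAt
  rw [norm_velocity_sq (c := c) hd (chart_symm_mem ht), e.deriv_eq, e.self_of_nhds, hx.deriv]

/-- The speed `σ` satisfies `σ ≤ σ² / 2 + 1 / 2`, with equality at unit speed; thus nothing is lost
to first order near a unit speed geodesic. -/
theorem dist_chart_le_energy [IsRiemannianManifold (𝓡 n) M] {c : M} {x : ℝ → Euc n} {a b : ℝ}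
    (hab : a ≤ b) (hx : ∀ t ∈ Icc a b, ContDiffAt ℝ 1 x t)
    (hxt : ∀ t ∈ Icc a b, x t ∈ (extChartAt (𝓡 n) c).target) {g : ℝ → ℝ}
    (hg : ContinuousOn g (Icc a b))
    (hxg : ∀ t ∈ Icc a b, metricForm c (x t) (deriv x t) (deriv x t) = g t) :
    dist ((extChartAt (𝓡 n) c).symm (x a)) ((extChartAt (𝓡 n) c).symm (x b)) ≤
      (∫ t in a..b, 1 / 2 * g t) + (b - a) / 2 := by
  have h1 : ContMDiffOn 𝓘(ℝ, ℝ) (𝓡 n) 1 (fun s => (extChartAt (𝓡 n) c).symm (x s)) (Icc a b) := by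
    intro t ht
    exact (((contMDiffAt_chart_symm (hxt t ht)).of_le (by simp)).comp t
      (hx t ht).contMDiffAt).contMDiffWithinAt
  have hc : ContinuousOn (fun t => 1 / 2 * g t + 1 / 2) (Icc a b) := by fun_prop
  refine (dist_le_integral (n := n) hab h1 hc fun t ht => ?_).trans_eq ?_
  · have ht' := Ioo_subset_Icc_self ht
    have h2 := norm_velocity_chart_sq (c := c) ((hx t ht').differentiableAt one_ne_zero).hasDerivAt
      (hxt t ht')
    rw [hxg t ht'] at h2
    nlinarith [sq_nonneg
      (‖(velocity n (fun s => (extChartAt (𝓡 n) c).symm (x s)) t).2‖ - 1)]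
  · rw [intervalIntegral.integral_add, intervalIntegral.integral_const, smul_eq_mul]
    · ring
    · exact ContinuousOn.intervalIntegrable_of_Icc hab (by fun_prop)
    · exact intervalIntegrable_const

theorem GeodesicAt.eulerLagrange_inChart {c : M} {γ : ℝ → M} {t : ℝ} (hγ : GeodesicAt n γ t)
    (hc : γ t ∈ (chartAt (Euc n) c).source) : ∃ A, HasDerivAt (deriv (inChart n c γ)) A t ∧
      ∀ w, eulerLagrange (metricForm c) (inChart n c γ t) (deriv (inChart n c γ) t) A w = 0 :=
  ⟨_, (hγ.hasDerivAt hc).2,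
    (eulerLagrange_eq_zero_iff (metricForm_isInvertible (inChart_mem_target hc)) _ _).2 rfl⟩

/-- The first variation inequality, in a chart. -/
theorem exists_dist_le_chart [IsRiemannianManifold (𝓡 n) M] {c : M} {γ : ℝ → M}
    (hγ : ∀ t, GeodesicAt n γ t) (hc : γ 0 ∈ (chartAt (Euc n) c).source)
    (hu : ∀ t, ‖(velocity n γ t).2‖ = 1) {d : ℝ} (hd : 0 < d) :
    ∃ δ > 0, δ ≤ d ∧ ∃ C, ∀ᶠ k in 𝓝 (0 : Euc n),
      dist (γ (-δ)) ((extChartAt (𝓡 n) c).symm (inChart n c γ 0 + k)) ≤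
        δ + metricForm c (inChart n c γ 0) (deriv (inChart n c γ) 0) k + C * ‖k‖ ^ 2 := by
  set x := inChart n c γ with hx
  obtain ⟨R, lam, C, hB, hBt⟩ := exists_chart_metricBounds c (inChart_mem_target hc)
  have hxc : ContinuousAt x 0 := ((hγ 0).hasDerivAt hc).1.continuousAt
  have hR2 : 0 < R / 2 := half_pos hB.R_pos
  obtain ⟨δ₀, hδ₀, hsub⟩ := Metric.eventually_nhds_iff.1
    ((eventually_mem_source (hγ 0).1.continuousAt hc).and
      (hxc.preimage_mem_nhds (Metric.ball_mem_nhds (x 0) hR2)))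
  set δ := min (δ₀ / 2) d with hδdef
  have hδ : 0 < δ := lt_min (half_pos hδ₀) hd
  have hmem : ∀ t ∈ Icc (-δ) 0, γ t ∈ (chartAt (Euc n) c).source ∧ x t ∈ Metric.ball (x 0) (R / 2) := by
    intro t ht
    refine hsub ?_
    rw [Real.dist_eq, sub_zero, abs_lt]
    have := min_le_left (δ₀ / 2) d
    constructor <;> linarith [ht.1, ht.2]
  have hxd : ∀ t ∈ Icc (-δ) 0, ContDiffAt ℝ 2 x t := fun t ht =>
    contDiffAt_inChart (k := 2) (hγ t).1 (hmem t ht).1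
  have hder : ∀ t ∈ Icc (-δ) 0, HasDerivAt x (deriv x t) t := fun t ht =>
    ((hγ t).hasDerivAt (hmem t ht).1).1
  have hder2 : ∀ t ∈ Icc (-δ) 0, ContinuousAt (deriv x) t := fun t ht =>
    ((hγ t).hasDerivAt (hmem t ht).1).2.continuousAt
  have hG : ∀ t ∈ Icc (-δ) 0, metricForm c (x t) (deriv x t) (deriv x t) = 1 := fun t ht => by
    rw [← norm_velocity_sq ((hγ t).1.mdifferentiableAt two_ne_zero) (hmem t ht).1, hu, one_pow]
  -- Unit speed and the lower bound of the metric give `lam ‖x'‖² ≤ 1`.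
  set ν := Real.sqrt (1 / lam) with hν
  have hU : ∀ t ∈ Icc (-δ) 0, ‖deriv x t‖ ≤ ν := by
    intro t ht
    apply Real.le_sqrt_of_sq_le
    have := hB.lower (x t) (Metric.ball_subset_ball (by linarith) (hmem t ht).2) (deriv x t)
    rw [hG t ht] at this
    rw [le_div_iff₀ hB.lam_pos]
    linarith
  -- The coefficient of `‖k‖²` in the remainder, from `‖η‖ = ‖k‖ / δ`, `‖h‖ ≤ ‖k‖` and `‖U‖ ≤ ν`.
  set D := C / 2 * (1 / δ) ^ 2 + C * ν * (1 / δ) + C / 2 * ν ^ 2 with hD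
  refine ⟨δ, hδ, min_le_right _ _, δ * D, ?_⟩
  filter_upwards [Metric.ball_mem_nhds (0 : Euc n) hR2] with k hk
  rw [mem_ball_zero_iff] at hk
  have hδne := hδ.ne'
  -- The linear variation that fixes the end at `-δ` and moves the end at `0` by `k`; only the
  -- boundary term at `0` survives.
  set h : ℝ → Euc n := fun τ => (1 + τ / δ) • k with hh
  have hhd : ∀ t, HasDerivAt h ((1 / δ) • k) t := fun t =>
    (((hasDerivAt_id t).div_const δ).const_add 1).smul_const k
  have hhn : ∀ t ∈ Icc (-δ) 0, ‖h t‖ ≤ ‖k‖ := by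
    intro t ht
    rw [hh]
    simp only [norm_smul, Real.norm_eq_abs]
    have h1 : -1 ≤ t / δ := by rw [le_div_iff₀ hδ]; linarith [ht.1]
    have h2 : t / δ ≤ 0 := div_nonpos_of_nonpos_of_nonneg ht.2 hδ.le
    rw [abs_of_nonneg (by linarith)]
    exact mul_le_of_le_one_left (norm_nonneg _) (by linarith)
  have hVar : GeodesicVariation (metricForm (n := n) c) (x 0) R (-δ) 0 (fun _ => 1) x (deriv x) h
      (fun _ => (1 / δ) • k) :=
    { le := by linarith
      cont_m := continuousOn_const
      cont_X := fun t ht => (hder t ht).continuousAt.continuousWithinAt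
      cont_U := fun t ht => (hder2 t ht).continuousWithinAt
      cont_h := fun t _ => (hhd t).continuousAt.continuousWithinAt
      cont_η := continuousOn_const
      nonneg_m := fun _ _ => zero_le_one
      mapsTo_X := fun t ht => Metric.ball_subset_ball (by linarith) (hmem t ht).2
      mapsTo_add := fun t ht => by
        have h1 := hhn t ht
        have h2 := Metric.mem_ball.1 (hmem t ht).2
        rw [dist_eq_norm] at h2
        rw [Metric.mem_ball, dist_eq_norm]
        calc ‖x t + h t - x 0‖ = ‖(x t - x 0) + h t‖ := by congr 1; abel
          _ ≤ ‖x t - x 0‖ + ‖h t‖ := norm_add_le _ _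
          _ < R := by linarith
      deriv_X := fun t ht => by
        rw [one_smul]
        exact hder t (Ioo_subset_Icc_self ht)
      deriv_h := fun t _ => by
        rw [one_smul]
        exact hhd t
      deriv_U := fun t ht => by
        obtain ⟨A, hA, hEL⟩ := (hγ t).eulerLagrange_inChart (hmem t (Ioo_subset_Icc_self ht)).1
        exact ⟨A, by rw [one_smul]; exact hA, hEL⟩ }
  have hE := hVar.energy_le hB (ρ := fun _ => D * ‖k‖ ^ 2) continuousOn_const (by
    intro t ht
    have h1 := hhn t ht
    have h2 := hU t ht
    have h3 : ‖(1 / δ) • k‖ = 1 / δ * ‖k‖ := by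
      rw [norm_smul, Real.norm_of_nonneg (by positivity)]
    have hC := hB.C_nonneg
    rw [h3]
    calc C / 2 * (1 / δ * ‖k‖) ^ 2 + C * ‖h t‖ * ‖deriv x t‖ * (1 / δ * ‖k‖) +
          C / 2 * ‖h t‖ ^ 2 * ‖deriv x t‖ ^ 2
        ≤ C / 2 * (1 / δ * ‖k‖) ^ 2 + C * ‖k‖ * ν * (1 / δ * ‖k‖) +
          C / 2 * ‖k‖ ^ 2 * ν ^ 2 := by gcongr
      _ = D * ‖k‖ ^ 2 := by rw [hD]; ring)
  have hdist := dist_chart_le_energy (c := c) (x := fun t => x t + h t) (a := -δ) (b := 0)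
    (g := fun t => metricForm c (x t + h t) (deriv x t + (1 / δ) • k) (deriv x t + (1 / δ) • k))
    (by linarith) (fun t ht => ((hxd t ht).of_le one_le_two).add
      (by simp only [hh]; fun_prop)) (fun t ht => hBt (hVar.mapsTo_add ht))
    (hB.continuousOn_metric (hVar.cont_X.add hVar.cont_h) hVar.mapsTo_add
      (hVar.cont_U.add hVar.cont_η) (hVar.cont_U.add hVar.cont_η)) (fun t ht => by
      have hsum : deriv (fun t => x t + h t) t = deriv x t + (1 / δ) • k :=
        ((hder t ht).add (hhd t)).deriv
      rw [hsum])
  have e1 : h (-δ) = 0 := by simp [hh, neg_div, div_self hδne]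
  have e2 : h 0 = k := by simp [hh]
  have e3 : (extChartAt (𝓡 n) c).symm (x (-δ)) = γ (-δ) :=
    symm_inChart (hmem (-δ) ⟨le_rfl, by linarith⟩).1
  have e4 : ∫ t in (-δ)..0, (1 : ℝ) * (1 / 2 * metricForm c (x t) (deriv x t) (deriv x t)) =
      δ / 2 := by
    rw [intervalIntegral.integral_congr (g := fun _ => (1 / 2 : ℝ)) (fun t ht => ?_)]
    · rw [intervalIntegral.integral_const, smul_eq_mul]
      ring
    · rw [uIcc_of_le (by linarith)] at ht
      simp only [hG t ht]
      norm_num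
  simp only [e1, e2, add_zero] at hdist
  rw [e3] at hdist
  rw [e4, e1, e2, map_zero, intervalIntegral.integral_const] at hE
  simp only [one_mul, smul_eq_mul] at hE
  linarith

/-- The first variation inequality for the distance to a point on a geodesic. -/
theorem exists_first_variation [IsRiemannianManifold (𝓡 n) M] {γ σ : ℝ → M} {p : M}
    {u w : TangentSpace (𝓡 n) p} (hγ : ∀ t, GeodesicAt n γ t) (hγ0 : velocity n γ 0 = ⟨p, u⟩)
    (hu : ‖u‖ = 1) (hσ : MDifferentiableAt 𝓘(ℝ, ℝ) (𝓡 n) σ 0) (hσ0 : velocity n σ 0 = ⟨p, w⟩)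
    {d : ℝ} (hd : 0 < d) :
    ∃ δ > 0, δ ≤ d ∧ ∃ f : ℝ → ℝ, HasDerivAt f (inner ℝ u w) 0 ∧ f 0 = δ ∧
      ∀ᶠ t in 𝓝 0, dist (γ (-δ)) (σ t) ≤ f t := by
  have hc : p ∈ (chartAt (Euc n) p).source := mem_chart_source _ _
  have hγp : γ 0 = p := congrArg TotalSpace.proj hγ0
  have hσp : σ 0 = p := congrArg TotalSpace.proj hσ0
  have hcγ : γ 0 ∈ (chartAt (Euc n) p).source := by rw [hγp]; exact hc
  have hcσ : σ 0 ∈ (chartAt (Euc n) p).source := by rw [hσp]; exact hc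
  have hspeed : ∀ t, ‖(velocity n γ t).2‖ = 1 := fun t => by
    rw [norm_velocity_eq isOpen_univ isPreconnected_univ (fun t _ => hγ t) (mem_univ t)
      (mem_univ 0), hγ0]
    exact hu
  obtain ⟨δ, hδ, hδd, C, hC⟩ := exists_dist_le_chart hγ hcγ hspeed hd
  have hinner : metricForm p (inChart n p γ 0) (deriv (inChart n p γ) 0) (deriv (inChart n p σ) 0) =
      inner ℝ u w := by
    have h1 := velocity_eq_tangentChartSymm ((hγ 0).1.mdifferentiableAt two_ne_zero) hcγ
    have h2 := velocity_eq_tangentChartSymm hσ hcσ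
    have h3 : inChart n p σ 0 = inChart n p γ 0 := by simp only [inChart, hγp, hσp]
    rw [h3] at h2
    rw [hγ0] at h1
    rw [hσ0] at h2
    rw [metricForm_apply]
    have key : ∀ (q : M) (u' w' : TangentSpace (𝓡 n) q),
        (⟨p, u⟩ : TangentBundle (𝓡 n) M) = ⟨q, u'⟩ → (⟨p, w⟩ : TangentBundle (𝓡 n) M) = ⟨q, w'⟩ →
        inner ℝ u' w' = inner ℝ u w := by
      intro q u' w' h h'
      obtain rfl : p = q := congrArg TotalSpace.proj h
      rw [TotalSpace.mk_inj] at h h'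
      rw [h, h']
    exact key _ _ _ h1 h2
  have hsd : HasDerivAt (inChart n p σ) (deriv (inChart n p σ) 0) 0 := by
    have h1 : MDifferentiableAt 𝓘(ℝ, ℝ) 𝓘(ℝ, Euc n) (inChart n p σ) 0 :=
      ((contMDiffAt_chart hcσ).mdifferentiableAt (by simp)).comp 0 hσ
    exact h1.differentiableAt.hasDerivAt
  set k : ℝ → Euc n := fun t => inChart n p σ t - inChart n p γ 0 with hk
  have hkd : HasDerivAt k (deriv (inChart n p σ) 0) 0 := hsd.sub_const _
  have hk0 : k 0 = 0 := by simp only [hk, inChart, hγp, hσp, sub_self]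
  -- The distance itself need not be differentiable here, so it is replaced by a differentiable
  -- majorant touching it to the right order: the quadratic term has derivative zero, and the linear
  -- one has derivative `⟨u, w⟩`.
  refine ⟨δ, hδ, hδd, fun t => δ + metricForm p (inChart n p γ 0) (deriv (inChart n p γ) 0) (k t) +
    C * ‖k t‖ ^ 2, ?_, ?_, ?_⟩
  · have h1 := ((metricForm p (inChart n p γ 0) (deriv (inChart n p γ) 0)).hasFDerivAt.comp_hasDerivAt
      (0 : ℝ) hkd)
    have h2 : HasDerivAt (fun t => C * ‖k t‖ ^ 2) 0 0 := by
      have := (hkd.norm_sq).const_mul C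
      rw [hk0, inner_zero_left, mul_zero, mul_zero] at this
      exact this
    have h3 := (h1.const_add δ).add h2
    rw [add_zero, hinner] at h3
    exact h3
  · simp [hk0]
  · have h1 : Tendsto k (𝓝 0) (𝓝 0) := by
      have := hkd.continuousAt
      rwa [ContinuousAt, hk0] at this
    filter_upwards [h1.eventually hC, eventually_mem_source hσ.continuousAt hcσ] with t ht hts
    have e : inChart n p γ 0 + k t = inChart n p σ t := by simp [hk]
    rwa [e, symm_inChart hts] at ht

end FirstVariation

/-! ### Shooting: short geodesics from a point cover a neighbourhood -/

section Shooting

variable {n : ℕ} {M : Type*} [TopologicalSpace M] [ChartedSpace (EuclideanSpace ℝ (Fin n)) M]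
  [IsManifold (𝓡 n) ∞ M]
  [RiemannianBundle (fun x : M => TangentSpace (𝓡 n) x)]
  [IsContMDiffRiemannianBundle (𝓡 n) ∞ (EuclideanSpace ℝ (Fin n))
    (fun x : M => TangentSpace (𝓡 n) x)]

theorem geodesicAcc_zero {E : Type*} [NormedAddCommGroup E] [NormedSpace ℝ E]
    (G : E → E →L[ℝ] E →L[ℝ] ℝ) (y : E) : geodesicAcc G y 0 = 0 := by
  simpa using geodesicAcc_smul G y 0 0

/-- The acceleration is `C¹`, so it remains to compute its derivative: it vanishes identically at
velocity zero, and it is quadratic in the velocity. -/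
theorem hasStrictFDerivAt_geodesicAcc_zero {c : M} {y : Euc n}
    (hy : y ∈ (extChartAt (𝓡 n) c).target) :
    HasStrictFDerivAt (fun z : Euc n × Euc n => geodesicAcc (metricForm c) z.1 z.2)
      (0 : Euc n × Euc n →L[ℝ] Euc n) (y, 0) := by
  have h := (contDiffAt_geodesicAcc hy 0).hasStrictFDerivAt one_ne_zero
  set A := fderiv ℝ (fun z : Euc n × Euc n => geodesicAcc (metricForm c) z.1 z.2) (y, 0)
  have hA1 : ∀ k : Euc n, A (k, 0) = 0 := by
    intro k
    have hl : HasDerivAt (fun s : ℝ => ((y + s • k, (0 : Euc n)) : Euc n × Euc n)) (k, 0) 0 := by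
      have h1 : HasDerivAt (fun s : ℝ => y + s • k) k 0 := by
        simpa using ((hasDerivAt_id (0 : ℝ)).smul_const k).const_add y
      exact h1.prodMk (hasDerivAt_const _ _)
    have hf : HasFDerivAt (fun z : Euc n × Euc n => geodesicAcc (metricForm c) z.1 z.2) A
        ((fun s : ℝ => ((y + s • k, (0 : Euc n)) : Euc n × Euc n)) 0) := by
      simpa using h.hasFDerivAt
    have h2 := hf.comp_hasDerivAt (0 : ℝ) hl
    have h3 : HasDerivAt (fun _ : ℝ => (0 : Euc n)) (A (k, 0)) 0 := by
      refine h2.congr_of_eventuallyEq (Eventually.of_forall fun s => ?_)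
      simp [geodesicAcc_zero]
    exact h3.unique (hasDerivAt_const _ _)
  have hA2 : ∀ k : Euc n, A (0, k) = 0 := by
    intro k
    have hl : HasDerivAt (fun s : ℝ => ((y, s • k) : Euc n × Euc n)) (0, k) 0 := by
      have h1 : HasDerivAt (fun s : ℝ => s • k) k 0 := by
        simpa using (hasDerivAt_id (0 : ℝ)).smul_const k
      exact (hasDerivAt_const _ _).prodMk h1
    have hf : HasFDerivAt (fun z : Euc n × Euc n => geodesicAcc (metricForm c) z.1 z.2) A
        ((fun s : ℝ => ((y, s • k) : Euc n × Euc n)) 0) := by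
      simpa using h.hasFDerivAt
    have h2 := hf.comp_hasDerivAt (0 : ℝ) hl
    have h3 : HasDerivAt (fun s : ℝ => s ^ 2 • geodesicAcc (metricForm c) y k) (A (0, k)) 0 := by
      refine h2.congr_of_eventuallyEq (Eventually.of_forall fun s => ?_)
      simp [geodesicAcc_smul]
    have h4 : HasDerivAt (fun s : ℝ => s ^ 2 • geodesicAcc (metricForm c) y k) 0 0 := by
      simpa using ((hasDerivAt_pow 2 (0 : ℝ)).smul_const (geodesicAcc (metricForm c) y k))
    exact h3.unique h4
  have hA : A = 0 := by
    refine ContinuousLinearMap.ext fun ⟨a, b⟩ => ?_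
    have : ((a, b) : Euc n × Euc n) = (a, 0) + (0, b) := by simp
    rw [this, map_add, hA1, hA2]
    simp
  rwa [hA] at h

/-- Speed is conserved, so zero initial velocity stays zero and the position does not move. -/
theorem flow_const {c : M} {y : Euc n} {ε : ℝ} {z : ℝ → Euc n × Euc n} (hε : 0 < ε)
    (h0 : z 0 = (y, 0)) (h : ∀ t ∈ Ioo (-ε) ε, HasDerivAt z (geodesicField n c (z t)) t ∧
      (z t).1 ∈ (extChartAt (𝓡 n) c).target) {t : ℝ} (ht : t ∈ Ioo (-ε) ε) : z t = (y, 0) := by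
  have h0' : (0 : ℝ) ∈ Ioo (-ε) ε := ⟨by linarith, hε⟩
  have hg := fun s (hs : s ∈ Ioo (-ε) ε) => geodesicAt_of_flow h hs
  have hsnd : ∀ s ∈ Ioo (-ε) ε, (z s).2 = 0 := by
    intro s hs
    have h1 := norm_velocity_eq isOpen_Ioo isPreconnected_Ioo (fun s hs => (hg s hs).1) hs h0'
    have h2 : ‖(tangentChartSymm c (z s) : TangentBundle (𝓡 n) M).2‖ ^ 2 =
        ‖(tangentChartSymm c (z 0) : TangentBundle (𝓡 n) M).2‖ ^ 2 := by
      rw [← (hg s hs).2, ← (hg 0 h0').2, h1]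
    rw [norm_tangentChartSymm_sq, norm_tangentChartSymm_sq, h0, map_zero] at h2
    by_contra hne
    exact (metricForm_pos (h s hs).2 hne).ne' h2
  have hfst : ∀ s ∈ Ioo (-ε) ε, HasDerivAt (fun r => (z r).1) 0 s := fun s hs => by
    have := (ContinuousLinearMap.fst ℝ (Euc n) (Euc n)).hasFDerivAt.comp_hasDerivAt s (h s hs).1
    rw [← hsnd s hs]
    exact this
  have h1 := isOpen_Ioo.is_const_of_deriv_eq_zero isPreconnected_Ioo
    (fun r hr => (hfst r hr).differentiableAt.differentiableWithinAt) (fun r hr => (hfst r hr).deriv)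
    ht h0'
  exact Prod.ext (h1.trans (by rw [h0])) (hsnd t ht)

/-- The local flow near a zero velocity; its map at a small time covers a neighbourhood of the
centre. -/
theorem exists_shooting {c : M} {y : Euc n} (hy : y ∈ (extChartAt (𝓡 n) c).target) :
    ∃ r > 0, ∃ ε > 0, ∃ (L : ℝ) (α : Euc n → ℝ → Euc n × Euc n), 0 ≤ L ∧
      (∀ u, ‖u‖ < r → α u 0 = (y, u) ∧ ∀ t ∈ Ioo (-ε) ε,
        (HasDerivAt (α u) (geodesicField n c (α u t)) t ∧
        (α u t).1 ∈ (extChartAt (𝓡 n) c).target) ∧ dist (α u t) (y, 0) ≤ L * ‖u‖) ∧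
      ∃ T ∈ Ioo 0 ε, T ≤ 1 ∧ ∀ N ∈ 𝓝 (0 : Euc n), (fun u => (α u T).1) '' N ∈ 𝓝 y := by
  obtain ⟨r, hr, ε, hε, L, α, hα, hL⟩ := exists_geodesic_flow c (z₀ := (y, 0)) hy
  have hball : ∀ u : Euc n, ‖u‖ < r → (y, u) ∈ Metric.ball ((y, 0) : Euc n × Euc n) r := by
    intro u hu
    rw [Metric.mem_ball, Prod.dist_eq, dist_self, dist_zero_right]
    exact max_lt hr hu
  have hdist : ∀ u u' : Euc n, dist ((y, u) : Euc n × Euc n) (y, u') = ‖u - u'‖ := by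
    intro u u'
    rw [Prod.dist_eq, dist_self, dist_eq_norm]
    exact max_eq_right (norm_nonneg _)
  have h0r : ‖(0 : Euc n)‖ < r := by simpa using hr
  have hconst : ∀ t ∈ Ioo (-ε) ε, α (y, 0) t = (y, 0) := fun t ht =>
    flow_const hε (hα _ (hball 0 h0r)).1 (hα _ (hball 0 h0r)).2 ht
  have hLip : ∀ u u' : Euc n, ‖u‖ < r → ‖u'‖ < r → ∀ t ∈ Ioo (-ε) ε,
      dist (α (y, u) t) (α (y, u') t) ≤ L * ‖u - u'‖ := by
    intro u u' hu hu' t ht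
    have := (hL t ht).dist_le_mul _ (hball u hu) _ (hball u' hu')
    rwa [hdist] at this
  have hdist0 : ∀ u : Euc n, ‖u‖ < r → ∀ t ∈ Ioo (-ε) ε, dist (α (y, u) t) (y, 0) ≤ L * ‖u‖ := by
    intro u hu t ht
    have := hLip u 0 hu h0r t ht
    rwa [hconst t ht, sub_zero] at this
  set T := min (ε / 2) 1 with hTdef
  have hT0 : 0 < T := lt_min (half_pos hε) one_pos
  have hTε : T < ε := (min_le_left _ _).trans_lt (half_lt_self hε)
  have hsub : Icc 0 T ⊆ Ioo (-ε) ε := fun t ht => ⟨by linarith [ht.1], ht.2.trans_lt hTε⟩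
  refine ⟨r, hr, ε, hε, L, fun u => α (y, u), L.2, fun u hu => ⟨(hα _ (hball u hu)).1, fun t ht =>
    ⟨(hα _ (hball u hu)).2 t ht, hdist0 u hu t ht⟩⟩, T, ⟨hT0, hTε⟩, min_le_right _ _, ?_⟩
  -- The flow is known only to be Lipschitz in its initial value. Strict differentiability is proved
  -- directly: near zero velocity the acceleration has small Lipschitz constant `κ`, so two
  -- solutions have accelerations differing by at most `κ L ‖u - u'‖`, and integrating twice leaves
  -- an error `κ L T² ‖u - u'‖`.
  have hS : HasStrictFDerivAt (fun u : Euc n => (α (y, u) T).1)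
      (T • ContinuousLinearMap.id ℝ (Euc n)) 0 := by
    refine .of_isLittleO (Asymptotics.isLittleO_iff.2 fun κ' hκ' => ?_)
    -- Chosen so that `κ (L + 1) T² = κ'`; the `+ 1` keeps the denominator positive when `L = 0`.
    set κ : ℝ := κ' / ((L + 1) * T ^ 2) with hκ
    have hL0 : (0 : ℝ) ≤ L := L.2
    have hκ0 : 0 < κ := by positivity
    have h1 := Asymptotics.isLittleO_iff.1 (hasStrictFDerivAt_geodesicAcc_zero hy).isLittleO hκ0
    obtain ⟨η, hη, hηb⟩ := Metric.eventually_nhds_iff.1 h1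
    have hacc : ∀ z z' : Euc n × Euc n, dist z (y, 0) < η → dist z' (y, 0) < η →
        ‖geodesicAcc (metricForm c) z.1 z.2 - geodesicAcc (metricForm c) z'.1 z'.2‖ ≤
          κ * dist z z' := by
      intro z z' hz hz'
      have := hηb (y := (z, z')) (by rw [Prod.dist_eq]; exact max_lt hz hz')
      simpa [dist_eq_norm] using this
    have hρ : 0 < min r (η / (L + 1)) := lt_min hr (by positivity)
    have hev : ∀ᶠ p : Euc n × Euc n in 𝓝 (0, 0), p ∈ Metric.ball (0, 0) (min r (η / (L + 1))) :=
      Metric.ball_mem_nhds _ hρ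
    filter_upwards [hev] with p hp
    rw [Metric.mem_ball, Prod.dist_eq, max_lt_iff, dist_zero_right, dist_zero_right] at hp
    obtain ⟨u, u'⟩ := p
    have hu : ‖u‖ < r := hp.1.trans_le (min_le_left _ _)
    have hu' : ‖u'‖ < r := hp.2.trans_le (min_le_left _ _)
    have hsmall : ∀ v : Euc n, ‖v‖ < min r (η / (L + 1)) → ∀ t ∈ Ioo (-ε) ε,
        dist (α (y, v) t) (y, 0) < η := by
      intro v hv t ht
      refine (hdist0 v (hv.trans_le (min_le_left _ _)) t ht).trans_lt ?_
      have h2 := hv.trans_le (min_le_right _ _)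
      rw [lt_div_iff₀ (by positivity)] at h2
      nlinarith [norm_nonneg v]
    have hz := hα _ (hball u hu)
    have hz' := hα _ (hball u' hu')
    have d1 : ∀ t ∈ Icc 0 T, HasDerivWithinAt (fun s => (α (y, u) s).2 - (α (y, u') s).2)
        (geodesicAcc (metricForm c) (α (y, u) t).1 (α (y, u) t).2 -
          geodesicAcc (metricForm c) (α (y, u') t).1 (α (y, u') t).2) (Icc 0 T) t := by
      intro t ht
      have e1 := (ContinuousLinearMap.snd ℝ (Euc n) (Euc n)).hasFDerivAt.comp_hasDerivAt t
        (hz.2 t (hsub ht)).1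
      have e2 := (ContinuousLinearMap.snd ℝ (Euc n) (Euc n)).hasFDerivAt.comp_hasDerivAt t
        (hz'.2 t (hsub ht)).1
      exact (e1.sub e2).hasDerivWithinAt
    have b1 : ∀ t ∈ Icc 0 T,
        ‖((α (y, u) t).2 - (α (y, u') t).2) - (u - u')‖ ≤ κ * (L * ‖u - u'‖) * T := by
      intro t ht
      have h2 := norm_image_sub_le_of_norm_deriv_le_segment' d1 (C := κ * (L * ‖u - u'‖))
        (fun s hs => (hacc _ _ (hsmall u hp.1 s (hsub (Ico_subset_Icc_self hs)))
          (hsmall u' hp.2 s (hsub (Ico_subset_Icc_self hs)))).trans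
          (by gcongr; exact hLip u u' hu hu' s (hsub (Ico_subset_Icc_self hs)))) t ht
      rw [hz.1, hz'.1, sub_zero] at h2
      refine h2.trans ?_
      gcongr
      exact ht.2
    have d2 : ∀ t ∈ Icc 0 T,
        HasDerivWithinAt (fun s => (α (y, u) s).1 - (α (y, u') s).1 - s • (u - u'))
        ((α (y, u) t).2 - (α (y, u') t).2 - (u - u')) (Icc 0 T) t := by
      intro t ht
      have e1 := (ContinuousLinearMap.fst ℝ (Euc n) (Euc n)).hasFDerivAt.comp_hasDerivAt t
        (hz.2 t (hsub ht)).1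
      have e2 := (ContinuousLinearMap.fst ℝ (Euc n) (Euc n)).hasFDerivAt.comp_hasDerivAt t
        (hz'.2 t (hsub ht)).1
      have e3 : HasDerivAt (fun s : ℝ => s • (u - u')) (u - u') t := by
        simpa using (hasDerivAt_id t).smul_const (u - u')
      exact ((e1.sub e2).sub e3).hasDerivWithinAt
    have b2 := norm_image_sub_le_of_norm_deriv_le_segment' d2
      (fun s hs => b1 s (Ico_subset_Icc_self hs)) T ⟨hT0.le, le_rfl⟩
    rw [hz.1, hz'.1] at b2
    simp only [sub_self, zero_smul, sub_zero] at b2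
    refine b2.trans ?_
    have hk : κ * (L + 1) * T ^ 2 = κ' := by
      rw [hκ]
      field_simp
    have hn := norm_nonneg (u - u')
    calc κ * (L * ‖u - u'‖) * T * T = κ * L * T ^ 2 * ‖u - u'‖ := by ring
      _ ≤ κ * (L + 1) * T ^ 2 * ‖u - u'‖ := by gcongr; linarith
      _ = κ' * ‖u - u'‖ := by rw [hk]
  -- A strictly differentiable map with surjective derivative is open at the point.
  have hsurj : (T • ContinuousLinearMap.id ℝ (Euc n)).range = ⊤ := by
    rw [LinearMap.range_eq_top]
    intro w
    exact ⟨T⁻¹ • w, by simp [smul_smul, hT0.ne']⟩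
  have hmap := hS.map_nhds_eq_of_surj hsurj
  have e0 : (α (y, 0) T).1 = y := by rw [hconst T ⟨by linarith, hTε⟩]
  rw [e0] at hmap
  intro N hN
  rw [← hmap]
  exact image_mem_map hN

end Shooting

/-! ### Short geodesics minimise length -/

section Minimality

open MeasureTheory

/-- A positive continuous function on `[0, 1]` is the velocity of a change of time onto `[0, T]`, up
to a factor. -/
theorem exists_time_change {s : ℝ → ℝ} (hs : ContinuousOn s (Icc 0 1))
    (hpos : ∀ t ∈ Icc (0 : ℝ) 1, 0 < s t) {T : ℝ} (hT : 0 < T) :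
    ∃ (θ m : ℝ → ℝ), Continuous θ ∧ Continuous m ∧ θ 0 = 0 ∧ θ 1 = T ∧
      (∀ t, HasDerivAt θ (m t) t) ∧ (∀ t ∈ Icc (0 : ℝ) 1, m t = T / (∫ t in (0 : ℝ)..1, s t) * s t) ∧
      (∀ t ∈ Icc (0 : ℝ) 1, θ t ∈ Icc 0 T) ∧ ∀ t ∈ Ioo (0 : ℝ) 1, θ t ∈ Ioo 0 T := by
  -- The constant extension beyond both ends is continuous and positive on all of `ℝ`, so its
  -- primitive is differentiable everywhere and strictly increasing.
  set s' : ℝ → ℝ := IccExtend zero_le_one ((Icc (0 : ℝ) 1).domRestrict s) with hs'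
  have hs'c : Continuous s' := (continuousOn_iff_continuous_domRestrict.1 hs).Icc_extend'
  have hs'e : ∀ t ∈ Icc (0 : ℝ) 1, s' t = s t := fun t ht => IccExtend_of_mem _ _ ht
  have hs'pos : ∀ t, 0 < s' t := fun t => hpos _ (projIcc 0 1 zero_le_one t).2
  set S : ℝ := ∫ t in (0 : ℝ)..1, s t with hS
  have hSS : ∫ t in (0 : ℝ)..1, s' t = S := by
    refine intervalIntegral.integral_congr fun t ht => ?_
    rw [uIcc_of_le zero_le_one] at ht
    exact hs'e t ht
  have hSpos : 0 < S := by
    rw [← hSS]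
    exact intervalIntegral.intervalIntegral_pos_of_pos (hs'c.intervalIntegrable _ _) hs'pos
      zero_lt_one
  have hd : ∀ t, HasDerivAt (fun t => T / S * ∫ r in (0 : ℝ)..t, s' r) (T / S * s' t) t := fun t =>
    (hs'c.integral_hasStrictDerivAt 0 t).hasDerivAt.const_mul _
  have hmono : StrictMono (fun t => T / S * ∫ r in (0 : ℝ)..t, s' r) :=
    strictMono_of_deriv_pos fun t => by
      rw [(hd t).deriv]
      have := hs'pos t
      positivity
  have h0 : T / S * ∫ r in (0 : ℝ)..0, s' r = 0 := by simp
  have h1 : T / S * ∫ r in (0 : ℝ)..1, s' r = T := by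
    rw [hSS]
    field_simp
  refine ⟨_, _, continuous_iff_continuousAt.2 fun t => (hd t).continuousAt,
    hs'c.const_mul (T / S), h0, h1, hd, fun t ht => by simp only [hs'e t ht], fun t ht => ?_,
    fun t ht => ?_⟩
  · have e0 := hmono.monotone ht.1
    have e1 := hmono.monotone ht.2
    simp only [h0, h1] at e0 e1
    exact ⟨e0, e1⟩
  · have e0 := hmono ht.1
    have e1 := hmono ht.2
    simp only [h0, h1] at e0 e1
    exact ⟨e0, e1⟩

section Chart

variable {E : Type*} [NormedAddCommGroup E] [NormedSpace ℝ E] [CompleteSpace E]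
  {G : E → E →L[ℝ] E →L[ℝ] ℝ} {y₀ : E} {R lam C : ℝ}

/-- Short geodesics of a chart minimise length. -/
theorem MetricBounds.le_length (hB : MetricBounds G y₀ R lam C) {T ν κ : ℝ} (hT : 0 < T)
    (hT1 : T ≤ 1) (hν : C * ν + C / 2 * ν ^ 2 ≤ lam / 2) {X U A : ℝ → E}
    (hX : ∀ t ∈ Icc 0 T, HasDerivAt X (U t) t) (hU : ∀ t ∈ Icc 0 T, HasDerivAt U (A t) t)
    (hA : ∀ t ∈ Icc 0 T, ∀ w, eulerLagrange G (X t) (U t) (A t) w = 0)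
    (hXR : ∀ t ∈ Icc 0 T, X t ∈ Metric.ball y₀ R) (hUν : ∀ t ∈ Icc 0 T, ‖U t‖ ≤ ν)
    (hκ0 : 0 ≤ κ) (hκ : ∀ t ∈ Icc 0 T, G (X t) (U t) (U t) = κ ^ 2) {x : ℝ → E}
    (hx : ∀ t ∈ Icc (0 : ℝ) 1, ContDiffAt ℝ 1 x t)
    (hxR : ∀ t ∈ Icc (0 : ℝ) 1, x t ∈ Metric.ball y₀ R) (hx0 : x 0 = X 0) (hx1 : x 1 = X T)
    {s : ℝ → ℝ} (hs : ContinuousOn s (Icc 0 1)) (hspos : ∀ t ∈ Icc (0 : ℝ) 1, 0 < s t)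
    (hsx : ∀ t ∈ Icc (0 : ℝ) 1, G (x t) (deriv x t) (deriv x t) ≤ s t ^ 2) :
    T * κ ≤ ∫ t in (0 : ℝ)..1, s t := by
  -- The geodesic is reparametrised in proportion to the speed bound `s` of the competitor. With the
  -- weight `m` its energy is `T κ² / 2` and that of the competitor is at most `S² / (2 T)`;
  -- comparing energies then compares lengths.
  obtain ⟨θ, m, hθ, hm, hθ0, hθ1, hθd, hms, hθT, hθT'⟩ := exists_time_change hs hspos hT
  set S := ∫ t in (0 : ℝ)..1, s t with hS
  have hSpos : 0 < S := intervalIntegral.intervalIntegral_pos_of_pos_on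
    (ContinuousOn.intervalIntegrable_of_Icc zero_le_one hs)
    (fun t ht => hspos t (Ioo_subset_Icc_self ht)) zero_lt_one
  have hmpos : ∀ t ∈ Icc (0 : ℝ) 1, 0 < m t := fun t ht => by
    rw [hms t ht]
    have := hspos t ht
    positivity
  have hxd : ∀ t ∈ Icc (0 : ℝ) 1, HasDerivAt x (deriv x t) t := fun t ht =>
    ((hx t ht).differentiableAt one_ne_zero).hasDerivAt
  have hxc : ContinuousOn (deriv x) (Icc 0 1) := fun t ht => by
    have h1 : ContDiffAt ℝ 0 (fderiv ℝ x) t := (hx t ht).fderiv_right (by norm_num)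
    have h2 := h1.continuousAt.clm_apply (continuousAt_const (y := (1 : ℝ)))
    exact h2.continuousWithinAt
  have hXθ : ∀ t ∈ Icc (0 : ℝ) 1, HasDerivAt (fun t => X (θ t)) (m t • U (θ t)) t := fun t ht =>
    (hX _ (hθT t ht)).scomp t (hθd t)
  have hUθ : ∀ t ∈ Icc (0 : ℝ) 1, HasDerivAt (fun t => U (θ t)) (m t • A (θ t)) t := fun t ht =>
    (hU _ (hθT t ht)).scomp t (hθd t)
  have cX : ContinuousOn (fun t => X (θ t)) (Icc 0 1) := fun t ht =>
    (hXθ t ht).continuousAt.continuousWithinAt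
  have cU : ContinuousOn (fun t => U (θ t)) (Icc 0 1) := fun t ht =>
    (hUθ t ht).continuousAt.continuousWithinAt
  have cx : ContinuousOn x (Icc 0 1) := fun t ht => (hxd t ht).continuousAt.continuousWithinAt
  have hVar : GeodesicVariation G y₀ R 0 1 m (fun t => X (θ t)) (fun t => U (θ t))
      (fun t => x t - X (θ t)) (fun t => (m t)⁻¹ • deriv x t - U (θ t)) :=
    { le := zero_le_one
      cont_m := hm.continuousOn
      cont_X := cX
      cont_U := cU
      cont_h := cx.sub cX
      cont_η := ((hm.continuousOn.inv₀ fun t ht => (hmpos t ht).ne').smul hxc).sub cU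
      nonneg_m := fun t ht => (hmpos t ht).le
      mapsTo_X := fun t ht => hXR _ (hθT t ht)
      mapsTo_add := fun t ht => by
        simp only [add_sub_cancel]
        exact hxR t ht
      deriv_X := fun t ht => hXθ t (Ioo_subset_Icc_self ht)
      deriv_h := fun t ht => by
        have ht' := Ioo_subset_Icc_self ht
        rw [smul_sub, smul_smul, mul_inv_cancel₀ (hmpos t ht').ne', one_smul]
        exact (hxd t ht').sub (hXθ t ht')
      deriv_U := fun t ht => ⟨A (θ t), hUθ t (Ioo_subset_Icc_self ht),
        hA _ (hθT t (Ioo_subset_Icc_self ht))⟩ }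
  have hmint : ∫ t in (0 : ℝ)..1, m t = T := by
    rw [intervalIntegral.integral_eq_sub_of_hasDerivAt (fun t _ => hθd t)
      (hm.intervalIntegrable _ _), hθ0, hθ1, sub_zero]
  have hmin := hVar.energy_min hB (by simp [hθ0, hx0]) (by simp [hθ1, hx1]) (hmint.trans_le hT1)
    (fun t ht => hUν _ (hθT t ht)) hν
  have e1 : ∫ t in (0 : ℝ)..1, m t * (1 / 2 * G (X (θ t)) (U (θ t)) (U (θ t))) =
      T * (1 / 2 * κ ^ 2) := by
    rw [← hmint, ← intervalIntegral.integral_mul_const]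
    refine intervalIntegral.integral_congr fun t ht => ?_
    rw [uIcc_of_le zero_le_one] at ht
    simp only [hκ _ (hθT t ht)]
  have e2 : ∫ t in (0 : ℝ)..1, m t * (1 / 2 * G (X (θ t) + (x t - X (θ t)))
      (U (θ t) + ((m t)⁻¹ • deriv x t - U (θ t))) (U (θ t) + ((m t)⁻¹ • deriv x t - U (θ t)))) ≤
      ∫ t in (0 : ℝ)..1, S / (2 * T) * s t := by
    refine intervalIntegral.integral_mono_on zero_le_one (hVar.intervalIntegrable_energy_add hB)
      (ContinuousOn.intervalIntegrable_of_Icc zero_le_one (hs.const_mul _)) fun t ht => ?_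
    have h1 := hmpos t ht
    have h2 := hspos t ht
    have h3 := hsx t ht
    simp only [add_sub_cancel, map_smul, smul_apply, smul_eq_mul]
    calc m t * (1 / 2 * ((m t)⁻¹ * ((m t)⁻¹ * G (x t) (deriv x t) (deriv x t))))
        ≤ m t * (1 / 2 * ((m t)⁻¹ * ((m t)⁻¹ * s t ^ 2))) := by gcongr
      _ = S / (2 * T) * s t := by
        rw [hms t ht]
        field_simp
  rw [intervalIntegral.integral_const_mul, ← hS] at e2
  have h5 : T * (1 / 2 * κ ^ 2) ≤ S / (2 * T) * S := by
    rw [← e1]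
    exact hmin.trans e2
  have h6 : (T * κ) ^ 2 ≤ S ^ 2 := by
    have h7 : T * (1 / 2 * κ ^ 2) * (2 * T) ≤ S / (2 * T) * S * (2 * T) := by gcongr
    have h8 : S / (2 * T) * S * (2 * T) = S ^ 2 := by field_simp
    nlinarith
  exact (pow_le_pow_iff_left₀ (by positivity) hSpos.le two_ne_zero).1 h6

end Chart

variable {n : ℕ} {M : Type*} [MetricSpace M] [ChartedSpace (EuclideanSpace ℝ (Fin n)) M]
  [IsManifold (𝓡 n) ∞ M]
  [RiemannianBundle (fun x : M => TangentSpace (𝓡 n) x)]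
  [IsContMDiffRiemannianBundle (𝓡 n) ∞ (EuclideanSpace ℝ (Fin n))
    (fun x : M => TangentSpace (𝓡 n) x)]
  [IsRiemannianManifold (𝓡 n) M]

/-- A short curve between two points stays near the first one, and its length is an integral over
the chart. -/
theorem exists_chart_curve {q y : M} {Λ D : ℝ} {V : Set (Euc n)} (hD : Λ ≤ D)
    (hqD : ∀ p, dist q p < D → p ∈ (chartAt (Euc n) q).source ∧ extChartAt (𝓡 n) q p ∈ V)
    (h : dist q y < Λ) :
    ∃ x : ℝ → Euc n, (∀ t ∈ Icc (0 : ℝ) 1, ContDiffAt ℝ 1 x t ∧ x t ∈ V ∧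
        x t ∈ (extChartAt (𝓡 n) q).target) ∧
      x 0 = extChartAt (𝓡 n) q q ∧ x 1 = extChartAt (𝓡 n) q y ∧
      ∫ t in (0 : ℝ)..1, Real.sqrt (metricForm q (x t) (deriv x t) (deriv x t)) < Λ := by
  have h1 : riemannianEDist (𝓡 n) q y < ENNReal.ofReal Λ := by
    rw [← IsRiemannianManifold.out (I := 𝓡 n) q y, edist_dist]
    exact (ENNReal.ofReal_lt_ofReal_iff (dist_nonneg.trans_lt h)).2 h
  obtain ⟨γ, hγ0, hγ1, hγ, hlen, -, -⟩ :=
    exists_lt_locally_constant_of_riemannianEDist_lt h1 zero_lt_one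
  -- An initial arc is no longer than the whole curve, so the curve cannot leave the region covered
  -- by the chart.
  have hnear : ∀ t ∈ Icc (0 : ℝ) 1, dist q (γ t) < D := by
    intro t ht
    have h2 : edist q (γ t) < ENNReal.ofReal Λ := by
      rw [IsRiemannianManifold.out (I := 𝓡 n) q (γ t)]
      exact ((riemannianEDist_le_pathELength hγ.contMDiffOn hγ0 rfl ht.1).trans
        (pathELength_mono le_rfl ht.2)).trans_lt hlen
    rw [edist_dist, ENNReal.ofReal_lt_ofReal_iff (dist_nonneg.trans_lt h)] at h2
    exact h2.trans_le hD
  have hsrc : ∀ t ∈ Icc (0 : ℝ) 1, γ t ∈ (chartAt (Euc n) q).source := fun t ht =>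
    (hqD _ (hnear t ht)).1
  have hcd : ∀ t ∈ Icc (0 : ℝ) 1, ContDiffAt ℝ 1 (inChart n q γ) t := fun t ht =>
    contDiffAt_inChart (k := 1) (hγ t) (hsrc t ht)
  have hnorm : ∀ t ∈ Icc (0 : ℝ) 1, Real.sqrt (metricForm q (inChart n q γ t)
      (deriv (inChart n q γ) t) (deriv (inChart n q γ) t)) = ‖(velocity n γ t).2‖ := by
    intro t ht
    rw [← norm_velocity_sq ((hγ t).mdifferentiableAt one_ne_zero) (hsrc t ht),
      Real.sqrt_sq (norm_nonneg _)]
  refine ⟨inChart n q γ, fun t ht => ⟨hcd t ht, (hqD _ (hnear t ht)).2,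
    inChart_mem_target (hsrc t ht)⟩, by simp only [inChart, hγ0], by simp only [inChart, hγ1], ?_⟩
  have hcont : ContinuousOn (fun t => Real.sqrt (metricForm q (inChart n q γ t)
      (deriv (inChart n q γ) t) (deriv (inChart n q γ) t))) (Icc 0 1) := by
    intro t ht
    have c0 : ContDiffAt ℝ 0 (fderiv ℝ (inChart n q γ)) t := (hcd t ht).fderiv_right (by norm_num)
    have c1 : ContinuousAt (deriv (inChart n q γ)) t :=
      c0.continuousAt.clm_apply (continuousAt_const (y := (1 : ℝ)))
    have c2 : ContinuousAt (fun t => metricForm (n := n) q (inChart n q γ t)) t :=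
      ContinuousAt.comp (f := inChart n q γ)
        (contDiffAt_metricForm (inChart_mem_target (hsrc t ht))).continuousAt
        (hcd t ht).continuousAt
    exact (((c2.clm_apply c1).clm_apply c1).sqrt).continuousWithinAt
  rw [pathELength_eq_lintegral_mfderiv_Icc] at hlen
  rw [intervalIntegral.integral_of_le zero_le_one, ← integral_Icc_eq_integral_Ioc]
  refine (ENNReal.ofReal_lt_ofReal_iff (dist_nonneg.trans_lt h)).1 ?_
  rw [ofReal_integral_eq_lintegral_ofReal hcont.integrableOn_Icc
    (Eventually.of_forall fun t => Real.sqrt_nonneg _)]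
  refine lt_of_le_of_lt (setLIntegral_mono_ae' measurableSet_Icc
    (Eventually.of_forall fun t ht => ?_)) hlen
  rw [hnorm t ht, ← ofReal_norm]
  exact le_rfl

/-- Near a point `q`, every point is joined to `q` by a minimising geodesic. -/
theorem exists_minimizing_local [CompleteSpace M] (q : M) : ∃ V ∈ 𝓝 q, ∀ y ∈ V,
    ∃ v : TangentSpace (𝓡 n) q, expMap (⟨q, v⟩ : TangentBundle (𝓡 n) M) = y ∧ ‖v‖ ≤ dist q y := by
  have hq : q ∈ (chartAt (Euc n) q).source := mem_chart_source _ _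
  set y₀ := extChartAt (𝓡 n) q q with hy₀def
  have hy₀ : y₀ ∈ (extChartAt (𝓡 n) q).target := mem_extChartAt_target q
  obtain ⟨R, lam, C, hB, hBt⟩ := exists_chart_metricBounds q hy₀
  obtain ⟨r, hr, ε, hε, L, α, hL, hα, T, hT, hT1, hcover⟩ := exists_shooting hy₀
  -- The velocity bound under which the energy comparison is valid.
  obtain ⟨ν, hν0, hν⟩ : ∃ ν > 0, C * ν + C / 2 * ν ^ 2 ≤ lam / 2 := by
    have hc : ContinuousAt (fun ν : ℝ => C * ν + C / 2 * ν ^ 2) 0 := by fun_prop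
    have h1 : ∀ᶠ ν in 𝓝 (0 : ℝ), C * ν + C / 2 * ν ^ 2 < lam / 2 :=
      hc.eventually_lt_const (by simpa using hB.lam_pos)
    obtain ⟨ν, h2, h3⟩ := ((h1.filter_mono (nhdsWithin_le_nhds (s := Ioi 0))).and
      eventually_mem_nhdsWithin).exists
    exact ⟨ν, h3, h2.le⟩
  have hsrcD : ∀ᶠ p in 𝓝 q, p ∈ (chartAt (Euc n) q).source ∧
      extChartAt (𝓡 n) q p ∈ Metric.ball y₀ R :=
    ((chartAt (Euc n) q).open_source.eventually_mem hq).and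
      ((continuousAt_extChartAt q).preimage_mem_nhds (Metric.ball_mem_nhds _ hB.R_pos))
  obtain ⟨D, hD, hDsub⟩ := Metric.eventually_nhds_iff.1 hsrcD
  -- The conditions on an initial velocity: the flow is defined, the geodesic stays in the ball of
  -- the bounds, its velocity is at most `ν`, and its length `T κ` is so small that shorter curves
  -- from `q` stay in the chart.
  have hN : ∀ᶠ u : Euc n in 𝓝 0, ‖u‖ < r ∧ L * ‖u‖ < R ∧ L * ‖u‖ < ν ∧
      T * Real.sqrt (metricForm q y₀ u u) < D := by
    have c1 : Continuous fun u : Euc n => ‖u‖ := continuous_norm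
    have c2 : Continuous fun u : Euc n => L * ‖u‖ := by fun_prop
    have c3 : Continuous fun u : Euc n => T * Real.sqrt (metricForm q y₀ u u) :=
      ((((metricForm q y₀).continuous).clm_apply continuous_id).sqrt).const_mul T
    have e1 : ∀ᶠ u : Euc n in 𝓝 0, ‖u‖ < r :=
      c1.continuousAt.eventually_lt continuousAt_const (by simpa using hr)
    have e2 : ∀ᶠ u : Euc n in 𝓝 0, L * ‖u‖ < R :=
      c2.continuousAt.eventually_lt continuousAt_const (by simpa using hB.R_pos)
    have e3 : ∀ᶠ u : Euc n in 𝓝 0, L * ‖u‖ < ν :=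
      c2.continuousAt.eventually_lt continuousAt_const (by simpa using hν0)
    have e4 : ∀ᶠ u : Euc n in 𝓝 0, T * Real.sqrt (metricForm q y₀ u u) < D :=
      c3.continuousAt.eventually_lt continuousAt_const (by simpa using hD)
    filter_upwards [e1, e2, e3, e4] with u h1 h2 h3 h4 using ⟨h1, h2, h3, h4⟩
  have hV := (continuousAt_extChartAt (I := 𝓡 n) q).preimage_mem_nhds (hcover _ hN)
  refine ⟨_, inter_mem ((chartAt (Euc n) q).open_source.mem_nhds hq) hV, ?_⟩
  rintro y ⟨hysrc, u, ⟨hur, huR, huν, huD⟩, huy⟩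
  obtain ⟨hα0, hαt⟩ := hα u hur
  have hsub : Icc 0 T ⊆ Ioo (-ε) ε := fun t ht => ⟨by linarith [ht.1], ht.2.trans_lt hT.2⟩
  have h0 : (0 : ℝ) ∈ Icc 0 T := ⟨le_rfl, hT.1.le⟩
  have h0' := hsub h0
  have hflow : ∀ t ∈ Ioo (-ε) ε, HasDerivAt (α u) (geodesicField n q (α u t)) t ∧
      (α u t).1 ∈ (extChartAt (𝓡 n) q).target := fun t ht => (hαt t ht).1
  have hg := fun t (ht : t ∈ Ioo (-ε) ε) => geodesicAt_of_flow hflow ht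
  set β : ℝ → M := fun s => (extChartAt (𝓡 n) q).symm (α u s).1 with hβ
  have hsymm : (extChartAt (𝓡 n) q).symm y₀ = q := (extChartAt (𝓡 n) q).left_inv (by simp)
  set κ : ℝ := Real.sqrt (metricForm q y₀ u u) with hκ
  have hnn : 0 ≤ metricForm q y₀ u u := by
    rw [metricForm_apply]
    exact real_inner_self_nonneg
  have hκt : ∀ t ∈ Ioo (-ε) ε, metricForm q (α u t).1 (α u t).2 (α u t).2 = κ ^ 2 := by
    intro t ht
    have h1 := norm_velocity_eq isOpen_Ioo isPreconnected_Ioo (fun s hs => (hg s hs).1) ht h0'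
    rw [Real.sq_sqrt hnn, ← norm_tangentChartSymm_sq, ← (hg t ht).2, h1, (hg 0 h0').2,
      norm_tangentChartSymm_sq, hα0]
  have hvel0 : velocity n β 0 = tangentChartSymm q (y₀, u) := by
    rw [(hg 0 h0').2, hα0]
  have hyT : β T = y := by
    have h1 : (α u T).1 = extChartAt (𝓡 n) q y := huy
    rw [hβ]
    simp only [h1]
    exact (extChartAt (𝓡 n) q).left_inv (by simpa using hysrc)
  have hgeod : β T = geod (tangentChartSymm q (y₀, u)) T := by
    rw [← hvel0]
    exact eqOn_geod isOpen_Ioo isPreconnected_Ioo (fun s hs => (hg s hs).1) h0'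
      (hsub ⟨hT.1.le, le_rfl⟩)
  obtain ⟨w, hw, hwκ⟩ : ∃ w : TangentSpace (𝓡 n) q,
      tangentChartSymm q (y₀, u) = (⟨q, w⟩ : TangentBundle (𝓡 n) M) ∧ ‖w‖ = κ := by
    have h1 : ‖(tangentChartSymm q (y₀, u) : TangentBundle (𝓡 n) M).2‖ = κ := by
      rw [hκ, ← norm_tangentChartSymm_sq q (y₀, u), Real.sqrt_sq (norm_nonneg _)]
    have key : ∀ (p : M) (w : TangentSpace (𝓡 n) p), p = q → ‖w‖ = κ →
        ∃ w' : TangentSpace (𝓡 n) q, (⟨p, w⟩ : TangentBundle (𝓡 n) M) = ⟨q, w'⟩ ∧ ‖w'‖ = κ := by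
      rintro p w rfl h
      exact ⟨w, rfl, h⟩
    exact key _ _ hsymm h1
  refine ⟨T • w, ?_, ?_⟩
  · rw [expMap_smul, ← hw, ← hgeod, hyT]
  rw [norm_smul, Real.norm_of_nonneg hT.1.le, hwκ]
  -- Otherwise a curve shorter than `T κ` joins `q` to `y` inside the chart, against
  -- `MetricBounds.le_length`.
  by_contra hlt
  push Not at hlt
  obtain ⟨x, hx, hx0, hx1, hxl⟩ := exists_chart_curve (V := Metric.ball y₀ R) huD.le
    (fun p hp => hDsub (by rwa [dist_comm])) hlt
  set I := ∫ t in (0 : ℝ)..1, Real.sqrt (metricForm q (x t) (deriv x t) (deriv x t)) with hI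
  have hcont : ContinuousOn (fun t => Real.sqrt (metricForm q (x t) (deriv x t) (deriv x t)))
      (Icc 0 1) := by
    intro t ht
    have c0 : ContDiffAt ℝ 0 (fderiv ℝ x) t := (hx t ht).1.fderiv_right (by norm_num)
    have c1 : ContinuousAt (deriv x) t :=
      c0.continuousAt.clm_apply (continuousAt_const (y := (1 : ℝ)))
    have c2 : ContinuousAt (fun t => metricForm (n := n) q (x t)) t :=
      ContinuousAt.comp (f := x) (contDiffAt_metricForm (hx t ht).2.2).continuousAt
        (hx t ht).1.continuousAt
    exact (((c2.clm_apply c1).clm_apply c1).sqrt).continuousWithinAt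
  -- Half the gap is added to the speed, making it strictly positive as the change of time requires,
  -- while its integral stays below `T κ`.
  have hpos : 0 < (T * κ - I) / 2 := by linarith
  have hle := hB.le_length (T := T) (ν := ν) (κ := κ) hT.1 hT1 hν (X := fun t => (α u t).1)
    (U := fun t => (α u t).2)
    (A := fun t => geodesicAcc (metricForm q) (α u t).1 (α u t).2)
    (fun t ht => (ContinuousLinearMap.fst ℝ (Euc n) (Euc n)).hasFDerivAt.comp_hasDerivAt t
      (hflow t (hsub ht)).1)
    (fun t ht => (ContinuousLinearMap.snd ℝ (Euc n) (Euc n)).hasFDerivAt.comp_hasDerivAt t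
      (hflow t (hsub ht)).1)
    (fun t ht => (eulerLagrange_eq_zero_iff (metricForm_isInvertible (hflow t (hsub ht)).2) _ _).2
      rfl)
    (fun t ht => by
      have h1 := (hαt t (hsub ht)).2
      rw [Prod.dist_eq] at h1
      exact ((le_max_left _ _).trans h1).trans_lt huR)
    (fun t ht => by
      have h1 := (hαt t (hsub ht)).2
      rw [Prod.dist_eq] at h1
      have h2 := (le_max_right _ _).trans h1
      rw [dist_zero_right] at h2
      exact h2.trans huν.le)
    (Real.sqrt_nonneg _) (fun t ht => hκt t (hsub ht)) (fun t ht => (hx t ht).1)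
    (fun t ht => (hx t ht).2.1) (hx0.trans (by simp only [hα0, hy₀def])) (hx1.trans huy.symm)
    (s := fun t => Real.sqrt (metricForm q (x t) (deriv x t) (deriv x t)) + (T * κ - I) / 2)
    (hcont.add continuousOn_const) (fun t _ => by positivity)
    (fun t _ => by
      have h2 : 0 ≤ metricForm q (x t) (deriv x t) (deriv x t) := by
        rw [metricForm_apply]
        exact real_inner_self_nonneg
      nlinarith [Real.sq_sqrt h2,
        Real.sqrt_nonneg (metricForm q (x t) (deriv x t) (deriv x t))])
  rw [intervalIntegral.integral_add (ContinuousOn.intervalIntegrable_of_Icc zero_le_one hcont)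
    intervalIntegrable_const, intervalIntegral.integral_const, ← hI, smul_eq_mul] at hle
  linarith

end Minimality

/-! ### Geodesics towards a set and feet of normals -/

theorem eventually_lt_of_hasDerivAt_neg {g : ℝ → ℝ} {g' : ℝ} (hg : HasDerivAt g g' 0)
    (hneg : g' < 0) : ∀ᶠ t in 𝓝[>] (0 : ℝ), g t < g 0 := by
  have h1 := (hasDerivAt_iff_tendsto_slope_zero.1 hg).mono_left
    (nhdsWithin_mono 0 (fun t (ht : t ∈ Ioi (0 : ℝ)) => (mem_Ioi.1 ht).ne'))
  filter_upwards [h1.eventually_lt_const hneg, self_mem_nhdsWithin] with t ht htpos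
  simp only [zero_add, smul_eq_mul] at ht
  have h2 := mem_Ioi.1 htpos
  by_contra hle
  have : 0 ≤ t⁻¹ * (g t - g 0) := mul_nonneg (by positivity) (by linarith)
  linarith

/-- A point at prescribed distance on a nearly minimising path. -/
theorem exists_dist_eq_and_lt (n : ℕ) {M : Type*} [MetricSpace M]
    [ChartedSpace (EuclideanSpace ℝ (Fin n)) M] [IsManifold (𝓡 n) ∞ M]
    [RiemannianBundle (fun x : M => TangentSpace (𝓡 n) x)]
    [IsContMDiffRiemannianBundle (𝓡 n) ∞ (EuclideanSpace ℝ (Fin n))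
      (fun x : M => TangentSpace (𝓡 n) x)]
    [IsRiemannianManifold (𝓡 n) M] {p y : M} {Λ δ : ℝ} (h : dist p y < Λ) (hδ : 0 ≤ δ)
    (hδy : δ ≤ dist p y) : ∃ z, dist p z = δ ∧ dist z y < Λ - δ := by
  have h1 : riemannianEDist (𝓡 n) p y < ENNReal.ofReal Λ := by
    rw [← IsRiemannianManifold.out (I := 𝓡 n) p y, edist_dist]
    exact (ENNReal.ofReal_lt_ofReal_iff (dist_nonneg.trans_lt h)).2 h
  obtain ⟨γ, hγ0, hγ1, hγ, hlen, -, -⟩ :=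
    exists_lt_locally_constant_of_riemannianEDist_lt h1 zero_lt_one
  have hc : ContinuousOn (fun t => dist p (γ t)) (Icc 0 1) :=
    (continuous_const.dist hγ.continuous).continuousOn
  obtain ⟨t, ht, htδ⟩ := intermediate_value_Icc zero_le_one hc
    (show δ ∈ Icc (dist p (γ 0)) (dist p (γ 1)) by rw [hγ0, hγ1, dist_self]; exact ⟨hδ, hδy⟩)
  simp only at htδ
  refine ⟨γ t, htδ, ?_⟩
  have h2 : edist p (γ t) + edist (γ t) y < ENNReal.ofReal Λ := by
    rw [IsRiemannianManifold.out (I := 𝓡 n) p (γ t), IsRiemannianManifold.out (I := 𝓡 n) (γ t) y]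
    refine lt_of_le_of_lt ?_ hlen
    rw [← pathELength_add ht.1 ht.2]
    exact add_le_add (riemannianEDist_le_pathELength hγ.contMDiffOn hγ0 rfl ht.1)
      (riemannianEDist_le_pathELength hγ.contMDiffOn rfl hγ1 ht.2)
  rw [edist_dist, edist_dist, ← ENNReal.ofReal_add dist_nonneg dist_nonneg,
    ENNReal.ofReal_lt_ofReal_iff (dist_nonneg.trans_lt h), htδ] at h2
  linarith

section FootPoint

variable {n : ℕ} {M : Type*} [MetricSpace M] [ChartedSpace (EuclideanSpace ℝ (Fin n)) M]
  [IsManifold (𝓡 n) ∞ M]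
  [RiemannianBundle (fun x : M => TangentSpace (𝓡 n) x)]
  [IsContMDiffRiemannianBundle (𝓡 n) ∞ (EuclideanSpace ℝ (Fin n))
    (fun x : M => TangentSpace (𝓡 n) x)]
  [IsRiemannianManifold (𝓡 n) M]

variable [CompleteSpace M]

theorem le_norm_of_expMap (p : M) (v : TangentSpace (𝓡 n) p) :
    dist p (expMap (⟨p, v⟩ : TangentBundle (𝓡 n) M)) ≤ ‖v‖ := by
  have h := dist_geod_le (⟨p, v⟩ : TangentBundle (𝓡 n) M) zero_le_one
  rw [geod_zero, sub_zero, mul_one, ← expMap_eq_geod] at h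
  exact h

/-- From every point outside a set there starts a geodesic that runs towards the set for a short
time. -/
theorem exists_geod_toward_short {L : Set M} (hL : L.Nonempty) {p : M}
    (hp : 0 < Metric.infDist p L) :
    ∃ δ > 0, δ ≤ Metric.infDist p L ∧ ∃ v : TangentSpace (𝓡 n) p, ‖v‖ = 1 ∧
      Metric.infDist (geod (⟨p, v⟩ : TangentBundle (𝓡 n) M) δ) L ≤ Metric.infDist p L - δ := by
  set ρ := Metric.infDist p L with hρ
  have : LocallyCompactSpace M := Manifold.locallyCompact_of_finiteDimensional (𝓡 n)
  obtain ⟨r, hr, hrc⟩ := Metric.exists_isCompact_closedBall p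
  obtain ⟨V, hV, hmin⟩ := exists_minimizing_local (n := n) p
  obtain ⟨s, hs, hsV⟩ := Metric.mem_nhds_iff.1 hV
  -- The radius keeps the sphere compact, keeps it inside the region of minimising geodesics, and
  -- makes every path from `p` to `L` reach it.
  set δ := min (min r (s / 2)) ρ with hδ
  have hδ0 : 0 < δ := lt_min (lt_min hr (half_pos hs)) hp
  have hδr : δ ≤ r := (min_le_left _ _).trans (min_le_left _ _)
  have hδs : δ < s := ((min_le_left _ _).trans (min_le_right _ _)).trans_lt (half_lt_self hs)
  have hδρ : δ ≤ ρ := min_le_right _ _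
  have hcomp : IsCompact (Metric.sphere p δ) := hrc.of_isClosed_subset Metric.isClosed_sphere
    (Metric.sphere_subset_closedBall.trans (Metric.closedBall_subset_closedBall hδr))
  -- A nearly shortest path from `p` to `L` crosses the sphere, and the rest of it has length at
  -- most about `ρ - δ`. Minimising over the compact sphere then removes `ε`.
  have hex : ∀ ε > 0, ∃ z ∈ Metric.sphere p δ, Metric.infDist z L ≤ ρ - δ + ε := by
    intro ε hε
    obtain ⟨y, hy, hyρ⟩ := (Metric.infDist_lt_iff hL).1 (show Metric.infDist p L < ρ + ε by linarith)
    obtain ⟨z, hz, hzy⟩ := exists_dist_eq_and_lt n hyρ hδ0.le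
      (hδρ.trans (Metric.infDist_le_dist_of_mem hy))
    refine ⟨z, by rwa [Metric.mem_sphere, dist_comm], ?_⟩
    have := Metric.infDist_le_dist_of_mem (x := z) hy
    linarith
  obtain ⟨z₁, hz₁, -⟩ := hex 1 one_pos
  obtain ⟨z, hz, hzmin⟩ := hcomp.exists_isMinOn ⟨z₁, hz₁⟩
    (Metric.continuous_infDist_pt L).continuousOn
  have hzL : Metric.infDist z L ≤ ρ - δ := by
    refine le_of_forall_pos_le_add fun ε hε => ?_
    obtain ⟨z', hz', h⟩ := hex ε hε
    exact (hzmin hz').trans h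
  obtain ⟨v, hv, hvn⟩ := hmin z (hsV (by rw [Metric.mem_ball, Metric.mem_sphere.1 hz]; exact hδs))
  have hpz : dist p z = δ := by rw [dist_comm]; exact hz
  have hvδ : ‖v‖ = δ := by
    refine le_antisymm (hvn.trans_eq hpz) ?_
    have := le_norm_of_expMap p v
    rwa [hv, hpz] at this
  refine ⟨δ, hδ0, hδρ, δ⁻¹ • v, ?_, ?_⟩
  · rw [norm_smul, norm_inv, Real.norm_of_nonneg hδ0.le, hvδ, inv_mul_cancel₀ hδ0.ne']
  · rw [← expMap_smul, smul_smul, mul_inv_cancel₀ hδ0.ne', one_smul, hv]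
    exact hzL

/-- A geodesic that leaves another geodesic at an angle is a shortcut. -/
theorem exists_shortcut {γ : ℝ → M} {p : M} {u w : TangentSpace (𝓡 n) p}
    (hγ : ∀ t, GeodesicAt n γ t) (hγ0 : velocity n γ 0 = ⟨p, u⟩) (hu : ‖u‖ = 1) (hw : ‖w‖ = 1)
    (huw : u ≠ w) {d d' : ℝ} (hd : 0 < d) (hd' : 0 < d') :
    ∃ δ ∈ Ioc 0 d, ∃ t ∈ Ioo 0 d',
      dist (γ (-δ)) (geod (⟨p, w⟩ : TangentBundle (𝓡 n) M) t) < δ + t := by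
  have hσ0 := velocity_geod_zero (⟨p, w⟩ : TangentBundle (𝓡 n) M)
  obtain ⟨δ, hδ, hδd, f, hf, hf0, hle⟩ := exists_first_variation hγ hγ0 hu
    ((geodesicAt_geod _ 0).1.mdifferentiableAt two_ne_zero) hσ0 hd
  have hlt : inner ℝ u w < 1 := (inner_lt_one_iff_real_of_norm_eq_one hu hw).2 huw
  -- The function `f t - t` has derivative `⟨u, w⟩ - 1`, negative by the strict Cauchy–Schwarz
  -- inequality.
  have h1 := eventually_lt_of_hasDerivAt_neg (hf.sub (hasDerivAt_id (0 : ℝ))) (by linarith)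
  obtain ⟨t, ht, ht1, ht2⟩ := (h1.and ((hle.filter_mono nhdsWithin_le_nhds).and
    (Ioo_mem_nhdsGT hd'))).exists
  refine ⟨δ, ⟨hδ, hδd⟩, t, ht2, ht1.trans_lt ?_⟩
  simp only [Pi.sub_apply, id, hf0] at ht
  linarith

/-- The theorem of Hopf and Rinow for the distance to a set. -/
theorem exists_geod_toward {L : Set M} (hL : L.Nonempty) {q : M} (hq : 0 < Metric.infDist q L) :
    ∃ v : TangentSpace (𝓡 n) q, ‖v‖ = 1 ∧ ∀ t ∈ Icc 0 (Metric.infDist q L),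
      Metric.infDist (geod (⟨q, v⟩ : TangentBundle (𝓡 n) M) t) L = Metric.infDist q L - t := by
  set ρ := Metric.infDist q L with hρ
  obtain ⟨δ, hδ, hδρ, v, hv, hvδ⟩ := exists_geod_toward_short (n := n) hL hq
  rw [← hρ] at hδρ hvδ
  set V : TangentBundle (𝓡 n) M := ⟨q, v⟩ with hV
  have hlip : ∀ s t, s ≤ t →
      Metric.infDist (geod V s) L ≤ Metric.infDist (geod V t) L + (t - s) := by
    intro s t hst
    have h := dist_geod_le V hst
    have h1 : ‖V.2‖ = 1 := hv
    rw [h1, one_mul] at h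
    exact Metric.infDist_le_infDist_add_dist.trans (by linarith)
  have hge : ∀ t, 0 ≤ t → ρ - t ≤ Metric.infDist (geod V t) L := by
    intro t ht
    have h := hlip 0 t ht
    rw [geod_zero, sub_zero] at h
    have h2 : ρ ≤ Metric.infDist (geod V t) L + t := h
    linarith
  -- Times up to which no distance is wasted; the reverse inequality holds at all nonnegative times
  -- by unit speed.
  set A : Set ℝ := {t | t ∈ Icc 0 ρ ∧ Metric.infDist (geod V t) L ≤ ρ - t} with hA
  have hcont : Continuous (geod V) := continuous_iff_continuousAt.2 fun t =>
    (geodesicAt_geod V t).1.continuousAt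
  have hAclosed : IsClosed A := by
    have h : IsClosed {t | Metric.infDist (geod V t) L ≤ ρ - t} :=
      isClosed_le ((Metric.continuous_infDist_pt L).comp hcont) (by fun_prop)
    exact isClosed_Icc.inter h
  have hAb : BddAbove A := ⟨ρ, fun t ht => ht.1.2⟩
  have hδA : δ ∈ A := ⟨⟨hδ.le, hδρ⟩, hvδ⟩
  set T := sSup A with hT
  have hTA : T ∈ A := hAclosed.csSup_mem ⟨δ, hδA⟩ hAb
  have hδT : δ ≤ T := le_csSup hAb hδA
  have hTρ : T = ρ := by
    -- From the last good time `T < ρ` a short geodesic again runs towards `L`. If it continues the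
    -- old one, `T` was not maximal; if not, there is a corner.
    by_contra hne
    have hlt : T < ρ := lt_of_le_of_ne hTA.1.2 hne
    have hinf : Metric.infDist (geod V T) L = ρ - T :=
      le_antisymm hTA.2 (hge T hTA.1.1)
    obtain ⟨δ', hδ', hδ'ρ, v', hv', hvδ'⟩ := exists_geod_toward_short (n := n) hL
      (p := geod V T) (by rw [hinf]; linarith)
    rw [hinf] at hδ'ρ hvδ'
    set γ : ℝ → M := fun s => geod V (s + T) with hγ
    have hγg : ∀ t, GeodesicAt n γ t := fun t => GeodesicAt.shift (geodesicAt_geod V _)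
    have hγ0 : velocity n γ 0 = velocity n (geod V) T := by
      rw [hγ, velocity_shift (geodesicAt_geod V _), zero_add]
    have hun : ‖(velocity n (geod V) T).2‖ = 1 := (norm_velocity_geod V T).trans hv
    by_cases huv : (velocity n (geod V) T).2 = v'
    · have h1 : (⟨geod V T, v'⟩ : TangentBundle (𝓡 n) M) = velocity n (geod V) T := by
        rw [← huv]
        rfl
      rw [h1, geod_add] at hvδ'
      have h2 : δ' + T ∈ A := ⟨⟨by linarith, by linarith⟩, by linarith⟩
      linarith [le_csSup hAb h2]
    -- Cutting the corner and then following the new geodesic joins the point at time `T - η` to `L`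
    -- at a cost below `η + ρ - T`, which `hge` forbids.
    · obtain ⟨η, hη, t, ht, hlt'⟩ := exists_shortcut hγg (hγ0.trans rfl) hun hv' huv
        (hδ.trans_le hδT) hδ'
      have h1 := hge (-η + T) (by linarith [hη.2])
      have h2 := dist_geod_le (⟨geod V T, v'⟩ : TangentBundle (𝓡 n) M) ht.2.le
      have hv1 : ‖(⟨geod V T, v'⟩ : TangentBundle (𝓡 n) M).2‖ = 1 := hv'
      rw [hv1, one_mul] at h2
      have h3 := Metric.infDist_le_infDist_add_dist (s := L)
        (x := geod (⟨geod V T, v'⟩ : TangentBundle (𝓡 n) M) t)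
        (y := geod (⟨geod V T, v'⟩ : TangentBundle (𝓡 n) M) δ')
      have h4 := Metric.infDist_le_infDist_add_dist (s := L) (x := γ (-η))
        (y := geod (⟨geod V T, v'⟩ : TangentBundle (𝓡 n) M) t)
      simp only [hγ] at h4 hlt'
      linarith
  refine ⟨v, hv, fun t ht => le_antisymm ?_ (hge t ht.1)⟩
  have h1 := hlip t T (hTρ ▸ ht.2)
  have h2 := hTA.2
  rw [hTρ] at h1 h2
  linarith

theorem expMap_zero (p : M) : expMap (⟨p, 0⟩ : TangentBundle (𝓡 n) M) = p := by
  have h := expMap_smul p (0 : TangentSpace (𝓡 n) p) 0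
  rwa [zero_smul, geod_zero] at h

theorem expMap_reverse {v : TangentBundle (𝓡 n) M} {t : ℝ} {p : M} {u : TangentSpace (𝓡 n) p}
    (h : velocity n (geod v) t = ⟨p, u⟩) :
    expMap (⟨p, t • -u⟩ : TangentBundle (𝓡 n) M) = v.proj := by
  have h2 := geod_add v t (-t)
  rw [h, neg_add_cancel, geod_zero] at h2
  rw [smul_neg, ← neg_smul, expMap_smul, h2]

/-- Every point is the image under the normal exponential map of a compact submanifold of a normal
vector whose length is the distance to the submanifold. -/
theorem exists_normal_foot {k : ℕ} {K : C1Submanifold n k M} (hK : IsCompact K.carrier)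
    (hne : K.carrier.Nonempty) (q : M) :
    ∃ v ∈ K.normalBundle, expMap v = q ∧ ‖v.2‖ = Metric.infDist q K.carrier := by
  rcases Metric.infDist_nonneg.eq_or_lt' (a := Metric.infDist q K.carrier) with h0 | hpos
  · have hq : q ∈ K.carrier := (hK.isClosed.mem_iff_infDist_zero hne).2 h0
    refine ⟨⟨q, 0⟩, ⟨hq, Submodule.zero_mem _⟩, expMap_zero q, ?_⟩
    rw [h0]
    exact norm_zero
  set ρ := Metric.infDist q K.carrier with hρ
  obtain ⟨v, hv, hdist⟩ := exists_geod_toward (n := n) hne hpos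
  set V : TangentBundle (𝓡 n) M := ⟨q, v⟩ with hV
  set x := geod V ρ with hx
  have hxK : x ∈ K.carrier := by
    rw [hK.isClosed.mem_iff_infDist_zero hne, hx, hdist ρ ⟨hpos.le, le_rfl⟩, sub_self]
  obtain ⟨u, hu⟩ : ∃ u : TangentSpace (𝓡 n) x, velocity n (geod V) ρ = ⟨x, u⟩ := ⟨_, rfl⟩
  have hun : ‖u‖ = 1 := by
    have h := norm_velocity_geod V ρ
    rw [hu] at h
    exact h.trans hv
  set γ : ℝ → M := fun s => geod V (s + ρ) with hγ
  have hγg : ∀ t, GeodesicAt n γ t := fun t => GeodesicAt.shift (geodesicAt_geod V _)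
  have hγ0 : velocity n γ 0 = (⟨x, u⟩ : TangentBundle (𝓡 n) M) := by
    rw [hγ, velocity_shift (geodesicAt_geod V _), zero_add, hu]
  -- Orthogonality at the nearest point: along a curve in `K`, the majorant `f` of the distance to
  -- `γ (-δ)` is smallest at `0`, because `δ` is already the distance from `γ (-δ)` to `K`. Hence
  -- its derivative `⟨u, w⟩` vanishes.
  have hnormal : u ∈ (K.tangent x)ᗮ := by
    rw [Submodule.mem_orthogonal]
    intro w hw
    induction hw using Submodule.span_induction with
    | zero => exact inner_zero_left _
    | add a b _ _ ha hb => rw [inner_add_left, ha, hb, add_zero]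
    | smul c a _ ha => rw [real_inner_smul_left, ha, mul_zero]
    | mem w hw =>
      obtain ⟨σ, hσ, hσK, hσ0⟩ := hw
      obtain ⟨δ, hδ, hδρ, f, hf, hf0, hle⟩ := exists_first_variation hγg hγ0 hun
        (hσ.mdifferentiableAt one_ne_zero) hσ0 hpos
      have hloc : IsLocalMin f 0 := by
        filter_upwards [hle, hσK] with t ht htK
        rw [hf0]
        refine le_trans ?_ ht
        have h1 := hdist (-δ + ρ) ⟨by linarith, by linarith⟩
        have h2 := Metric.infDist_le_dist_of_mem (x := γ (-δ)) htK
        simp only [hγ] at h2 ⊢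
        linarith
      rw [real_inner_comm]
      exact hloc.hasDerivAt_eq_zero hf
  refine ⟨⟨x, ρ • -u⟩, ⟨hxK, Submodule.smul_mem _ _ (Submodule.neg_mem _ hnormal)⟩,
    expMap_reverse hu, ?_⟩
  have h1 : ‖ρ • -u‖ = ρ := by
    rw [norm_smul, norm_neg, hun, mul_one, Real.norm_of_nonneg hpos.le]
  exact h1

end FootPoint

/-! ### Thickness equals ball radius -/

section Radius

variable {n k : ℕ} {M : Type*} [MetricSpace M] [ChartedSpace (EuclideanSpace ℝ (Fin n)) M]
  [IsManifold (𝓡 n) ∞ M]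
  [RiemannianBundle (fun x : M => TangentSpace (𝓡 n) x)]
  [IsContMDiffRiemannianBundle (𝓡 n) ∞ (EuclideanSpace ℝ (Fin n))
    (fun x : M => TangentSpace (𝓡 n) x)]
  [IsRiemannianManifold (𝓡 n) M] [CompleteSpace M]

/-- If `r' < r`, the centre of the ball is the image of `r' w` and also of the normal vector from
its nearest point on `K`. The latter is shorter than `r'` because the ball meets `K`, so injectivity
below `r` fails. -/
theorem le_of_injOn_of_ballUnion {K : C1Submanifold n k M} (hK : IsCompact K.carrier) {r r' : ℝ}
    (hinj : InjOn expMap {v | v ∈ K.normalBundle ∧ ‖v.2‖ < r}) (hr' : 0 < r')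
    (hne : (K.ballUnion r' ∩ K.carrier).Nonempty) : r ≤ r' := by
  by_contra hlt
  push Not at hlt
  obtain ⟨x, ⟨p, hp, w, hw, hw1, hx⟩, hxK⟩ := hne
  obtain ⟨v, hv, hvq, hvn⟩ := exists_normal_foot hK ⟨x, hxK⟩
    (expMap (⟨p, r' • w⟩ : TangentBundle (𝓡 n) M))
  have h1 : ‖v.2‖ < r' := by
    rw [hvn]
    refine (Metric.infDist_le_dist_of_mem hxK).trans_lt ?_
    rw [dist_comm]
    exact Metric.mem_ball.1 hx
  have h2 : ‖r' • w‖ = r' := by rw [norm_smul, hw1, mul_one, Real.norm_of_nonneg hr'.le]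
  have h3 : v = ⟨p, r' • w⟩ := by
    refine hinj ⟨hv, h1.trans hlt⟩ ⟨⟨hp, Submodule.smul_mem _ _ hw⟩, ?_⟩ hvq
    rw [h2]
    exact hlt
  have h4 : ‖v.2‖ = r' := by
    rw [h3]
    exact h2
  exact h1.ne h4

theorem thickness_le_ballRadius {K : C1Submanifold n k M} (hK : IsCompact K.carrier) :
    K.thickness ≤ K.ballRadius := by
  simp only [C1Submanifold.thickness, C1Submanifold.ballRadius, iSup_le_iff, le_iInf_iff]
  intro r' hr' hne r hr hinj
  exact ENNReal.ofReal_le_ofReal (le_of_injOn_of_ballUnion hK hinj hr' hne)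

theorem ballRadius_le_of_dist_lt {K : C1Submanifold n k M} {r : ℝ} (hr : 0 < r) {p x : M}
    (hp : p ∈ K.carrier) (hx : x ∈ K.carrier) {w : TangentSpace (𝓡 n) p}
    (hw : w ∈ (K.tangent p)ᗮ) (hw1 : ‖w‖ = 1)
    (h : dist x (geod (⟨p, w⟩ : TangentBundle (𝓡 n) M) r) < r) :
    K.ballRadius ≤ ENNReal.ofReal r := by
  refine iInf_le_of_le r (iInf_le_of_le hr (iInf_le _ ?_))
  refine ⟨x, ⟨p, hp, w, hw, hw1, ?_⟩, hx⟩
  rw [expMap_smul]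
  exact h

theorem exists_unit_normal {K : C1Submanifold n k M} {v : TangentBundle (𝓡 n) M}
    (hv : v ∈ K.normalBundle) (hpos : 0 < ‖v.2‖) :
    ∃ w ∈ (K.tangent v.proj)ᗮ, ‖w‖ = 1 ∧ v.2 = ‖v.2‖ • w ∧
      expMap v = geod (⟨v.proj, w⟩ : TangentBundle (𝓡 n) M) ‖v.2‖ := by
  have h : v.2 = ‖v.2‖ • (‖v.2‖⁻¹ • v.2) := by
    rw [smul_smul, mul_inv_cancel₀ hpos.ne', one_smul]
  refine ⟨‖v.2‖⁻¹ • v.2, Submodule.smul_mem _ _ hv.2, ?_, h, ?_⟩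
  · rw [norm_smul, norm_inv, norm_norm, inv_mul_cancel₀ hpos.ne']
  · rw [← expMap_smul, ← h]

/-- The foot of the shorter vector is within `‖v₁‖ < ‖v₂‖` of the common image, so it lies in the
ball that `v₂` defines. -/
theorem ballRadius_le_of_norm_lt {K : C1Submanifold n k M} {v₁ v₂ : TangentBundle (𝓡 n) M}
    (h₁ : v₁ ∈ K.normalBundle) (h₂ : v₂ ∈ K.normalBundle) (heq : expMap v₁ = expMap v₂)
    (hlt : ‖v₁.2‖ < ‖v₂.2‖) : K.ballRadius ≤ ENNReal.ofReal ‖v₂.2‖ := by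
  have hpos : 0 < ‖v₂.2‖ := (norm_nonneg _).trans_lt hlt
  obtain ⟨w, hw, hw1, -, he⟩ := exists_unit_normal h₂ hpos
  refine ballRadius_le_of_dist_lt hpos h₂.1 h₁.1 hw hw1 ?_
  rw [← he, ← heq]
  exact (le_norm_of_expMap v₁.proj v₁.2).trans_lt hlt

/-- For equal lengths the ball around the common image only touches the other foot. Its centre is
therefore pushed a little beyond that point, and the strict inequality comes from cutting the corner
between the two geodesics. -/
theorem ballRadius_le_of_not_injOn {K : C1Submanifold n k M} {r : ℝ}
    (h : ¬ InjOn expMap {v | v ∈ K.normalBundle ∧ ‖v.2‖ < r}) :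
    K.ballRadius ≤ ENNReal.ofReal r := by
  simp only [InjOn, not_forall] at h
  obtain ⟨v₁, ⟨h₁, hr₁⟩, v₂, ⟨h₂, hr₂⟩, heq, hne⟩ := h
  rcases lt_trichotomy ‖v₁.2‖ ‖v₂.2‖ with hlt | hn | hlt
  · exact (ballRadius_le_of_norm_lt h₁ h₂ heq hlt).trans (ENNReal.ofReal_le_ofReal hr₂.le)
  · rcases (norm_nonneg v₁.2).eq_or_lt' with h0 | hpos
    · exfalso
      apply hne
      have e1 : v₁.2 = 0 := norm_eq_zero.1 h0
      have e2 : v₂.2 = 0 := norm_eq_zero.1 (hn.symm.trans h0)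
      have f : ∀ v : TangentBundle (𝓡 n) M, v.2 = 0 → expMap v = v.proj ∧ v = ⟨v.proj, 0⟩ := by
        rintro ⟨p, v⟩ hv
        obtain rfl : v = 0 := hv
        exact ⟨expMap_zero p, rfl⟩
      rw [(f v₁ e1).2, (f v₂ e2).2, ← (f v₁ e1).1, ← (f v₂ e2).1, heq]
    · obtain ⟨w₁, hw₁, hw₁1, hv₁, he₁⟩ := exists_unit_normal h₁ hpos
      obtain ⟨w₂, hw₂, hw₂1, hv₂, he₂⟩ := exists_unit_normal h₂ (hn ▸ hpos)
      rw [← hn] at he₂ hv₂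
      set s := ‖v₁.2‖ with hs
      set W₁ : TangentBundle (𝓡 n) M := ⟨v₁.proj, w₁⟩ with hW₁
      set W₂ : TangentBundle (𝓡 n) M := ⟨v₂.proj, w₂⟩ with hW₂
      set γ : ℝ → M := fun t => geod W₂ (t + s) with hγ
      have hγg : ∀ t, GeodesicAt n γ t := fun t => GeodesicAt.shift (geodesicAt_geod W₂ _)
      have hγ0 : velocity n γ 0 = velocity n (geod W₂) s := by
        rw [hγ, velocity_shift (geodesicAt_geod W₂ _), zero_add]
      have hn₁ : ‖(velocity n (geod W₁) s).2‖ = 1 := (norm_velocity_geod W₁ s).trans hw₁1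
      have hn₂ : ‖(velocity n (geod W₂) s).2‖ = 1 := (norm_velocity_geod W₂ s).trans hw₂1
      have hend : geod W₁ s = geod W₂ s := by rw [← he₁, ← he₂, heq]
      -- Equal velocities at the meeting point would, flowing back for time `s`, give equal initial
      -- vectors.
      have hvne : velocity n (geod W₂) s ≠ velocity n (geod W₁) s := by
        intro hv
        apply hne
        have e1 := velocity_geod_add W₁ s (-s)
        have e2 := velocity_geod_add W₂ s (-s)
        rw [neg_add_cancel, velocity_geod_zero] at e1 e2
        have e3 : W₁ = W₂ := by rw [← e1, ← e2, hv]
        have f : ∀ (v : TangentBundle (𝓡 n) M) (w : TangentSpace (𝓡 n) v.proj),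
            v.2 = s • w → v = ⟨v.proj, s • w⟩ := fun v w h => TotalSpace.ext rfl (heq_of_eq h)
        have e4 : (⟨W₁.proj, s • W₁.2⟩ : TangentBundle (𝓡 n) M) = ⟨W₂.proj, s • W₂.2⟩ := by
          rw [e3]
        exact (f v₁ w₁ hv₁).trans (e4.trans (f v₂ w₂ hv₂).symm)
      obtain ⟨u, hu, hu1⟩ : ∃ u : TangentSpace (𝓡 n) (geod W₂ s),
          velocity n (geod W₁) s = ⟨geod W₂ s, u⟩ ∧ ‖u‖ = 1 := by
        have key : ∀ (p q : M) (u : TangentSpace (𝓡 n) p), p = q → ‖u‖ = 1 →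
            ∃ u' : TangentSpace (𝓡 n) q,
              (⟨p, u⟩ : TangentBundle (𝓡 n) M) = ⟨q, u'⟩ ∧ ‖u'‖ = 1 := by
          rintro p q u rfl h
          exact ⟨u, rfl, h⟩
        exact key _ _ _ hend hn₁
      have huv : (velocity n (geod W₂) s).2 ≠ u := by
        intro h
        apply hvne
        rw [hu, ← h]
        rfl
      -- The first geodesic is prolonged by `t < r - s`, so that the new radius `t + s` is still
      -- below `r`.
      obtain ⟨δ, hδ, t, ht, hlt⟩ := exists_shortcut hγg (hγ0.trans rfl) hn₂ hu1 huv hpos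
        (sub_pos.2 hr₁)
      rw [← hu, geod_add] at hlt
      have hst : 0 < t + s := by linarith [ht.1]
      refine (ballRadius_le_of_dist_lt (x := v₂.proj) hst h₁.1 h₂.1 hw₁ hw₁1 ?_).trans
        (ENNReal.ofReal_le_ofReal (by linarith [ht.2]))
      -- The path from the second foot to the new centre: length at most `s - δ` along its own
      -- geodesic, then a shortcut of length less than `δ + t`.
      have h3 := dist_geod_le W₂ (s := 0) (t := -δ + s) (by linarith [hδ.2])
      have h4 : ‖W₂.2‖ = 1 := hw₂1
      rw [geod_zero, h4, one_mul] at h3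
      refine (dist_triangle _ (geod W₂ (-δ + s)) _).trans_lt ?_
      have h5 : dist (geod W₂ (-δ + s)) (geod W₁ (t + s)) < δ + t := hlt
      have h6 : dist v₂.proj (geod W₂ (-δ + s)) ≤ -δ + s - 0 := h3
      linarith
  · exact (ballRadius_le_of_norm_lt h₂ h₁ heq.symm hlt).trans (ENNReal.ofReal_le_ofReal hr₁.le)

/-- At any radius strictly between the thickness and a larger ball radius, injectivity would fail,
and this failure bounds the ball radius by that same radius. -/
theorem ballRadius_le_thickness (K : C1Submanifold n k M) : K.ballRadius ≤ K.thickness := by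
  by_contra hlt
  push Not at hlt
  obtain ⟨r, h1, h2⟩ := ENNReal.lt_iff_exists_nnreal_btwn.1 hlt
  have hr : (0 : ℝ) < r := by
    have : (0 : ℝ≥0∞) < r := zero_le.trans_lt h1
    exact_mod_cast this
  have hinj : ¬ InjOn expMap {v | v ∈ K.normalBundle ∧ ‖v.2‖ < r} := by
    intro hinj
    refine absurd h1 (not_lt.2 ?_)
    have : ENNReal.ofReal r ≤ K.thickness :=
      le_iSup_of_le (r : ℝ) (le_iSup_of_le hr (le_iSup_of_le hinj le_rfl))
    rwa [ENNReal.ofReal_coe_nnreal] at this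
  have h3 := ballRadius_le_of_not_injOn hinj
  rw [ENNReal.ofReal_coe_nnreal] at h3
  exact absurd h2 (not_lt.2 h3)

end Radius

/-! ### Unit normals to nearby planes -/

section GrassmannConvergence

variable {n k : ℕ} {M : Type*} [TopologicalSpace M] [ChartedSpace (EuclideanSpace ℝ (Fin n)) M]
  [IsManifold (𝓡 n) ∞ M]
  [RiemannianBundle (fun x : M => TangentSpace (𝓡 n) x)]
  [IsContMDiffRiemannianBundle (𝓡 n) ∞ (EuclideanSpace ℝ (Fin n))
    (fun x : M => TangentSpace (𝓡 n) x)]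

theorem GrassmannBundle.continuous_toEnd :
    Continuous[GrassmannBundle.topology n k M, inferInstance]
      (GrassmannBundle.toEnd (n := n) (k := k) (M := M)) :=
  continuous_induced_dom

/-- The vector field near `p` with constant coordinates `u`. -/
def constField (p : M) (u : Euc n) (b : M) : TangentSpace (𝓡 n) b :=
  (chartFrame p (extChartAt (𝓡 n) p b) u : Euc n)

theorem constField_eq {p b : M} (hb : b ∈ (chartAt (Euc n) p).source) (u : Euc n) :
    (⟨b, constField p u b⟩ : TangentBundle (𝓡 n) M) =
      tangentChartSymm p (extChartAt (𝓡 n) p b, u) :=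
  TotalSpace.ext ((extChartAt (𝓡 n) p).left_inv (by simpa using hb)).symm HEq.rfl

/-- Unit vectors normal to a plane extend to unit vectors normal to the nearby planes. -/
theorem GrassmannBundle.eventually_exists_unit_normal {p : M}
    (P : Submodule ℝ (TangentSpace (𝓡 n) p)) (hP : Module.finrank ℝ P = k)
    {w : TangentSpace (𝓡 n) p} (hw : w ∈ Pᗮ) (hw1 : ‖w‖ = 1)
    {O : Set (TangentBundle (𝓡 n) M)} (hO : O ∈ 𝓝 (⟨p, w⟩ : TangentBundle (𝓡 n) M)) :
    ∀ᶠ V : GrassmannBundle n k M in @nhds _ (GrassmannBundle.topology n k M) ⟨p, P, hP⟩,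
      ∃ w' ∈ V.planeᗮ, ‖w'‖ = 1 ∧ (⟨V.base, w'⟩ : TangentBundle (𝓡 n) M) ∈ O := by
  let : TopologicalSpace (GrassmannBundle n k M) := GrassmannBundle.topology n k M
  set V₀ : GrassmannBundle n k M := ⟨p, P, hP⟩ with hV₀
  have hps : p ∈ (chartAt (Euc n) p).source := mem_chart_source _ _
  have hend : ContinuousAt (GrassmannBundle.toEnd (n := n) (k := k) (M := M)) V₀ :=
    GrassmannBundle.continuous_toEnd.continuousAt
  have hbase : ContinuousAt (fun V : GrassmannBundle n k M => V.base) V₀ :=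
    ContinuousAt.comp (f := GrassmannBundle.toEnd (n := n) (k := k) (M := M))
      (FiberBundle.continuous_proj _ _).continuousAt hend
  have hsrc : ∀ᶠ V : GrassmannBundle n k M in 𝓝 V₀, V.base ∈ (chartAt (Euc n) p).source :=
    hbase.preimage_mem_nhds ((chartAt (Euc n) p).open_source.mem_nhds hps)
  -- The vector `w` is extended with constant coordinates; its projection to the plane `V` is
  -- subtracted, and the result is normalised.
  set u₀ : Euc n := (tangentChart p (⟨p, w⟩ : TangentBundle (𝓡 n) M)).2 with hu₀
  have he : ContinuousAt (fun V : GrassmannBundle n k M => extChartAt (𝓡 n) p V.base) V₀ :=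
    ContinuousAt.comp (f := fun V : GrassmannBundle n k M => V.base)
      (continuousAt_extChartAt p) hbase
  have hsymm : ∀ z : Euc n × Euc n, z.1 ∈ (extChartAt (𝓡 n) p).target →
      ContinuousAt (tangentChartSymm (n := n) p) z := fun z hz =>
    (continuousOn_tangentChartSymm p).continuousAt
      (((isOpen_extChartAt_target p).prod isOpen_univ).mem_nhds ⟨hz, mem_univ _⟩)
  have hfield : ContinuousAt (fun V : GrassmannBundle n k M =>
      (⟨V.base, constField p u₀ V.base⟩ : TangentBundle (𝓡 n) M)) V₀ := by
    refine ContinuousAt.congr (f := fun V : GrassmannBundle n k M =>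
      tangentChartSymm p (extChartAt (𝓡 n) p V.base, u₀)) ?_ ?_
    · exact ContinuousAt.comp (f := fun V : GrassmannBundle n k M =>
        (extChartAt (𝓡 n) p V.base, u₀)) (hsymm _ (mem_extChartAt_target p))
        (he.prodMk continuousAt_const)
    · filter_upwards [hsrc] with V hV using (constField_eq hV u₀).symm
  have hfield₀ : constField p u₀ p = w := by
    have h1 := constField_eq hps u₀
    have h2 : ((extChartAt (𝓡 n) p) p, u₀) = tangentChart p (⟨p, w⟩ : TangentBundle (𝓡 n) M) := rfl
    rw [h2, tangentChartSymm_tangentChart hps] at h1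
    exact TotalSpace.mk_inj.1 h1
  have hproj : ContinuousAt (fun V : GrassmannBundle n k M =>
      (⟨V.base, V.plane.starProjection (constField p u₀ V.base)⟩ : TangentBundle (𝓡 n) M)) V₀ :=
    ContinuousAt.clm_bundle_apply (F₁ := Euc n) (F₂ := Euc n)
      (E₁ := fun x : M => TangentSpace (𝓡 n) x) (E₂ := fun x : M => TangentSpace (𝓡 n) x)
      (b := fun V : GrassmannBundle n k M => V.base)
      (ϕ := fun V : GrassmannBundle n k M => V.plane.starProjection)
      (v := fun V : GrassmannBundle n k M => constField p u₀ V.base) hend hfield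
  -- Coordinates of the tangential part of the extended vector. They are continuous because the
  -- topology is induced by the projections, and they vanish at `V₀` because `w` is normal there.
  set A : GrassmannBundle n k M → Euc n := fun V =>
    (tangentChart p (⟨V.base, V.plane.starProjection (constField p u₀ V.base)⟩ :
      TangentBundle (𝓡 n) M)).2 with hA
  have hAc : ContinuousAt A V₀ := by
    have h1 : ContinuousAt (tangentChart (n := n) p)
        (⟨V₀.base, V₀.plane.starProjection (constField p u₀ V₀.base)⟩ : TangentBundle (𝓡 n) M) :=
      (continuousOn_tangentChart p).continuousAt
        (((chartAt (Euc n) p).open_source.preimage (FiberBundle.continuous_proj _ _)).mem_nhds hps)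
    have h2 : ContinuousAt (fun V : GrassmannBundle n k M =>
        tangentChart p (⟨V.base, V.plane.starProjection (constField p u₀ V.base)⟩ :
          TangentBundle (𝓡 n) M)) V₀ := Tendsto.comp h1 hproj
    exact h2.snd
  have hA₀ : A V₀ = 0 := by
    have h1 : V₀.plane.starProjection (constField p u₀ V₀.base) = 0 := by
      rw [show constField p u₀ V₀.base = w from hfield₀]
      exact (Submodule.starProjection_apply_eq_zero_iff P).2 hw
    simp only [hA, tangentChart]
    rw [h1]
    exact map_zero _
  set z : GrassmannBundle n k M → Euc n := fun V => u₀ - A V with hz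
  have hzc : ContinuousAt z V₀ := continuousAt_const.sub hAc
  have hz₀ : z V₀ = u₀ := by simp only [hz, hA₀, sub_zero]
  -- The length of the corrected vector, equal to `1` at `V₀`, so the division is harmless nearby.
  set N : GrassmannBundle n k M → ℝ := fun V =>
    Real.sqrt (metricForm p (extChartAt (𝓡 n) p V.base) (z V) (z V)) with hN
  have hNc : ContinuousAt N V₀ := by
    have h1 : ContinuousAt (fun V : GrassmannBundle n k M =>
        metricForm (n := n) p (extChartAt (𝓡 n) p V.base)) V₀ :=
      Tendsto.comp (g := metricForm (n := n) p)
        (contDiffAt_metricForm (mem_extChartAt_target p)).continuousAt he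
    exact ((h1.clm_apply hzc).clm_apply hzc).sqrt
  have hW₀ : tangentChartSymm p (extChartAt (𝓡 n) p p, u₀) = (⟨p, w⟩ : TangentBundle (𝓡 n) M) :=
    tangentChartSymm_tangentChart (v := (⟨p, w⟩ : TangentBundle (𝓡 n) M)) hps
  have hN₀ : N V₀ = 1 := by
    have h1 : metricForm p (extChartAt (𝓡 n) p p) u₀ u₀ = 1 := by
      have h2 := norm_tangentChartSymm_sq p (extChartAt (𝓡 n) p p, u₀)
      rw [hW₀] at h2
      rw [← h2]
      have h3 : ‖w‖ ^ 2 = 1 := by rw [hw1, one_pow]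
      exact h3
    simp only [hN, hz₀]
    change Real.sqrt (metricForm p (extChartAt (𝓡 n) p p) u₀ u₀) = 1
    rw [h1, Real.sqrt_one]
  have hNinv : ContinuousAt (fun V => (N V)⁻¹) V₀ := hNc.inv₀ (by rw [hN₀]; exact one_ne_zero)
  have hfinal : ContinuousAt (fun V : GrassmannBundle n k M =>
      tangentChartSymm p (extChartAt (𝓡 n) p V.base, (N V)⁻¹ • z V)) V₀ :=
    ContinuousAt.comp (f := fun V : GrassmannBundle n k M =>
      (extChartAt (𝓡 n) p V.base, (N V)⁻¹ • z V)) (hsymm _ (mem_extChartAt_target p))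
      (he.prodMk (hNinv.smul hzc))
  have hO' : O ∈ 𝓝 (tangentChartSymm p (extChartAt (𝓡 n) p V₀.base, (N V₀)⁻¹ • z V₀)) := by
    rw [hN₀, hz₀, inv_one, one_smul]
    change O ∈ 𝓝 (tangentChartSymm p (extChartAt (𝓡 n) p p, u₀))
    rwa [hW₀]
  have hNpos : ∀ᶠ V in 𝓝 V₀, 0 < N V :=
    hNc.eventually_const_lt (by rw [hN₀]; exact one_pos)
  filter_upwards [hsrc, hfinal.preimage_mem_nhds hO', hNpos] with V hV hVO hVN
  have hlin : constField p (z V) V.base =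
      constField p u₀ V.base - V.plane.starProjection (constField p u₀ V.base) := by
    have h1 : constField p (A V) V.base = V.plane.starProjection (constField p u₀ V.base) :=
      chartFrame_mfderiv_chart hV (V.plane.starProjection (constField p u₀ V.base))
    rw [← h1]
    exact map_sub (chartFrame p (extChartAt (𝓡 n) p V.base)) u₀ (A V)
  have hsmul : constField p ((N V)⁻¹ • z V) V.base = (N V)⁻¹ • constField p (z V) V.base :=
    map_smul (chartFrame p (extChartAt (𝓡 n) p V.base)) (N V)⁻¹ (z V)
  have heq := constField_eq hV ((N V)⁻¹ • z V)
  refine ⟨constField p ((N V)⁻¹ • z V) V.base, ?_, ?_, ?_⟩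
  · rw [hsmul, hlin]
    exact Submodule.smul_mem _ _ (Submodule.sub_starProjection_mem_orthogonal _)
  · have h1 := norm_tangentChartSymm_sq p (extChartAt (𝓡 n) p V.base, z V)
    rw [← constField_eq hV] at h1
    have h2 : ‖constField p (z V) V.base‖ = N V := by
      rw [hN]
      simp only
      rw [← h1, Real.sqrt_sq (norm_nonneg _)]
    refine (congrArg norm hsmul).trans ((norm_smul _ _).trans ?_)
    rw [h2, norm_inv, Real.norm_of_nonneg hVN.le, inv_mul_cancel₀ hVN.ne']
  · rw [heq]
    exact hVO

end GrassmannConvergence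

/-! ### Upper semicontinuity -/

section Semicontinuity

variable {n k : ℕ} {M : Type*} [MetricSpace M] [ChartedSpace (EuclideanSpace ℝ (Fin n)) M]
  [IsManifold (𝓡 n) ∞ M]
  [RiemannianBundle (fun x : M => TangentSpace (𝓡 n) x)]
  [IsContMDiffRiemannianBundle (𝓡 n) ∞ (EuclideanSpace ℝ (Fin n))
    (fun x : M => TangentSpace (𝓡 n) x)]
  [IsRiemannianManifold (𝓡 n) M] [CompleteSpace M]

/-- Scaling the vector by `r` amounts to flowing for time `r`, so continuity of the geodesic flow
applies. -/
theorem continuous_smul_expMap (r : ℝ) :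
    Continuous fun v : TangentBundle (𝓡 n) M =>
      expMap (⟨v.proj, r • v.2⟩ : TangentBundle (𝓡 n) M) := by
  have h : (fun v : TangentBundle (𝓡 n) M =>
      expMap (⟨v.proj, r • v.2⟩ : TangentBundle (𝓡 n) M)) =
      fun v => (velocity n (geod v) r).proj := funext fun v => expMap_smul v.proj v.2 r
  rw [h]
  exact (FiberBundle.continuous_proj (Euc n) _).comp (continuous_velocity_geod_left r)

/-- The ball is open, so the membership witnessing `r` survives a small move of `x`, of `p` and of
the unit normal. The diffeomorphism supplies the moved points, and closeness of tangent planes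
supplies the normal. -/
theorem eventually_ballRadius_le {dG : MetricSpace (GrassmannBundle n k M)}
    (hdG : dG.toUniformSpace.toTopologicalSpace = GrassmannBundle.topology n k M)
    {K : C1Submanifold n k M} {Kseq : ℕ → C1Submanifold n k M}
    (hconv : Tendsto (fun j => c1Dist dG K (Kseq j)) atTop (𝓝 0)) {r : ℝ} (hr : 0 < r)
    (hne : (K.ballUnion r ∩ K.carrier).Nonempty) :
    ∀ᶠ j in atTop, (Kseq j).ballRadius ≤ ENNReal.ofReal r := by
  obtain ⟨x, ⟨p, hp, w, hw, hw1, hx⟩, hxK⟩ := hne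
  have hx' : dist x (expMap (⟨p, r • w⟩ : TangentBundle (𝓡 n) M)) < r := Metric.mem_ball.1 hx
  have hcont : ContinuousAt (fun a : M × TangentBundle (𝓡 n) M =>
      dist a.1 (expMap (⟨a.2.proj, r • a.2.2⟩ : TangentBundle (𝓡 n) M))) (x, ⟨p, w⟩) :=
    (continuous_fst.dist ((continuous_smul_expMap r).comp continuous_snd)).continuousAt
  obtain ⟨U, hU, O, hO, hUO⟩ := mem_nhds_prod_iff.1 (hcont.eventually_lt_const hx')
  have hplane := GrassmannBundle.eventually_exists_unit_normal (K.tangent p) (K.finrank_tangent hp)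
    hw hw1 hO
  rw [← hdG] at hplane
  obtain ⟨ε₁, hε₁, hplane⟩ := (@Metric.eventually_nhds_iff _ dG.toPseudoMetricSpace _ _).1 hplane
  obtain ⟨ε₂, hε₂, hball⟩ := Metric.mem_nhds_iff.1 hU
  have hε : 0 < ENNReal.ofReal (min ε₁ ε₂) := ENNReal.ofReal_pos.2 (lt_min hε₁ hε₂)
  filter_upwards [hconv.eventually_lt_const hε] with j hj
  simp only [c1Dist, iInf_lt_iff] at hj
  obtain ⟨ψ, hψ, hlt⟩ := hj
  -- The supremum over `K` bounds each term, so one diffeomorphism controls both the position at `x`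
  -- and the tangent plane at `p`.
  have hall : ∀ y : K.carrier, dist (y : M) (ψ y) +
      dG.dist (K.gauss y) ((Kseq j).gauss ⟨ψ y, hψ.1 y.2⟩) < min ε₁ ε₂ := fun y =>
    (ENNReal.ofReal_lt_ofReal_iff (lt_min hε₁ hε₂)).1 ((le_iSup
      (fun y : K.carrier => ENNReal.ofReal (dist (y : M) (ψ y) +
        dG.dist (K.gauss y) ((Kseq j).gauss ⟨ψ y, hψ.1 y.2⟩))) y).trans_lt hlt)
  have hGnn : ∀ V W : GrassmannBundle n k M, 0 ≤ dG.dist V W := fun V W =>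
    @dist_nonneg _ dG.toPseudoMetricSpace V W
  have hxψ : ψ x ∈ U := by
    apply hball
    rw [Metric.mem_ball, dist_comm]
    have h1 := hall ⟨x, hxK⟩
    have h2 := hGnn (K.gauss ⟨x, hxK⟩) ((Kseq j).gauss ⟨ψ x, hψ.1 hxK⟩)
    have h3 := min_le_right ε₁ ε₂
    simp only at h1
    linarith
  have hpψ : dG.dist ((Kseq j).gauss ⟨ψ p, hψ.1 hp⟩) (K.gauss ⟨p, hp⟩) < ε₁ := by
    rw [dG.dist_comm]
    have h1 := hall ⟨p, hp⟩
    have h2 : 0 ≤ dist p (ψ p) := dist_nonneg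
    have h3 := min_le_left ε₁ ε₂
    simp only at h1
    linarith
  obtain ⟨w', hw', hw'1, hw'O⟩ := hplane hpψ
  refine ballRadius_le_of_dist_lt (p := ψ p) (x := ψ x) hr (hψ.1 hp) (hψ.1 hxK) hw' hw'1 ?_
  have h4 : dist (ψ x) (expMap (⟨ψ p, r • w'⟩ : TangentBundle (𝓡 n) M)) < r :=
    hUO (mk_mem_prod hxψ hw'O)
  exact (congrArg (dist (ψ x)) (expMap_smul (ψ p) w' r)).symm.trans_lt h4

theorem limsup_ballRadius_le {dG : MetricSpace (GrassmannBundle n k M)}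
    (hdG : dG.toUniformSpace.toTopologicalSpace = GrassmannBundle.topology n k M)
    {K : C1Submanifold n k M} {Kseq : ℕ → C1Submanifold n k M}
    (hconv : Tendsto (fun j => c1Dist dG K (Kseq j)) atTop (𝓝 0)) :
    limsup (fun j => (Kseq j).ballRadius) atTop ≤ K.ballRadius :=
  le_iInf fun _ => le_iInf fun hr => le_iInf fun hne =>
    limsup_le_of_le (h := eventually_ballRadius_le hdG hconv hr hne)

end Semicontinuity

end

end RiemThick

/-- Upper semicontinuity of the ball radius and of the thickness under `C¹` convergence of compact
submanifolds of a complete Riemannian manifold. -/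
theorem proposition2 {n k : ℕ} {M : Type*} [MetricSpace M]
    [ChartedSpace (EuclideanSpace ℝ (Fin n)) M] [IsManifold (𝓡 n) ∞ M]
    [RiemannianBundle (fun x : M => TangentSpace (𝓡 n) x)]
    [IsContMDiffRiemannianBundle (𝓡 n) ∞ (EuclideanSpace ℝ (Fin n))
      (fun x : M => TangentSpace (𝓡 n) x)]
    [IsRiemannianManifold (𝓡 n) M] [CompleteSpace M]
    (dG : MetricSpace (RiemThick.GrassmannBundle n k M))
    (hdG : dG.toUniformSpace.toTopologicalSpace = RiemThick.GrassmannBundle.topology n k M)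
    (K : RiemThick.C1Submanifold n k M) (Kseq : ℕ → RiemThick.C1Submanifold n k M)
    (hK : IsCompact K.carrier) (hKseq : ∀ j, IsCompact (Kseq j).carrier)
    (hconv : Tendsto (fun j => RiemThick.c1Dist dG K (Kseq j)) atTop (𝓝 0)) :
    limsup (fun j => (Kseq j).ballRadius) atTop ≤ K.ballRadius ∧
      limsup (fun j => (Kseq j).thickness) atTop ≤ K.thickness := by
  have h := RiemThick.limsup_ballRadius_le hdG hconv
  refine ⟨h, le_trans ?_ (h.trans (RiemThick.ballRadius_le_thickness K))⟩
  exact limsup_le_limsup (Eventually.of_forall fun j =>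
    RiemThick.thickness_le_ballRadius (hKseq j))
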